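/- Let $\lambda_0,\dots,\lambda_3$ be complex numbers of modulus one whose squares are pairwise distinct. Let $\mathcal A$ be the quadratic algebra $T(V)/(R)$ on generators $z_0,\dots,z_3$ (a basis of $V$), with $R\subset V\otimes V$ spanned by $$\lambda_0z_kz_0-\lambda_kz_0z_k+\lambda_mz_lz_m-\lambda_lz_mz_l,\qquad -\lambda_kz_kz_0+\lambda_0z_0z_k+\lambda_lz_lz_m-\lambda_mz_mz_l,$$ $(k,l,m)$ running over the circular permutations of $(1,2,3)$. For a quadratic element $c$, $\mathcal A/(c-1)$ is the sphere algebra with inhomogeneous relation $c=1$; for $c=C=\sum\lambda_\mu z_\mu^2$ it is the algebra of the non-commutative three-sphere. The adjunction is the antilinear anti-multiplicative involution with $z_\mu^*=\lambda_\mu z_\mu$. Let $E\subset\mathbb P(V^*)$ be the elliptic curve $\sum y_\mu^2=\sum\lambda_\mu^2y_\mu^2=0$, and $j(y)_\mu=\overline{\lambda_\mu y_\mu}$, which maps $E$ to $E$. 1. $E$ is uncountable, and there is a bijection $\sigma$ of $E$ such that, for $Z\in E$ and $Z'\in\mathbb P(V^*)$, one has $\omega(Z,Z')=0$ for all $\omega\in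 R$ if and only if $Z'=\sigma(Z)$. It satisfies $j\sigma=\sigma^{-1}j$. 2. Every quadratic element of $\mathcal A$ is $\sum Q_{ij}z_iz_j$ for a unique symmetric matrix $Q$. If it is central in $\mathcal A$, then $Q(y,y')=\sum Q_{ij}y_iy'_j$ is a central quadratic form: for all $\omega\in R$ and $Z,Z'\in E$, $$\omega(Z,Z')\,Q(\sigma(Z'),\sigma^{-1}(Z))+\omega(\sigma(Z'),\sigma^{-1}(Z))\,Q(Z,Z')=0 .$$ Suppose from now on that $\sigma^4\neq\mathrm{id}$. Put $\tilde\sigma(Z,Z')=(\sigma(Z),\sigma^{-1}(Z'))$ and $\tilde j(Z,Z')=(j(Z'),j(Z))$. Let $\mathcal L$ be the bundle on $E$ whose sections include the linear forms $Y\in V$. For a symmetric $Q$ and $X\subset E\times E$, let $\mathcal C_Q(X)$ be the cross product of sections of line bundles over the $\tilde\sigma$-orbits contained in $X$ on which $Q$ does not vanish: the algebra of finite sums $\sum_n f_nW^n$ with $Wf=(f\circ\tilde\sigma)W$ and $W^*=W^{-1}$. Here $f_n$ is a regular section (poles being allowed only where some $Q\circ\tilde\sigma^k$ vanishes) of the product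 of the pullbacks of $\mathcal L$ by $1,\sigma,\dots,\sigma^{n-1}$ in the variable $Z$ if $n\ge0$, and by $\sigma,\dots,\sigma^{-n}$ in the variable $Z'$ if $n<0$; the product of $\mathcal L$ on $Z$ and $\mathcal L$ on $Z'$ is trivialized by dividing by $Q(Z,Z')$. If $X$ is invariant by $\tilde j$ and $Q(\tilde j(Z,Z'))=\overline{Q(Z,Z')}$, the adjunction of $\mathcal C_Q(X)$ is $(\sum f_nW^n)^*=\sum W^{-n}f_n^*$, with $f^*$ the complex conjugate of $f\circ\tilde j$. 3. Let $Q\neq0$ be the symmetric matrix of a central quadratic element of $\mathcal A$. For all $Z\in E$ outside a countable set, $Q$ is non-zero at every point of the orbit of $(Z,Z')$ for all $Z'\in E$ outside a countable set. The formula $\rho(Y)=Y(Z)W+W^*Y(Z')$ $(Y\in V)$ defines a representation of the algebra $\mathcal A/(\frac12\sum Q_{ij}z_iz_j-1)$ in $\mathcal C_Q(E\times E)$; thus $\frac12\sum Q_{ij}z_iz_j$ is represented by $1$. It is a $*$-representation if $Q(\tilde j(Z,Z'))=\overline{Q(Z,Z')}$ on $E\times E$. 4. If moreover $Q(\tilde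 j(Z,Z'))=\overline{Q(Z,Z')}$ and $Q(Z,j(Z))>0$ on $E$, the same formula defines a $*$-representation of the same algebra in $\mathcal C_Q(X)$, where $X=\{(Z,j(Z)):Z\in E\}$. 5. The matrix $Q=\mathrm{diag}(2\lambda_0,\dots,2\lambda_3)$, for which $\frac12\sum Q_{ij}z_iz_j=C$, is the matrix of a central quadratic element of $\mathcal A$ and satisfies the two conditions of 4. The same formula defines a faithful $*$-representation of the algebra $\mathcal A/(C-1)$ of the non-commutative three-sphere in $\mathcal C_Q(\{(Z,j(Z))\})$. -/

import Mathlib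

open scoped BigOperators

noncomputable section

namespace NCSphere

/-! ### The quadratic algebra and the sphere algebras -/

/-- The linear element `∑ Y_μ x_μ` of an algebra with distinguished elements `x_μ`. -/
def lin {A : Type*} [Ring A] [Algebra ℂ A] (x : Fin 4 → A) (Y : Fin 4 → ℂ) : A :=
  ∑ μ, Y μ • x μ

/-- The quadratic element `∑ c_ij x_i x_j`. -/
def quad {A : Type*} [Ring A] [Algebra ℂ A] (x : Fin 4 → A) (c : Matrix (Fin 4) (Fin 4) ℂ) : A :=
  ∑ i, ∑ j, c i j • (x i * x j)

/-- The bilinear form `∑ c_ij y_i y'_j` on `ℂ⁴`, the dual of the space of generators. -/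
def ev (c : Matrix (Fin 4) (Fin 4) ℂ) (y y' : Fin 4 → ℂ) : ℂ :=
  ∑ i, ∑ j, c i j * y i * y' j

/-- `λ₀ z_k z_0 - λ_k z_0 z_k + λ_m z_l z_m - λ_l z_m z_l` -/
def relA (lam : Fin 4 → Circle) (k l m : Fin 4) : Matrix (Fin 4) (Fin 4) ℂ :=
  Matrix.single k 0 (lam 0 : ℂ) - Matrix.single 0 k (lam k : ℂ)
    + Matrix.single l m (lam m : ℂ) - Matrix.single m l (lam l : ℂ)

/-- `-λ_k z_k z_0 + λ₀ z_0 z_k + λ_l z_l z_m - λ_m z_m z_l` -/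
def relB (lam : Fin 4 → Circle) (k l m : Fin 4) : Matrix (Fin 4) (Fin 4) ℂ :=
  - Matrix.single k 0 (lam k : ℂ) + Matrix.single 0 k (lam 0 : ℂ)
    + Matrix.single l m (lam l : ℂ) - Matrix.single m l (lam m : ℂ)

/-- The space `R ⊆ V ⊗ V` of quadratic relations, spanned by the two relations above for
`(k, l, m)` a circular permutation of `(1, 2, 3)`. -/
def relSpace (lam : Fin 4 → Circle) : Submodule ℂ (Matrix (Fin 4) (Fin 4) ℂ) :=
  Submodule.span ℂ {relA lam 1 2 3, relA lam 2 3 1, relA lam 3 1 2,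
    relB lam 1 2 3, relB lam 2 3 1, relB lam 3 1 2}

/-- The defining relations `ω = 0`, `ω ∈ R`, in the free algebra. -/
def quadRel (lam : Fin 4 → Circle) (a b : FreeAlgebra ℂ (Fin 4)) : Prop :=
  b = 0 ∧ ∃ ω ∈ relSpace lam, a = quad (FreeAlgebra.ι ℂ) ω

/-- The quadratic algebra `T(V) / (R)`. -/
abbrev QuadAlg (lam : Fin 4 → Circle) : Type := RingQuot (quadRel lam)

/-- The generators `z_μ` of the quadratic algebra. -/
def zQ (lam : Fin 4 → Circle) (μ : Fin 4) : QuadAlg lam :=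
  RingQuot.mkAlgHom ℂ (quadRel lam) (FreeAlgebra.ι ℂ μ)

/-- The inhomogeneous relation `∑ c_ij z_i z_j = 1`. -/
def sphereRel (lam : Fin 4 → Circle) (c : Matrix (Fin 4) (Fin 4) ℂ) (a b : QuadAlg lam) : Prop :=
  a = quad (zQ lam) c ∧ b = 1

/-- The quotient of the quadratic algebra by `∑ c_ij z_i z_j = 1`. -/
abbrev SphereAlg (lam : Fin 4 → Circle) (c : Matrix (Fin 4) (Fin 4) ℂ) : Type :=
  RingQuot (sphereRel lam c)

/-- The generators `z_μ` of the sphere algebra. -/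
def zS (lam : Fin 4 → Circle) (c : Matrix (Fin 4) (Fin 4) ℂ) (μ : Fin 4) : SphereAlg lam c :=
  RingQuot.mkAlgHom ℂ (sphereRel lam c) (zQ lam μ)

/-- `C = ∑ λ_μ z_μ²`; the algebra of the non-commutative three-sphere is
`SphereAlg lam (sphereForm lam)`. -/
def sphereForm (lam : Fin 4 → Circle) : Matrix (Fin 4) (Fin 4) ℂ :=
  Matrix.diagonal fun μ => (lam μ : ℂ)

/-- `q` is the symmetric matrix of a central quadratic element of the quadratic algebra. -/
def IsCentralQuad (lam : Fin 4 → Circle) (q : Matrix (Fin 4) (Fin 4) ℂ) : Prop :=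
  q.IsSymm ∧ quad (zQ lam) q ∈ Subalgebra.center ℂ (QuadAlg lam)

/-- `τ` is the adjunction of a `*`-algebra generated by the `z_μ`, with `z_μ^* = λ_μ z_μ`
(these properties determine `τ`). -/
structure IsAdjunction (lam : Fin 4 → Circle) {A : Type*} [Ring A] [Algebra ℂ A]
    (z : Fin 4 → A) (τ : A → A) : Prop where
  add : ∀ a b, τ (a + b) = τ a + τ b
  smul : ∀ (c : ℂ) (a : A), τ (c • a) = (starRingEnd ℂ) c • τ a
  mul : ∀ a b, τ (a * b) = τ b * τ a
  invol : ∀ a, τ (τ a) = a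
  gen : ∀ μ, τ (z μ) = (lam μ : ℂ) • z μ

/-! ### Geometric data -/

/-- The generic part of the characteristic variety: the intersection of the quadrics
`∑ y_μ² = 0` and `∑ λ_μ² y_μ² = 0` in `ℙ³`. -/
def curve (lam : Fin 4 → Circle) : Set (Projectivization ℂ (Fin 4 → ℂ)) :=
  {Z | ∀ y ∈ Z.submodule, ∑ μ, y μ ^ 2 = 0 ∧ ∑ μ, (lam μ : ℂ) ^ 2 * y μ ^ 2 = 0}

/-- The zero set `Γ ⊆ ℙ³ × ℙ³` of the relations. -/
def Gam (lam : Fin 4 → Circle) (Z Z' : Projectivization ℂ (Fin 4 → ℂ)) : Prop :=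
  ∀ ω ∈ relSpace lam, ∀ y ∈ Z.submodule, ∀ y' ∈ Z'.submodule, ev ω y y' = 0

/-- `σ` is the correspondence on the curve defined by `Γ`. -/
def IsCorrespondence (lam : Fin 4 → Circle) (σ : Equiv.Perm (curve lam)) : Prop :=
  ∀ (Z : curve lam) (Z' : Projectivization ℂ (Fin 4 → ℂ)), Gam lam Z Z' ↔ Z' = σ Z

/-- The antilinear map `y_μ ↦ conj (λ_μ y_μ)` of `ℂ⁴`. -/
def jV (lam : Fin 4 → Circle) : (Fin 4 → ℂ) →ₛₗ[starRingEnd ℂ] (Fin 4 → ℂ) where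
  toFun y := fun μ => (starRingEnd ℂ) ((lam μ : ℂ) * y μ)
  map_add' y y' := by ext μ; simp [mul_add]
  map_smul' c y := by ext μ; simp only [Pi.smul_apply, smul_eq_mul, map_mul]; ring

theorem jV_apply (lam : Fin 4 → Circle) (y : Fin 4 → ℂ) (μ : Fin 4) :
    jV lam y μ = (starRingEnd ℂ) ((lam μ : ℂ) * y μ) := rfl

theorem jV_injective (lam : Fin 4 → Circle) : Function.Injective (jV lam) := by
  intro y y' h
  ext μ
  have h1 := congrFun h μ
  rw [jV_apply, jV_apply] at h1
  exact mul_left_cancel₀ (Circle.coe_ne_zero _) ((starRingEnd ℂ).injective h1)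

theorem circle_mul_conj (u : Circle) : (u : ℂ) * (starRingEnd ℂ) (u : ℂ) = 1 := by
  rw [Complex.mul_conj, Circle.normSq_coe, Complex.ofReal_one]

theorem jV_mem_curve (lam : Fin 4 → Circle) (Z : Projectivization ℂ (Fin 4 → ℂ)) (hZ : Z ∈ curve lam) :
    Projectivization.map (jV lam) (jV_injective lam) Z ∈ curve lam := by
  induction Z using Projectivization.ind with
  | h v hv =>
    obtain ⟨h1, h2⟩ := hZ v (Submodule.mem_span_singleton_self v)
    intro y hy
    rw [Projectivization.map_mk, Projectivization.submodule_mk,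
      Submodule.mem_span_singleton] at hy
    obtain ⟨a, rfl⟩ := hy
    constructor
    · have : ∑ μ, (a • jV lam v) μ ^ 2
          = a ^ 2 * (starRingEnd ℂ) (∑ μ, (lam μ : ℂ) ^ 2 * v μ ^ 2) := by
        rw [map_sum, Finset.mul_sum]
        refine Finset.sum_congr rfl fun μ _ => ?_
        simp only [Pi.smul_apply, smul_eq_mul, jV_apply, map_mul, map_pow]
        ring
      rw [this, h2, map_zero, mul_zero]
    · have : ∑ μ, (lam μ : ℂ) ^ 2 * (a • jV lam v) μ ^ 2
          = a ^ 2 * (starRingEnd ℂ) (∑ μ, v μ ^ 2) := by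
        rw [map_sum, Finset.mul_sum]
        refine Finset.sum_congr rfl fun μ _ => ?_
        simp only [Pi.smul_apply, smul_eq_mul, jV_apply, map_mul, map_pow]
        have := circle_mul_conj (lam μ)
        calc _ = a ^ 2 * (((lam μ : ℂ) * (starRingEnd ℂ) (lam μ : ℂ)) ^ 2
              * (starRingEnd ℂ) (v μ) ^ 2) := by ring
          _ = _ := by rw [this]; ring
      rw [this, h1, map_zero, mul_zero]

/-- The complex conjugation `j` of the curve. -/
def jE (lam : Fin 4 → Circle) (Z : curve lam) : curve lam :=
  ⟨Projectivization.map (jV lam) (jV_injective lam) Z, jV_mem_curve lam Z Z.2⟩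

/-- `Q(j̃(Z, Z')) = conj Q(Z, Z')` on `E × E`, where `j̃(Z, Z') = (j(Z'), j(Z))`. -/
def IsReal (lam : Fin 4 → Circle) (q : Matrix (Fin 4) (Fin 4) ℂ) : Prop :=
  ∀ Z Z' : curve lam, ∀ y ∈ Z.1.submodule, ∀ y' ∈ Z'.1.submodule,
    ev q (jV lam y') (jV lam y) = (starRingEnd ℂ) (ev q y y')

/-- `Q(Z, j(Z)) > 0` on `E`. -/
def IsPositive (lam : Fin 4 → Circle) (q : Matrix (Fin 4) (Fin 4) ℂ) : Prop :=
  ∀ Z : curve lam, ∀ y ∈ Z.1.submodule, y ≠ 0 → ∃ r : ℝ, 0 < r ∧ ev q y (jV lam y) = r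

/-- The set of points `(Z, j(Z))` of `E × E`. -/
def realLocus (lam : Fin 4 → Circle) : Set (curve lam × curve lam) :=
  {x | x.2 = jE lam x.1}

/-- The central quadratic form equation
`ω(Z,Z') Q(σ(Z'),σ⁻¹(Z)) + ω(σ(Z'),σ⁻¹(Z)) Q(Z,Z') = 0` for all relations `ω` and all
`Z`, `Z'` on the curve; it is homogeneous in each of the four points. -/
def CentralEq (lam : Fin 4 → Circle) (σ : Equiv.Perm (curve lam))
    (q : Matrix (Fin 4) (Fin 4) ℂ) : Prop :=
  ∀ ω ∈ relSpace lam, ∀ Z Z' : curve lam,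
    ∀ y ∈ Z.1.submodule, ∀ y' ∈ Z'.1.submodule,
    ∀ u' ∈ (σ Z').1.submodule, ∀ u ∈ (σ⁻¹ Z).1.submodule,
      ev ω y y' * ev q u' u + ev ω u' u * ev q y y' = 0

/-! ### The cross product of sections of line bundles

Sections of the line bundles over `E × E` are described as equivariant functions on a frame
bundle. A frame over `(Z, Z')` consists of representatives `v_k` of `σ^k(Z)` and `v'_k` of
`σ^(-k)(Z')` for all `k ∈ ℤ`, normalised by `Q(v_k, v'_k) = 1`. A section of the pullback of `𝓛`
by `σ^k` in the variable `Z` is a function of frames which is homogeneous of degree one in `v_k`.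
Since `Q` trivialises the product of `𝓛` on the variables `Z` and `Z'`, a section of the pullback
of `𝓛` by `σ^(-k)` in the variable `Z'` is a function homogeneous of degree `-1` in `v_k`. -/

section CrossProduct

variable (lam : Fin 4 → Circle) (σ : Equiv.Perm (curve lam)) (q : Matrix (Fin 4) (Fin 4) ℂ)
  (X : Set (curve lam × curve lam))

/-- `σ̃^n`, where `σ̃(Z, Z') = (σ(Z), σ⁻¹(Z'))`. -/
def tw {lam : Fin 4 → Circle} (σ : Equiv.Perm (curve lam)) (n : ℤ)
    (x : curve lam × curve lam) : curve lam × curve lam :=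
  ((σ ^ n) x.1, (σ ^ (-n)) x.2)

/-- The frames over the `σ̃`-orbits contained in `X` on which `Q` does not vanish. -/
def frames : Set ((ℤ → Fin 4 → ℂ) × (ℤ → Fin 4 → ℂ)) :=
  {p | ∃ x : curve lam × curve lam, ∀ k : ℤ, tw σ k x ∈ X ∧
    p.1 k ∈ (tw σ k x).1.1.submodule ∧ p.2 k ∈ (tw σ k x).2.1.submodule ∧
    ev q (p.1 k) (p.2 k) = 1}

/-- The action of `σ̃^n` on frames. -/
def shift (n : ℤ) (p : frames lam σ q X) : frames lam σ q X :=
  ⟨(fun k => p.1.1 (k + n), fun k => p.1.2 (k + n)), by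
    obtain ⟨x, hx⟩ := p.2
    refine ⟨tw σ n x, fun k => ?_⟩
    have : tw σ k (tw σ n x) = tw σ (k + n) x := by
      simp only [tw, ← Equiv.Perm.mul_apply, ← zpow_add, neg_add]
    rw [this]
    exact hx (k + n)⟩

theorem ev_smul_smul (c : Matrix (Fin 4) (Fin 4) ℂ) (a b : ℂ) (y y' : Fin 4 → ℂ) :
    ev c (a • y) (b • y') = a * b * ev c y y' := by
  simp only [ev, Pi.smul_apply, smul_eq_mul, Finset.mul_sum]
  refine Finset.sum_congr rfl fun i _ => Finset.sum_congr rfl fun j _ => ?_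
  ring

/-- Rescaling of the `i`-th representatives: `v_i ↦ c v_i`, `v'_i ↦ c⁻¹ v'_i`. -/
def rescale (i : ℤ) (c : ℂˣ) (p : frames lam σ q X) : frames lam σ q X :=
  ⟨(fun k => (if k = i then (c : ℂ) else 1) • p.1.1 k,
    fun k => (if k = i then (c : ℂ)⁻¹ else 1) • p.1.2 k), by
    obtain ⟨x, hx⟩ := p.2
    refine ⟨x, fun k => ⟨(hx k).1, Submodule.smul_mem _ _ (hx k).2.1,
      Submodule.smul_mem _ _ (hx k).2.2.1, ?_⟩⟩
    rw [ev_smul_smul, (hx k).2.2.2]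
    split_ifs <;> simp⟩

/-- Functions of frames. -/
def Fn : Type := frames lam σ q X → ℂ

instance : CommRing (Fn lam σ q X) := inferInstanceAs (CommRing (frames lam σ q X → ℂ))

instance : Algebra ℂ (Fn lam σ q X) := inferInstanceAs (Algebra ℂ (frames lam σ q X → ℂ))

/-- The group `ℤ` acts on functions by `n • f = f ∘ σ̃^n`. -/
instance : MulSemiringAction (Multiplicative ℤ) (Fn lam σ q X) where
  smul g f := fun p => f (shift lam σ q X g.toAdd p)
  one_smul f := by
    funext p
    change f (shift lam σ q X 0 p) = f p
    congr 1
    apply Subtype.ext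
    simp [shift]
  mul_smul g h f := by
    funext p
    change f (shift lam σ q X (g.toAdd + h.toAdd) p)
      = f (shift lam σ q X h.toAdd (shift lam σ q X g.toAdd p))
    congr 1
    apply Subtype.ext
    refine Prod.ext (funext fun k => ?_) (funext fun k => ?_)
    · exact congrArg p.1.1 (by rw [add_comm g.toAdd, add_assoc])
    · exact congrArg p.1.2 (by rw [add_comm g.toAdd, add_assoc])
  smul_zero _ := rfl
  smul_add _ _ _ := rfl
  smul_one _ := rfl
  smul_mul _ _ _ := rfl

instance : SMulCommClass (Multiplicative ℤ) ℂ (Fn lam σ q X) := ⟨fun _ _ _ => rfl⟩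

/-- The function of frames `Y(v_k)`. -/
def fnZ (k : ℤ) (Y : Fin 4 → ℂ) : Fn lam σ q X := fun p => ∑ μ, Y μ * p.1.1 k μ

/-- The function of frames `Y(v'_k)`. -/
def fnZ' (k : ℤ) (Y : Fin 4 → ℂ) : Fn lam σ q X := fun p => ∑ μ, Y μ * p.1.2 k μ

/-- Regular functions of frames: polynomials in the coordinates of the `v_k` and `v'_k`. The
normalisation of frames allows poles along the divisors `Q ∘ σ̃^k = 0`. -/
def regular : Subalgebra ℂ (Fn lam σ q X) :=
  Algebra.adjoin ℂ ({f | ∃ k Y, f = fnZ lam σ q X k Y} ∪ {f | ∃ k Y, f = fnZ' lam σ q X k Y})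

/-- The degree in `v_i` of the coefficient of `W^n`: for `n ≥ 0` this is the product of the
pullbacks of `𝓛` by `1, σ, …, σ^(n-1)` in the variable `Z`, for `n < 0` the product of the
pullbacks of `𝓛` by `σ, …, σ^(-n)` in the variable `Z'`. -/
def wt (n i : ℤ) : ℤ :=
  if 0 ≤ i ∧ i < n then 1 else if n ≤ i ∧ i < 0 then -1 else 0

/-- Regular sections of the line bundle which carries the coefficient of `W^n`. -/
def sections (n : ℤ) : Submodule ℂ (Fn lam σ q X) where
  carrier := {f | f ∈ regular lam σ q X ∧
    ∀ (i : ℤ) (c : ℂˣ) (p : frames lam σ q X),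
      f (rescale lam σ q X i c p) = (c : ℂ) ^ wt n i * f p}
  zero_mem' := ⟨Subalgebra.zero_mem _, fun i c p => (mul_zero _).symm⟩
  add_mem' := fun {f g} hf hg => ⟨Subalgebra.add_mem _ hf.1 hg.1, fun i c p => by
    change f _ + g _ = _ * (f p + g p)
    rw [hf.2, hg.2, mul_add]⟩
  smul_mem' := fun a f hf => ⟨Subalgebra.smul_mem _ hf.1 a, fun i c p => by
    change a * f _ = _ * (a * f p)
    rw [hf.2]; ring⟩

theorem smul_fnZ (g : Multiplicative ℤ) (k : ℤ) (Y : Fin 4 → ℂ) :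
    g • fnZ lam σ q X k Y = fnZ lam σ q X (k + g.toAdd) Y := rfl

theorem smul_fnZ' (g : Multiplicative ℤ) (k : ℤ) (Y : Fin 4 → ℂ) :
    g • fnZ' lam σ q X k Y = fnZ' lam σ q X (k + g.toAdd) Y := rfl

theorem smul_mem_regular (g : Multiplicative ℤ) {f : Fn lam σ q X}
    (hf : f ∈ regular lam σ q X) : g • f ∈ regular lam σ q X := by
  induction hf using Algebra.adjoin_induction with
  | mem f hf =>
    rcases hf with ⟨k, Y, rfl⟩ | ⟨k, Y, rfl⟩
    · exact Algebra.subset_adjoin (Or.inl ⟨_, _, smul_fnZ lam σ q X g k Y⟩)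
    · exact Algebra.subset_adjoin (Or.inr ⟨_, _, smul_fnZ' lam σ q X g k Y⟩)
  | algebraMap r => exact Subalgebra.algebraMap_mem _ r
  | add f h _ _ h1 h2 => rw [smul_add]; exact Subalgebra.add_mem _ h1 h2
  | mul f h _ _ h1 h2 => rw [smul_mul']; exact Subalgebra.mul_mem _ h1 h2

theorem wt_add (m n i : ℤ) : wt (m + n) i = wt m i + wt n (i - m) := by
  unfold wt; split_ifs <;> omega

theorem shift_rescale (m i : ℤ) (c : ℂˣ) (p : frames lam σ q X) :
    shift lam σ q X m (rescale lam σ q X i c p)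
      = rescale lam σ q X (i - m) c (shift lam σ q X m p) := by
  apply Subtype.ext
  simp only [shift, rescale, eq_sub_iff_add_eq]

theorem mul_smul_mem_sections {m n : ℤ} {f g : Fn lam σ q X}
    (hf : f ∈ sections lam σ q X m) (hg : g ∈ sections lam σ q X n) :
    f * (Multiplicative.ofAdd m • g) ∈ sections lam σ q X (m + n) := by
  refine ⟨Subalgebra.mul_mem _ hf.1 (smul_mem_regular lam σ q X _ hg.1), fun i c p => ?_⟩
  change f _ * g (shift lam σ q X m _) = _ * (f p * g (shift lam σ q X m p))
  rw [hf.2, shift_rescale, hg.2, wt_add, zpow_add₀ c.ne_zero]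
  ring

/-- The cross product of all functions of frames with the action of `σ̃`: finite sums
`∑ f_n W^n` with `W f = (f ∘ σ̃) W`. -/
abbrev BigCross : Type := SkewMonoidAlgebra (Fn lam σ q X) (Multiplicative ℤ)

/-- The function `f`, as an element of the cross product. -/
def fn (f : Fn lam σ q X) : BigCross lam σ q X := SkewMonoidAlgebra.single 1 f

/-- The unitary symbol `W`. -/
def W : BigCross lam σ q X := SkewMonoidAlgebra.single (Multiplicative.ofAdd 1) 1

/-- The symbol `W^*`, the inverse of `W`. -/
def Wst : BigCross lam σ q X := SkewMonoidAlgebra.single (Multiplicative.ofAdd (-1)) 1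

/-- The cross product of sections of line bundles: finite sums `∑ f_n W^n` where `f_n` is a
regular section of the line bundle which carries the coefficient of `W^n`. -/
def CrossProd : Subalgebra ℂ (BigCross lam σ q X) where
  carrier := {F | ∀ n : ℤ, F.coeff (Multiplicative.ofAdd n) ∈ sections lam σ q X n}
  add_mem' := fun {F G} hF hG n => by
    rw [SkewMonoidAlgebra.coeff_add]
    exact Submodule.add_mem _ (hF n) (hG n)
  mul_mem' := fun {F G} hF hG n => by
    classical
    rw [SkewMonoidAlgebra.coeff_mul, SkewMonoidAlgebra.sum_def']
    refine Submodule.sum_mem _ fun a _ => ?_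
    rw [SkewMonoidAlgebra.sum_def']
    refine Submodule.sum_mem _ fun b _ => ?_
    split_ifs with h
    · have h1 : n = a.toAdd + b.toAdd := by
        rw [← toAdd_mul, h]; rfl
      rw [h1]
      exact mul_smul_mem_sections lam σ q X (hF a.toAdd) (hG b.toAdd)
    · exact Submodule.zero_mem _
  algebraMap_mem' := fun r n => by
    rw [SkewMonoidAlgebra.coe_algebraMap, Function.comp_apply]
    change (Finsupp.single (1 : Multiplicative ℤ) (algebraMap ℂ (Fn lam σ q X) r))
      (Multiplicative.ofAdd n) ∈ _
    rw [Finsupp.single_apply]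
    split_ifs with h
    · have h0 : n = 0 := (congrArg Multiplicative.toAdd h).symm
      subst h0
      refine ⟨Subalgebra.algebraMap_mem _ r, fun i c p => ?_⟩
      have hw : wt 0 i = 0 := by unfold wt; split_ifs <;> omega
      rw [hw, zpow_zero, one_mul]
      rfl
    · exact Submodule.zero_mem _

/-- `j̃` on pairs of sequences: `(v, v') ↦ (j(v'), j(v))`. -/
def jSeq (p : (ℤ → Fin 4 → ℂ) × (ℤ → Fin 4 → ℂ)) : (ℤ → Fin 4 → ℂ) × (ℤ → Fin 4 → ℂ) :=
  (fun k => jV lam (p.2 k), fun k => jV lam (p.1 k))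

variable {lam σ q X} in
/-- `F^* = c ∘ F ∘ j̃` for functions of frames. -/
def fnStar (hj : Set.MapsTo (jSeq lam) (frames lam σ q X) (frames lam σ q X))
    (f : Fn lam σ q X) : Fn lam σ q X :=
  fun p => (starRingEnd ℂ) (f ⟨jSeq lam p.1, hj p.2⟩)

variable {lam σ q X} in
/-- The adjunction `(∑ f_n W^n)^* = ∑ W^(-n) f_n^*` of the cross product. -/
def crossStar (hj : Set.MapsTo (jSeq lam) (frames lam σ q X) (frames lam σ q X))
    (F : BigCross lam σ q X) : BigCross lam σ q X :=
  F.sum fun g f => SkewMonoidAlgebra.single g⁻¹ 1 * fn lam σ q X (fnStar hj f)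

end CrossProduct

/-! ### The representation -/

/-- The formula `ρ(Y) = Y(Z) W + W^* Y(Z')` for every `Y` in the space of generators. -/
def HasFormula {lam : Fin 4 → Circle} {c : Matrix (Fin 4) (Fin 4) ℂ}
    {σ : Equiv.Perm (curve lam)} {q : Matrix (Fin 4) (Fin 4) ℂ}
    {X : Set (curve lam × curve lam)}
    (ρ : SphereAlg lam c →ₐ[ℂ] CrossProd lam σ q X) : Prop :=
  ∀ Y : Fin 4 → ℂ, (ρ (lin (zS lam c) Y) : BigCross lam σ q X) =
    fn lam σ q X (fnZ lam σ q X 0 Y) * W lam σ q X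
      + Wst lam σ q X * fn lam σ q X (fnZ' lam σ q X 0 Y)

/-- `ρ` is a `*`-representation: the sphere algebra carries the adjunction with
`z_μ^* = λ_μ z_μ`, the space of frames is invariant by `j̃`, and `ρ` intertwines the adjunctions. -/
def IsStarRep {lam : Fin 4 → Circle} {c : Matrix (Fin 4) (Fin 4) ℂ}
    {σ : Equiv.Perm (curve lam)} {q : Matrix (Fin 4) (Fin 4) ℂ}
    {X : Set (curve lam × curve lam)}
    (ρ : SphereAlg lam c →ₐ[ℂ] CrossProd lam σ q X) : Prop :=
  ∃ τ : SphereAlg lam c → SphereAlg lam c, IsAdjunction lam (zS lam c) τ ∧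
    ∃ hj : Set.MapsTo (jSeq lam) (frames lam σ q X) (frames lam σ q X),
      ∀ a, (ρ (τ a) : BigCross lam σ q X) = crossStar hj (ρ a)

end NCSphere

end

/-!
The relations of the quadratic algebra, regarded as bilinear forms in two vectors `y` and `y'`, are
six linear equations for `y'`. Solved for the products with the first coordinate (`Chain.α1` and its
companions) they involve only the numbers `D_k = λ₀² - λ_k²` and `c_k = λ₀ λ_k + λ_l λ_m`. On the
curve the kernel of this system is a line (`Chain.unique`), spanned by the value of any one of three
quadratic maps which does not vanish (`stepMap`), and it lies on the curve (`Chain.cone`). This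
gives `σ`; the change of sign of the first coordinate conjugates it to its inverse, and so does `j`
(`exists_correspondence`). If some `c_k` vanishes, `σ²` is a change of signs, so `σ⁴ ≠ 1` excludes
this case (`cc_ne_of_pow_four`).

A sequence of vectors on which the relations vanish successively makes the generators act as
weighted shifts, so that a homogeneous element of the algebra has a value along it (`pathEval`). At
the points of the curve with a zero coordinate these values show that the symmetric matrix of a
quadratic element is unique, and that it is diagonal if the element is central
(`IsCentralQuad.diagonal`). The central elements form a space of dimension two, spanned by
`Ω = ∑ D_k c_k z_k²` and one of the forms obtained from it by permuting the indices by the Klein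
four-group, which leaves the relations invariant. For `Ω` the equation of central quadratic forms
follows from the triple product formula of vector calculus (`central_om`).

In the cross product a quadratic element is represented by a function and multiples of `W²` and
`W⁻²`, whose coefficients are its values at neighbouring vectors (`quad_xB`). The multiples of `W²`
and `W⁻²` vanish for the relations by the definition of `σ`, and for `Q` because `Q` vanishes on the
graph of `σ`. For the relations the function is zero by the equation of central quadratic forms, and
for `Q` it is the sum of two values normalized to `1`. This is the representation `rep`. It respects
the adjunctions, which is checked on the generators (`rep_isStarRep`). The exceptional points are
countable because planes meet the curve in finitely many points (`finite_plane_section`).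

For the faithfulness, the coefficient of `Wⁿ` in the image of an element of degree `n` is its value
along the orbit of `Z` (`coefAt_repQ`), and two facts are needed.

* A homogeneous element which vanishes along all the orbits lies in the ideal generated by `C` and
  `Ω` (`mem_Jn_of_vanish`). Modulo the right ideal generated by `z₀`, `C` and `Ω`, the part of each
  degree at least two is spanned by four elements dual to the orbits of the four points with
  `y₀ = 0` (`Stage`); this is a computation in degrees two and three and propagates to the higher
  degrees by the uniqueness of the next point of an orbit. Hence the element is a multiple of `z₀`
  modulo `C` and `Ω`, and by continuity in a chart of the curve (`exists_chart`) the factor again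
  vanishes along all the orbits.
* The element `Ω` is represented by the function `Ω(Z, j(Z)) / C(Z, j(Z))`, whose powers are linearly
  independent over the sections in the variable `Z` (`pathEval_eq_zero_of_sum`): by polarization
  `j(Z)` can be replaced by an independent point, and then the function takes infinitely many values
  for a fixed `Z`.

Write an element of the kernel as a polynomial in `Ω` whose coefficients have degree at most `n`. By
the second fact the parts of degree `n` of the coefficients vanish along all the orbits, by the
first they are in the ideal generated by `C` and `Ω`, and since `C = 1` they can be replaced by
polynomials in `Ω` with coefficients of smaller degree (`mem_Filt_of_rep_eq_zero`).
-/

noncomputable section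

namespace NCSphere

/-! ### The correspondence on vectors -/

/-- The pair `(y, y')` is a common zero of all the relations, regarded as bilinear forms. -/
structure Chain (L y y' : Fin 4 → ℂ) : Prop where
  a1 : L 0 * y 1 * y' 0 - L 1 * y 0 * y' 1 + L 3 * y 2 * y' 3 - L 2 * y 3 * y' 2 = 0
  a2 : L 0 * y 2 * y' 0 - L 2 * y 0 * y' 2 + L 1 * y 3 * y' 1 - L 3 * y 1 * y' 3 = 0
  a3 : L 0 * y 3 * y' 0 - L 3 * y 0 * y' 3 + L 2 * y 1 * y' 2 - L 1 * y 2 * y' 1 = 0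
  b1 : -(L 1 * y 1 * y' 0) + L 0 * y 0 * y' 1 + L 2 * y 2 * y' 3 - L 3 * y 3 * y' 2 = 0
  b2 : -(L 2 * y 2 * y' 0) + L 0 * y 0 * y' 2 + L 3 * y 3 * y' 1 - L 1 * y 1 * y' 3 = 0
  b3 : -(L 3 * y 3 * y' 0) + L 0 * y 0 * y' 3 + L 1 * y 1 * y' 2 - L 2 * y 2 * y' 1 = 0

/-- The affine cone over the curve. -/
structure Cone (L y : Fin 4 → ℂ) : Prop where
  h1 : y 0 ^ 2 + y 1 ^ 2 + y 2 ^ 2 + y 3 ^ 2 = 0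
  h2 : L 0 ^ 2 * y 0 ^ 2 + L 1 ^ 2 * y 1 ^ 2 + L 2 ^ 2 * y 2 ^ 2 + L 3 ^ 2 * y 3 ^ 2 = 0

/-- The squares of the parameters are pairwise distinct. -/
def Distinct (L : Fin 4 → ℂ) : Prop := ∀ μ ν, μ ≠ ν → L μ ^ 2 ≠ L ν ^ 2

/-- The Klein four-group, acting on the indices by translations: `kl l` is the permutation without
fixed points, or the identity, which takes `0` to `l`. The relations are invariant if the
parameters and the generators are permuted simultaneously, so that a statement about the first
coordinate gives one about each of the others. -/
def kl : Fin 4 → Fin 4 → Fin 4 := ![![0, 1, 2, 3], ![1, 0, 3, 2], ![2, 3, 0, 1], ![3, 2, 1, 0]]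

theorem kl_kl (l μ : Fin 4) : kl l (kl l μ) = μ := by revert l μ; decide

theorem kl_zero (l : Fin 4) : kl l 0 = l := by revert l; decide

theorem kl_injective (l : Fin 4) : Function.Injective (kl l) :=
  fun a b h => by rw [← kl_kl l a, h, kl_kl]

theorem comp_kl_kl (l : Fin 4) {α : Type*} (y : Fin 4 → α) : (y ∘ kl l) ∘ kl l = y := by
  funext μ; simp [kl_kl]

theorem Distinct.kl {L : Fin 4 → ℂ} (h : Distinct L) (l : Fin 4) : Distinct (L ∘ kl l) :=
  fun _ _ hμν => h _ _ fun e => hμν (kl_injective l e)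

theorem Cone.kl {L y : Fin 4 → ℂ} (h : Cone L y) (l : Fin 4) :
    Cone (L ∘ kl l) (y ∘ kl l) := by
  obtain ⟨h1, h2⟩ := h
  fin_cases l <;> refine ⟨?_, ?_⟩ <;> simp [NCSphere.kl] <;>
    first | linear_combination h1 | linear_combination h2

theorem Chain.kl {L y y' : Fin 4 → ℂ} (h : Chain L y y') (l : Fin 4) :
    Chain (L ∘ kl l) (y ∘ kl l) (y' ∘ kl l) := by
  obtain ⟨a1, a2, a3, b1, b2, b3⟩ := h
  fin_cases l <;> refine ⟨?_, ?_, ?_, ?_, ?_, ?_⟩ <;> simp [NCSphere.kl] <;>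
    first
    | linear_combination a1
    | linear_combination -a1
    | linear_combination a2
    | linear_combination -a2
    | linear_combination a3
    | linear_combination -a3
    | linear_combination b1
    | linear_combination -b1
    | linear_combination b2
    | linear_combination -b2
    | linear_combination b3
    | linear_combination -b3

/-- The numbers `λ₀² - λ_k²`. -/
def dd (L : Fin 4 → ℂ) (k : Fin 4) : ℂ := L 0 ^ 2 - L k ^ 2

/-- The numbers `λ₀ λ_k + λ_l λ_m`, for `(k, l, m)` a circular permutation of `(1, 2, 3)`; the value
`0` at the index `0` is a placeholder. -/
def cc (L : Fin 4 → ℂ) : Fin 4 → ℂ :=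
  ![0, L 0 * L 1 + L 2 * L 3, L 0 * L 2 + L 3 * L 1, L 0 * L 3 + L 1 * L 2]

/-- The numbers `λ_l² - λ_m²`, for `(k, l, m)` a circular permutation of `(1, 2, 3)`; the value `0`
at the index `0` is a placeholder. -/
def xx (L : Fin 4 → ℂ) : Fin 4 → ℂ :=
  ![0, L 2 ^ 2 - L 3 ^ 2, L 3 ^ 2 - L 1 ^ 2, L 1 ^ 2 - L 2 ^ 2]

theorem cc_one (L : Fin 4 → ℂ) : cc L 1 = L 0 * L 1 + L 2 * L 3 := rfl
theorem cc_two (L : Fin 4 → ℂ) : cc L 2 = L 0 * L 2 + L 3 * L 1 := rfl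
theorem cc_three (L : Fin 4 → ℂ) : cc L 3 = L 0 * L 3 + L 1 * L 2 := rfl
theorem xx_one (L : Fin 4 → ℂ) : xx L 1 = L 2 ^ 2 - L 3 ^ 2 := rfl
theorem xx_two (L : Fin 4 → ℂ) : xx L 2 = L 3 ^ 2 - L 1 ^ 2 := rfl
theorem xx_three (L : Fin 4 → ℂ) : xx L 3 = L 1 ^ 2 - L 2 ^ 2 := rfl

theorem Distinct.dd_ne {L : Fin 4 → ℂ} (h : Distinct L) {k : Fin 4} (hk : k ≠ 0) :
    dd L k ≠ 0 := sub_ne_zero.2 (h _ _ hk.symm)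

theorem Distinct.xx_ne {L : Fin 4 → ℂ} (h : Distinct L) {k : Fin 4} (hk : k ≠ 0) :
    xx L k ≠ 0 := by
  fin_cases k
  · exact absurd rfl hk
  · exact sub_ne_zero.2 (h 2 3 (by decide))
  · exact sub_ne_zero.2 (h 3 1 (by decide))
  · exact sub_ne_zero.2 (h 1 2 (by decide))

theorem cc_sq_one (L : Fin 4 → ℂ) : cc L 2 ^ 2 - cc L 3 ^ 2 = dd L 1 * xx L 1 := by
  simp only [cc_two, cc_three, dd, xx_one]; ring
theorem cc_sq_two (L : Fin 4 → ℂ) : cc L 3 ^ 2 - cc L 1 ^ 2 = dd L 2 * xx L 2 := by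
  simp only [cc_one, cc_three, dd, xx_two]; ring
theorem cc_sq_three (L : Fin 4 → ℂ) : cc L 1 ^ 2 - cc L 2 ^ 2 = dd L 3 * xx L 3 := by
  simp only [cc_one, cc_two, dd, xx_three]; ring

section

variable {L y y' : Fin 4 → ℂ}

/-! The relations, solved for the products with the first coordinate. -/

theorem Chain.α1 (h : Chain L y y') :
    dd L 1 * y 1 * y' 0 + cc L 3 * y 2 * y' 3 - cc L 2 * y 3 * y' 2 = 0 := by
  simp only [cc_two, cc_three, dd]; linear_combination L 0 * h.a1 + L 1 * h.b1
theorem Chain.α2 (h : Chain L y y') :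
    dd L 2 * y 2 * y' 0 + cc L 1 * y 3 * y' 1 - cc L 3 * y 1 * y' 3 = 0 := by
  simp only [cc_one, cc_three, dd]; linear_combination L 0 * h.a2 + L 2 * h.b2
theorem Chain.α3 (h : Chain L y y') :
    dd L 3 * y 3 * y' 0 + cc L 2 * y 1 * y' 2 - cc L 1 * y 2 * y' 1 = 0 := by
  simp only [cc_one, cc_two, dd]; linear_combination L 0 * h.a3 + L 3 * h.b3
theorem Chain.β1 (h : Chain L y y') :
    dd L 1 * y 0 * y' 1 + cc L 2 * y 2 * y' 3 - cc L 3 * y 3 * y' 2 = 0 := by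
  simp only [cc_two, cc_three, dd]; linear_combination L 1 * h.a1 + L 0 * h.b1
theorem Chain.β2 (h : Chain L y y') :
    dd L 2 * y 0 * y' 2 + cc L 3 * y 3 * y' 1 - cc L 1 * y 1 * y' 3 = 0 := by
  simp only [cc_one, cc_three, dd]; linear_combination L 2 * h.a2 + L 0 * h.b2
theorem Chain.β3 (h : Chain L y y') :
    dd L 3 * y 0 * y' 3 + cc L 1 * y 1 * y' 2 - cc L 2 * y 2 * y' 1 = 0 := by
  simp only [cc_one, cc_two, dd]; linear_combination L 3 * h.a3 + L 0 * h.b3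

/-- The solved relations are equivalent to the original ones. -/
theorem Chain.of_solved (hL : Distinct L)
    (α1 : dd L 1 * y 1 * y' 0 + cc L 3 * y 2 * y' 3 - cc L 2 * y 3 * y' 2 = 0)
    (α2 : dd L 2 * y 2 * y' 0 + cc L 1 * y 3 * y' 1 - cc L 3 * y 1 * y' 3 = 0)
    (α3 : dd L 3 * y 3 * y' 0 + cc L 2 * y 1 * y' 2 - cc L 1 * y 2 * y' 1 = 0)
    (β1 : dd L 1 * y 0 * y' 1 + cc L 2 * y 2 * y' 3 - cc L 3 * y 3 * y' 2 = 0)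
    (β2 : dd L 2 * y 0 * y' 2 + cc L 3 * y 3 * y' 1 - cc L 1 * y 1 * y' 3 = 0)
    (β3 : dd L 3 * y 0 * y' 3 + cc L 1 * y 1 * y' 2 - cc L 2 * y 2 * y' 1 = 0) :
    Chain L y y' := by
  have d1 := hL.dd_ne (k := 1) (by decide)
  have d2 := hL.dd_ne (k := 2) (by decide)
  have d3 := hL.dd_ne (k := 3) (by decide)
  constructor
  · apply mul_left_cancel₀ d1
    simp only [cc_two, cc_three, dd] at *; linear_combination L 0 * α1 - L 1 * β1
  · apply mul_left_cancel₀ d2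
    simp only [cc_one, cc_three, dd] at *; linear_combination L 0 * α2 - L 2 * β2
  · apply mul_left_cancel₀ d3
    simp only [cc_one, cc_two, dd] at *; linear_combination L 0 * α3 - L 3 * β3
  · apply mul_left_cancel₀ d1
    simp only [cc_two, cc_three, dd] at *; linear_combination L 0 * β1 - L 1 * α1
  · apply mul_left_cancel₀ d2
    simp only [cc_one, cc_three, dd] at *; linear_combination L 0 * β2 - L 2 * α2
  · apply mul_left_cancel₀ d3
    simp only [cc_one, cc_two, dd] at *; linear_combination L 0 * β3 - L 3 * α3

theorem Cone.sum_dd (h : Cone L y) :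
    dd L 1 * y 1 ^ 2 + dd L 2 * y 2 ^ 2 + dd L 3 * y 3 ^ 2 = 0 := by
  simp only [dd]; linear_combination L 0 ^ 2 * h.h1 - h.h2

/-- The determinant of the linear system for the last three coordinates of the next point vanishes
on the curve. -/
theorem Cone.det (h : Cone L y) :
    dd L 1 * dd L 2 * dd L 3 * y 0 ^ 2
      + dd L 1 * cc L 1 ^ 2 * y 1 ^ 2
      + dd L 2 * cc L 2 ^ 2 * y 2 ^ 2 + dd L 3 * cc L 3 ^ 2 * y 3 ^ 2 = 0 := by
  simp only [dd, cc_one, cc_two, cc_three]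
  linear_combination (L 0 ^ 4 - L 0 ^ 2 * (L 1 ^ 2 + L 2 ^ 2 + L 3 ^ 2)
      - 2 * (L 0 * L 1 * L 2 * L 3)) * h.h2
    + (L 0 ^ 2 * (L 1 ^ 2 * L 2 ^ 2 + L 2 ^ 2 * L 3 ^ 2 + L 3 ^ 2 * L 1 ^ 2)
      - L 1 ^ 2 * L 2 ^ 2 * L 3 ^ 2 + 2 * (L 0 * L 1 * L 2 * L 3) * L 0 ^ 2) * h.h1

/-- Three quadratic maps which represent the correspondence on the curve, each where it does not
vanish. -/
def stepMap (L : Fin 4 → ℂ) (k : Fin 3) (y : Fin 4 → ℂ) : Fin 4 → ℂ :=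
  ![![cc L 1 * xx L 1 * y 2 * y 3 + cc L 2 * cc L 3 * y 0 * y 1,
      dd L 2 * dd L 3 * y 0 ^ 2 + cc L 1 ^ 2 * y 1 ^ 2,
      cc L 1 * cc L 2 * y 1 * y 2 - dd L 3 * cc L 3 * y 0 * y 3,
      cc L 1 * cc L 3 * y 1 * y 3 + dd L 2 * cc L 2 * y 0 * y 2],
    ![cc L 2 * xx L 2 * y 3 * y 1 + cc L 3 * cc L 1 * y 0 * y 2,
      cc L 2 * cc L 1 * y 2 * y 1 + dd L 3 * cc L 3 * y 0 * y 3,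
      dd L 3 * dd L 1 * y 0 ^ 2 + cc L 2 ^ 2 * y 2 ^ 2,
      cc L 2 * cc L 3 * y 2 * y 3 - dd L 1 * cc L 1 * y 0 * y 1],
    ![cc L 3 * xx L 3 * y 1 * y 2 + cc L 1 * cc L 2 * y 0 * y 3,
      cc L 3 * cc L 1 * y 3 * y 1 - dd L 2 * cc L 2 * y 0 * y 2,
      cc L 3 * cc L 2 * y 3 * y 2 + dd L 1 * cc L 1 * y 0 * y 1,
      dd L 1 * dd L 2 * y 0 ^ 2 + cc L 3 ^ 2 * y 3 ^ 2]] k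

theorem continuous_stepMap (L : Fin 4 → ℂ) (k : Fin 3) : Continuous (stepMap L k) := by
  refine continuous_pi fun μ => ?_
  fin_cases k <;> fin_cases μ <;> simp [stepMap] <;> fun_prop

theorem Cone.chain_stepMap (h : Cone L y) (hL : Distinct L) (k : Fin 3) :
    Chain L y (stepMap L k y) := by
  have hd := h.sum_dd
  have hdet := h.det
  have e1 := cc_sq_one L
  have e2 := cc_sq_two L
  have e3 := cc_sq_three L
  have r1 : xx L 3 * y 2 ^ 2 - dd L 1 * y 0 ^ 2 - xx L 2 * y 3 ^ 2 = 0 := by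
    simp only [dd, xx_two, xx_three]; linear_combination L 1 ^ 2 * h.h1 - h.h2
  have r2 : xx L 1 * y 3 ^ 2 - dd L 2 * y 0 ^ 2 - xx L 3 * y 1 ^ 2 = 0 := by
    simp only [dd, xx_one, xx_three]; linear_combination L 2 ^ 2 * h.h1 - h.h2
  have r3 : xx L 2 * y 1 ^ 2 - dd L 3 * y 0 ^ 2 - xx L 1 * y 2 ^ 2 = 0 := by
    simp only [dd, xx_one, xx_two]; linear_combination L 3 ^ 2 * h.h1 - h.h2
  fin_cases k <;> apply Chain.of_solved hL <;> simp [stepMap]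
  · linear_combination cc L 1 * y 1 * y 2 * y 3 * (-e1) + cc L 2 * cc L 3 * y 0 * hd
  · linear_combination cc L 1 * y 3 * y 1 ^ 2 * (-e2) - cc L 1 * y 3 * dd L 2 * r3
  · linear_combination -cc L 1 * y 2 * y 1 ^ 2 * e3 - cc L 1 * y 2 * dd L 3 * (-r2)
  · linear_combination y 0 * hdet
  · ring
  · ring
  · linear_combination -cc L 2 * y 3 * y 2 ^ 2 * e1 - cc L 2 * y 3 * dd L 1 * (-r3)
  · linear_combination cc L 2 * y 1 * y 2 * y 3 * (-e2) + cc L 3 * cc L 1 * y 0 * hd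
  · linear_combination cc L 2 * y 1 * y 2 ^ 2 * (-e3) - cc L 2 * y 1 * dd L 3 * r1
  · ring
  · linear_combination y 0 * hdet
  · ring
  · linear_combination cc L 3 * y 2 * y 3 ^ 2 * (-e1) - cc L 3 * y 2 * dd L 1 * r2
  · linear_combination -cc L 3 * y 1 * y 3 ^ 2 * e2 - cc L 3 * y 1 * dd L 2 * (-r1)
  · linear_combination cc L 3 * y 1 * y 2 * y 3 * (-e3) + cc L 1 * cc L 2 * y 0 * hd
  · ring
  · ring
  · linear_combination y 0 * hdet

end

section

variable {L y y' y'' : Fin 4 → ℂ}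

/-- Two coordinates of a point of the curve do not vanish simultaneously. -/
theorem Cone.eq_zero (h : Cone L y) (hL : Distinct L) {μ ν : Fin 4} (hμν : μ ≠ ν)
    (hμ : y μ = 0) (hν : y ν = 0) : y = 0 := by
  have key : ∀ {M z : Fin 4 → ℂ}, Cone M z → Distinct M → z 0 = 0 → ∀ ν, ν ≠ 0 → z ν = 0 →
      z = 0 := by
    intro M z hz hM h0 ν hν0 hν
    have e1 := hz.h1
    have e2 := hz.h2
    have h12 := sub_ne_zero.2 (hM 1 2 (by decide))
    have h13 := sub_ne_zero.2 (hM 1 3 (by decide))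
    have h23 := sub_ne_zero.2 (hM 2 3 (by decide))
    have hs : z 1 = 0 ∧ z 2 = 0 ∧ z 3 = 0 := by
      rw [h0] at e1 e2
      fin_cases ν
      · exact absurd rfl hν0
      all_goals
        simp only [Fin.mk_one, Fin.reduceFinMk] at hν
        rw [hν] at e1 e2
      · have h2 : z 2 = 0 := by
          apply pow_eq_zero_iff two_ne_zero |>.1
          apply mul_left_cancel₀ h23
          linear_combination e2 - M 3 ^ 2 * e1
        rw [h2] at e1
        exact ⟨hν, h2, by simpa using e1⟩
      · have h1 : z 1 = 0 := by
          apply pow_eq_zero_iff two_ne_zero |>.1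
          apply mul_left_cancel₀ h13
          linear_combination e2 - M 3 ^ 2 * e1
        rw [h1] at e1
        exact ⟨h1, hν, by simpa using e1⟩
      · have h1 : z 1 = 0 := by
          apply pow_eq_zero_iff two_ne_zero |>.1
          apply mul_left_cancel₀ h12
          linear_combination e2 - M 2 ^ 2 * e1
        rw [h1] at e1
        exact ⟨h1, by simpa using e1, hν⟩
    funext κ
    fin_cases κ
    exacts [h0, hs.1, hs.2.1, hs.2.2]
  have h0 := key (h.kl μ) (hL.kl μ) (by simpa [kl_zero] using hμ) (NCSphere.kl μ ν)
    (fun e => hμν (by rw [← kl_kl μ ν, e, kl_zero])) (by simpa [kl_kl] using hν)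
  rw [← comp_kl_kl μ y, h0]
  rfl

theorem Cone.ne_zero (h : Cone L y) (hL : Distinct L) (hy : y ≠ 0) {μ ν : Fin 4} (hμν : μ ≠ ν)
    (hμ : y μ = 0) : y ν ≠ 0 := fun hν => hy (h.eq_zero hL hμν hμ hν)

/-- At most one of the numbers `λ₀ λ_k + λ_l λ_m` vanishes. -/
theorem Distinct.cc_ne (hL : Distinct L) {k l : Fin 4} (hk : k ≠ 0) (hl : l ≠ 0) (hkl : k ≠ l)
    (h : cc L k = 0) : cc L l ≠ 0 := by
  intro h'
  have e1 := cc_sq_one L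
  have e2 := cc_sq_two L
  have e3 := cc_sq_three L
  have n1 := mul_ne_zero (hL.dd_ne (k := 1) (by decide)) (hL.xx_ne (k := 1) (by decide))
  have n2 := mul_ne_zero (hL.dd_ne (k := 2) (by decide)) (hL.xx_ne (k := 2) (by decide))
  have n3 := mul_ne_zero (hL.dd_ne (k := 3) (by decide)) (hL.xx_ne (k := 3) (by decide))
  fin_cases k <;> fin_cases l <;>
    simp only [ne_eq, not_true_eq_false, Fin.zero_eta, Fin.mk_one, Fin.reduceFinMk] at * <;>
    simp [h, h'] at e1 e2 e3 <;> simp_all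

/-- The three quadratic maps have no common zero on the curve. -/
theorem Cone.exists_stepMap_ne (h : Cone L y) (hL : Distinct L) (hy : y ≠ 0) :
    ∃ k, stepMap L k y ≠ 0 := by
  by_contra! hk
  have d1 := hL.dd_ne (k := 1) (by decide)
  have d2 := hL.dd_ne (k := 2) (by decide)
  have d3 := hL.dd_ne (k := 3) (by decide)
  have e11 := congrFun (hk 0) 1
  have e12 := congrFun (hk 0) 2
  have e22 := congrFun (hk 1) 2
  have e21 := congrFun (hk 1) 1
  have e33 := congrFun (hk 2) 3
  simp [stepMap] at e11 e12 e22 e21 e33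
  by_cases h0 : y 0 = 0
  · have y1 := h.ne_zero hL hy (ν := 1) (by decide) h0
    have y2 := h.ne_zero hL hy (ν := 2) (by decide) h0
    simp [h0, y1] at e11
    simp [h0, y2] at e22
    exact hL.cc_ne (by decide) (by decide) (by decide) e11 e22
  · have hc : dd L 3 * y 0 * (cc L 3 * y 3) = 0 := by linear_combination (e21 - e12) / 2
    have hc' : cc L 3 * y 3 = 0 := by
      rcases mul_eq_zero.1 hc with h' | h'
      · exact absurd h' (mul_ne_zero d3 h0)
      · exact h'
    have : dd L 1 * dd L 2 * y 0 ^ 2 = 0 := by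
      linear_combination e33 - cc L 3 * y 3 * hc'
    simp [d1, d2, h0] at this

/-- If all the two by two minors vanish, the vectors are proportional. -/
theorem exists_smul_of_minors {p r : Fin 4 → ℂ} (hr : r ≠ 0)
    (h : ∀ i j, p i * r j = p j * r i) : ∃ s : ℂ, p = s • r := by
  obtain ⟨j, hj⟩ := Function.ne_iff.1 hr
  refine ⟨p j / r j, funext fun i => ?_⟩
  have := h i j
  simp only [Pi.zero_apply] at hj
  simp only [Pi.smul_apply, smul_eq_mul]
  field_simp
  exact this

/-- The kernel of the linear system is one-dimensional at every point of the curve. -/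
theorem Chain.unique (h' : Chain L y y') (h'' : Chain L y y'') (h : Cone L y) (hL : Distinct L)
    (hy : y ≠ 0) (hy'' : y'' ≠ 0) : ∃ s : ℂ, y' = s • y'' := by
  have d1 := hL.dd_ne (k := 1) (by decide)
  have d2 := hL.dd_ne (k := 2) (by decide)
  have d3 := hL.dd_ne (k := 3) (by decide)
  have p1 := h'.β1
  have p2 := h'.β2
  have p3 := h'.β3
  have r1 := h''.β1
  have r2 := h''.β2
  have r3 := h''.β3
  -- the cross product of the last three coordinates vanishes
  have hw : y' 2 * y'' 3 - y' 3 * y'' 2 = 0 ∧ y' 3 * y'' 1 - y' 1 * y'' 3 = 0 ∧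
      y' 1 * y'' 2 - y' 2 * y'' 1 = 0 := by
    by_cases h0 : y 0 = 0
    · have y1 := h.ne_zero hL hy (ν := 1) (by decide) h0
      have y2 := h.ne_zero hL hy (ν := 2) (by decide) h0
      have y3 := h.ne_zero hL hy (ν := 3) (by decide) h0
      rw [h0] at p1 p2 p3 r1 r2 r3
      by_cases hc : cc L 1 = 0
      · have hc2 := hL.cc_ne (l := 2) (by decide) (by decide) (by decide) hc
        have hn := mul_ne_zero hc2 y2
        refine ⟨?_, ?_, ?_⟩
        · apply mul_left_cancel₀ hn
          linear_combination y'' 2 * (-p1) + y' 2 * r1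
        · apply mul_left_cancel₀ (pow_ne_zero 2 hn)
          linear_combination cc L 2 * y 2 * y'' 1 * p1 - cc L 3 * y 3 * y' 2 * r3
            + cc L 2 * y 2 * y'' 3 * p3 - cc L 1 * y 1 * y' 2 * r1
        · apply mul_left_cancel₀ hn
          linear_combination -y'' 2 * p3 + y' 2 * r3
      · have hn := mul_ne_zero hc y1
        refine ⟨?_, ?_, ?_⟩
        · apply mul_left_cancel₀ (pow_ne_zero 2 hn)
          linear_combination cc L 1 * y 1 * y'' 3 * p3 + cc L 1 * y 1 * y'' 2 * p2
            - cc L 2 * y 2 * y' 1 * r2 - cc L 3 * y 3 * y' 1 * r3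
        · apply mul_left_cancel₀ hn
          linear_combination y'' 1 * (-p2) + y' 1 * r2
        · apply mul_left_cancel₀ hn
          linear_combination y' 1 * r3 - y'' 1 * p3
    · -- `D y'` and `D y''` are orthogonal to `y'` and `y''`, hence parallel to the cross product
      have hpp : dd L 1 * y' 1 ^ 2 + dd L 2 * y' 2 ^ 2 + dd L 3 * y' 3 ^ 2 = 0 := by
        apply mul_left_cancel₀ h0
        linear_combination y' 1 * p1 + y' 2 * p2 + y' 3 * p3
      have hrr : dd L 1 * y'' 1 ^ 2 + dd L 2 * y'' 2 ^ 2 + dd L 3 * y'' 3 ^ 2 = 0 := by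
        apply mul_left_cancel₀ h0
        linear_combination y'' 1 * r1 + y'' 2 * r2 + y'' 3 * r3
      have hpr : dd L 1 * y' 1 * y'' 1 + dd L 2 * y' 2 * y'' 2 + dd L 3 * y' 3 * y'' 3 = 0 := by
        apply mul_left_cancel₀ h0
        linear_combination (y'' 1 * p1 + y'' 2 * p2 + y'' 3 * p3
          + y' 1 * r1 + y' 2 * r2 + y' 3 * r3) / 2
      refine ⟨?_, ?_, ?_⟩
      · apply pow_eq_zero_iff (n := 3) (by decide) |>.1
        apply mul_left_cancel₀ (mul_ne_zero d2 d3)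
        set w1 := y' 2 * y'' 3 - y' 3 * y'' 2 with hw1
        set w2 := y' 3 * y'' 1 - y' 1 * y'' 3 with hw2
        set w3 := y' 1 * y'' 2 - y' 2 * y'' 1 with hw3
        have c1 : dd L 2 * y' 2 * w1 = dd L 1 * y' 1 * w2 := by
          rw [hw1, hw2]; linear_combination y' 3 * (-hpr) + y'' 3 * hpp
        have c2 : dd L 3 * y' 3 * w1 = dd L 1 * y' 1 * w3 := by
          rw [hw1, hw3]; linear_combination y' 2 * (hpr) - y'' 2 * hpp
        have c3 : dd L 2 * y'' 2 * w1 = dd L 1 * y'' 1 * w2 := by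
          rw [hw1, hw2]; linear_combination y' 3 * (-hrr) + y'' 3 * hpr
        have c4 : dd L 3 * y'' 3 * w1 = dd L 1 * y'' 1 * w3 := by
          rw [hw1, hw3]; linear_combination y' 2 * (hrr) - y'' 2 * hpr
        have : dd L 2 * dd L 3 * w1 ^ 3 =
            (dd L 2 * y' 2 * w1) * (dd L 3 * y'' 3 * w1)
              - (dd L 3 * y' 3 * w1) * (dd L 2 * y'' 2 * w1) := by
          rw [hw1]; ring
        rw [this, c1, c2, c3, c4]; ring
      · apply pow_eq_zero_iff (n := 3) (by decide) |>.1
        apply mul_left_cancel₀ (mul_ne_zero d3 d1)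
        set w1 := y' 2 * y'' 3 - y' 3 * y'' 2 with hw1
        set w2 := y' 3 * y'' 1 - y' 1 * y'' 3 with hw2
        set w3 := y' 1 * y'' 2 - y' 2 * y'' 1 with hw3
        have c1 : dd L 3 * y' 3 * w2 = dd L 2 * y' 2 * w3 := by
          rw [hw2, hw3]; linear_combination y' 1 * (-hpr) + y'' 1 * hpp
        have c2 : dd L 1 * y' 1 * w2 = dd L 2 * y' 2 * w1 := by
          rw [hw1, hw2]; linear_combination y' 3 * (hpr) - y'' 3 * hpp
        have c3 : dd L 3 * y'' 3 * w2 = dd L 2 * y'' 2 * w3 := by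
          rw [hw2, hw3]; linear_combination y' 1 * (-hrr) + y'' 1 * hpr
        have c4 : dd L 1 * y'' 1 * w2 = dd L 2 * y'' 2 * w1 := by
          rw [hw1, hw2]; linear_combination y' 3 * (hrr) - y'' 3 * hpr
        have : dd L 3 * dd L 1 * w2 ^ 3 =
            (dd L 3 * y' 3 * w2) * (dd L 1 * y'' 1 * w2)
              - (dd L 1 * y' 1 * w2) * (dd L 3 * y'' 3 * w2) := by
          rw [hw2]; ring
        rw [this, c1, c2, c3, c4]; ring
      · apply pow_eq_zero_iff (n := 3) (by decide) |>.1
        apply mul_left_cancel₀ (mul_ne_zero d1 d2)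
        set w1 := y' 2 * y'' 3 - y' 3 * y'' 2 with hw1
        set w2 := y' 3 * y'' 1 - y' 1 * y'' 3 with hw2
        set w3 := y' 1 * y'' 2 - y' 2 * y'' 1 with hw3
        have c1 : dd L 1 * y' 1 * w3 = dd L 3 * y' 3 * w1 := by
          rw [hw1, hw3]; linear_combination y' 2 * (-hpr) + y'' 2 * hpp
        have c2 : dd L 2 * y' 2 * w3 = dd L 3 * y' 3 * w2 := by
          rw [hw2, hw3]; linear_combination y' 1 * (hpr) - y'' 1 * hpp
        have c3 : dd L 1 * y'' 1 * w3 = dd L 3 * y'' 3 * w1 := by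
          rw [hw1, hw3]; linear_combination y' 2 * (-hrr) + y'' 2 * hpr
        have c4 : dd L 2 * y'' 2 * w3 = dd L 3 * y'' 3 * w2 := by
          rw [hw2, hw3]; linear_combination y' 1 * (hrr) - y'' 1 * hpr
        have : dd L 1 * dd L 2 * w3 ^ 3 =
            (dd L 1 * y' 1 * w3) * (dd L 2 * y'' 2 * w3)
              - (dd L 2 * y' 2 * w3) * (dd L 1 * y'' 1 * w3) := by
          rw [hw3]; ring
        rw [this, c1, c2, c3, c4]; ring
  obtain ⟨w1, w2, w3⟩ := hw
  have m1 : y' 0 * y'' 1 = y' 1 * y'' 0 ∧ y' 0 * y'' 2 = y' 2 * y'' 0 ∧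
      y' 0 * y'' 3 = y' 3 * y'' 0 := by
    have q1 := h'.α1
    have q2 := h'.α2
    have s1 := h''.α1
    have s2 := h''.α2
    by_cases h1 : y 1 = 0
    · have hn := mul_ne_zero d2 (h.ne_zero hL hy (ν := 2) (by decide) h1)
      refine ⟨?_, ?_, ?_⟩ <;> apply mul_left_cancel₀ hn
      · linear_combination y'' 1 * q2 - y' 1 * s2 + cc L 3 * y 1 * w2
      · linear_combination y'' 2 * q2 - y' 2 * s2 - cc L 1 * y 3 * w3 - cc L 3 * y 1 * w1
      · linear_combination y'' 3 * q2 - y' 3 * s2 + cc L 1 * y 3 * w2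
    · have hn := mul_ne_zero d1 h1
      refine ⟨?_, ?_, ?_⟩ <;> apply mul_left_cancel₀ hn
      · linear_combination y'' 1 * q1 - y' 1 * s1 - cc L 3 * y 2 * w2 - cc L 2 * y 3 * w3
      · linear_combination y'' 2 * q1 - y' 2 * s1 + cc L 3 * y 2 * w1
      · linear_combination y'' 3 * q1 - y' 3 * s1 + cc L 2 * y 3 * w1
  obtain ⟨m1, m2, m3⟩ := m1
  apply exists_smul_of_minors hy''
  intro i j
  fin_cases i <;> fin_cases j <;> simp only [Fin.zero_eta, Fin.mk_one, Fin.reduceFinMk]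
  all_goals
    first
    | rfl
    | linear_combination m1 | linear_combination m2 | linear_combination m3
    | linear_combination w1 | linear_combination w2 | linear_combination w3
    | linear_combination -m1 | linear_combination -m2 | linear_combination -m3
    | linear_combination -w1 | linear_combination -w2 | linear_combination -w3

/-- The solved relations with a nonzero coordinate `y_l` give one equation for the squares of the
coordinates of the next point. -/
theorem Chain.quadric (h' : Chain L y y') {l : Fin 4} (hl : y l ≠ 0) :
    L l ^ 2 * (y' 0 ^ 2 + y' 1 ^ 2 + y' 2 ^ 2 + y' 3 ^ 2)
      - (L 0 ^ 2 * y' 0 ^ 2 + L 1 ^ 2 * y' 1 ^ 2 + L 2 ^ 2 * y' 2 ^ 2 + L 3 ^ 2 * y' 3 ^ 2) = 0 := by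
  have key : ∀ {M z z' : Fin 4 → ℂ}, Chain M z z' → z 0 ≠ 0 →
      M 0 ^ 2 * (z' 0 ^ 2 + z' 1 ^ 2 + z' 2 ^ 2 + z' 3 ^ 2)
      - (M 0 ^ 2 * z' 0 ^ 2 + M 1 ^ 2 * z' 1 ^ 2 + M 2 ^ 2 * z' 2 ^ 2 + M 3 ^ 2 * z' 3 ^ 2) = 0 := by
    intro M z z' h h0
    have p1 := h.β1
    have p2 := h.β2
    have p3 := h.β3
    apply mul_left_cancel₀ h0
    simp only [dd] at p1 p2 p3
    linear_combination z' 1 * p1 + z' 2 * p2 + z' 3 * p3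
  have := key (h'.kl l) (by simpa [kl_zero] using hl)
  fin_cases l <;> simp [NCSphere.kl] at this <;>
    simp only [Fin.zero_eta, Fin.mk_one, Fin.reduceFinMk] <;> linear_combination this

/-- The next point again lies on the curve. -/
theorem Chain.cone (h' : Chain L y y') (h : Cone L y) (hL : Distinct L) (hy : y ≠ 0) :
    Cone L y' := by
  have : ∃ l n : Fin 4, l ≠ n ∧ y l ≠ 0 ∧ y n ≠ 0 := by
    by_cases h0 : y 0 = 0
    · exact ⟨1, 2, by decide, h.ne_zero hL hy (by decide) h0, h.ne_zero hL hy (by decide) h0⟩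
    · by_cases h1 : y 1 = 0
      · exact ⟨0, 2, by decide, h0, h.ne_zero hL hy (by decide) h1⟩
      · exact ⟨0, 1, by decide, h0, h1⟩
  obtain ⟨l, n, hln, hl, hn⟩ := this
  have el := h'.quadric hl
  have en := h'.quadric hn
  have h1 : y' 0 ^ 2 + y' 1 ^ 2 + y' 2 ^ 2 + y' 3 ^ 2 = 0 := by
    apply mul_left_cancel₀ (sub_ne_zero.2 (hL l n hln))
    linear_combination el - en
  exact ⟨h1, by linear_combination L l ^ 2 * h1 - el⟩

/-- The change of sign of the first coordinate; it conjugates the correspondence to its inverse. -/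
def eps (y : Fin 4 → ℂ) : Fin 4 → ℂ := ![-y 0, y 1, y 2, y 3]

theorem eps_eps (y : Fin 4 → ℂ) : eps (eps y) = y := by
  funext μ; fin_cases μ <;> simp [eps]

theorem eps_smul (a : ℂ) (y : Fin 4 → ℂ) : eps (a • y) = a • eps y := by
  funext μ; fin_cases μ <;> simp [eps]

theorem eps_ne_zero (hy : y ≠ 0) : eps y ≠ 0 := by
  intro h
  apply hy
  rw [← eps_eps y, h]
  funext μ; fin_cases μ <;> simp [eps]

theorem Cone.eps (h : Cone L y) : Cone L (eps y) :=
  ⟨by simpa [NCSphere.eps] using h.h1, by simpa [NCSphere.eps] using h.h2⟩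

theorem Chain.eps (h : Chain L y y') : Chain L (eps y') (eps y) := by
  obtain ⟨a1, a2, a3, b1, b2, b3⟩ := h
  refine ⟨?_, ?_, ?_, ?_, ?_, ?_⟩ <;> simp [NCSphere.eps]
  · linear_combination -b1
  · linear_combination -b2
  · linear_combination -b3
  · linear_combination -a1
  · linear_combination -a2
  · linear_combination -a3

theorem Chain.smul (h : Chain L y y') (a b : ℂ) : Chain L (a • y) (b • y') := by
  obtain ⟨a1, a2, a3, b1, b2, b3⟩ := h
  refine ⟨?_, ?_, ?_, ?_, ?_, ?_⟩ <;> simp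
  · linear_combination a * b * a1
  · linear_combination a * b * a2
  · linear_combination a * b * a3
  · linear_combination a * b * b1
  · linear_combination a * b * b2
  · linear_combination a * b * b3

theorem Cone.smul (h : Cone L y) (a : ℂ) : Cone L (a • y) :=
  ⟨by simp; linear_combination a ^ 2 * h.h1, by simp; linear_combination a ^ 2 * h.h2⟩

/-- If `λ₀ λ_m + λ_k λ_l = 0`, then the square of the correspondence is a change of signs. -/
theorem Chain.sign (h : Chain L y y') (hL : Distinct L) {m : Fin 4} (hm : m ≠ 0)
    (hc : cc L m = 0) :
    Chain L y' fun μ => if μ = 0 ∨ μ = m then -y μ else y μ := by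
  have α1 := h.α1
  have α2 := h.α2
  have α3 := h.α3
  have β1 := h.β1
  have β2 := h.β2
  have β3 := h.β3
  fin_cases m
  · exact absurd rfl hm
  all_goals
    simp only [Fin.mk_one, Fin.reduceFinMk] at hc ⊢
    simp only [hc] at α1 α2 α3 β1 β2 β3
    apply Chain.of_solved hL <;> simp [hc]
  all_goals
    first
    | linear_combination β1 | linear_combination β2 | linear_combination β3
    | linear_combination α1 | linear_combination α2 | linear_combination α3
    | linear_combination -β1 | linear_combination -β2 | linear_combination -β3
    | linear_combination -α1 | linear_combination -α2 | linear_combination -α3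

end

/-! ### The correspondence on the curve -/

/-- The parameters as complex numbers. -/
def lv (lam : Fin 4 → Circle) : Fin 4 → ℂ := fun μ => (lam μ : ℂ)

theorem ev_add (c c' : Matrix (Fin 4) (Fin 4) ℂ) (y y' : Fin 4 → ℂ) :
    ev (c + c') y y' = ev c y y' + ev c' y y' := by
  simp only [ev, Matrix.add_apply, add_mul, Finset.sum_add_distrib]

theorem ev_smul (a : ℂ) (c : Matrix (Fin 4) (Fin 4) ℂ) (y y' : Fin 4 → ℂ) :
    ev (a • c) y y' = a * ev c y y' := by
  simp only [ev, Matrix.smul_apply, smul_eq_mul, Finset.mul_sum, mul_assoc]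

theorem ev_zero (y y' : Fin 4 → ℂ) : ev 0 y y' = 0 := by simp [ev]

theorem relA_mem (lam : Fin 4 → Circle) :
    relA lam 1 2 3 ∈ relSpace lam ∧ relA lam 2 3 1 ∈ relSpace lam ∧
      relA lam 3 1 2 ∈ relSpace lam ∧ relB lam 1 2 3 ∈ relSpace lam ∧
      relB lam 2 3 1 ∈ relSpace lam ∧ relB lam 3 1 2 ∈ relSpace lam := by
  refine ⟨?_, ?_, ?_, ?_, ?_, ?_⟩ <;> exact Submodule.subset_span (by simp)

/-- A linear condition holds on the space of relations if it holds on the six generators. -/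
theorem relSpace_induction {lam : Fin 4 → Circle} {p : Matrix (Fin 4) (Fin 4) ℂ → Prop}
    (a1 : p (relA lam 1 2 3)) (a2 : p (relA lam 2 3 1)) (a3 : p (relA lam 3 1 2))
    (b1 : p (relB lam 1 2 3)) (b2 : p (relB lam 2 3 1)) (b3 : p (relB lam 3 1 2))
    (zero : p 0) (add : ∀ ω ω', p ω → p ω' → p (ω + ω')) (smul : ∀ (a : ℂ) ω, p ω → p (a • ω))
    {ω : Matrix (Fin 4) (Fin 4) ℂ} (hω : ω ∈ relSpace lam) : p ω := by
  induction hω using Submodule.span_induction with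
  | mem ω h =>
    simp only [Set.mem_insert_iff, Set.mem_singleton_iff] at h
    rcases h with rfl | rfl | rfl | rfl | rfl | rfl <;> assumption
  | zero => exact zero
  | add ω ω' _ _ h h' => exact add _ _ h h'
  | smul a ω _ h => exact smul a ω h

theorem ev_single (i j : Fin 4) (a : ℂ) (y y' : Fin 4 → ℂ) :
    ev (Matrix.single i j a) y y' = a * y i * y' j := by
  unfold ev
  rw [Finset.sum_eq_single i, Finset.sum_eq_single j]
  · simp
  · intro b _ hb; simp [hb.symm]
  · simp
  · intro b _ hb
    refine Finset.sum_eq_zero fun k _ => ?_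
    simp [hb.symm]
  · simp

theorem ev_sub (c c' : Matrix (Fin 4) (Fin 4) ℂ) (y y' : Fin 4 → ℂ) :
    ev (c - c') y y' = ev c y y' - ev c' y y' := by
  simp only [ev, Matrix.sub_apply, sub_mul, Finset.sum_sub_distrib]

theorem ev_neg (c : Matrix (Fin 4) (Fin 4) ℂ) (y y' : Fin 4 → ℂ) :
    ev (-c) y y' = -ev c y y' := by
  simp only [ev, Matrix.neg_apply, neg_mul, Finset.sum_neg_distrib]

theorem ev_relA (lam : Fin 4 → Circle) (k l m : Fin 4) (y y' : Fin 4 → ℂ) :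
    ev (relA lam k l m) y y' = lv lam 0 * y k * y' 0 - lv lam k * y 0 * y' k
      + lv lam m * y l * y' m - lv lam l * y m * y' l := by
  simp only [relA, ev_add, ev_sub, ev_single, lv]

theorem ev_relB (lam : Fin 4 → Circle) (k l m : Fin 4) (y y' : Fin 4 → ℂ) :
    ev (relB lam k l m) y y' = -(lv lam k * y k * y' 0) + lv lam 0 * y 0 * y' k
      + lv lam l * y l * y' m - lv lam m * y m * y' l := by
  simp only [relB, ev_add, ev_sub, ev_neg, ev_single, lv]

theorem chain_iff {lam : Fin 4 → Circle} {y y' : Fin 4 → ℂ} :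
    Chain (lv lam) y y' ↔ ∀ ω ∈ relSpace lam, ev ω y y' = 0 := by
  constructor
  · rintro ⟨a1, a2, a3, b1, b2, b3⟩ ω hω
    refine relSpace_induction (p := fun ω => ev ω y y' = 0) ?_ ?_ ?_ ?_ ?_ ?_ (ev_zero _ _) ?_ ?_ hω
    · rw [ev_relA, a1]
    · rw [ev_relA, a2]
    · rw [ev_relA, a3]
    · rw [ev_relB, b1]
    · rw [ev_relB, b2]
    · rw [ev_relB, b3]
    · intro ω ω' h h'; rw [ev_add, h, h', add_zero]
    · intro a ω h; rw [ev_smul, h, mul_zero]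
  · intro h
    obtain ⟨a1, a2, a3, b1, b2, b3⟩ := relA_mem lam
    refine ⟨?_, ?_, ?_, ?_, ?_, ?_⟩
    · rw [← ev_relA]; exact h _ a1
    · rw [← ev_relA]; exact h _ a2
    · rw [← ev_relA]; exact h _ a3
    · rw [← ev_relB]; exact h _ b1
    · rw [← ev_relB]; exact h _ b2
    · rw [← ev_relB]; exact h _ b3

/-- The projective space `ℙ(V^*)`, where `V` is the space of generators. -/
abbrev PV : Type := Projectivization ℂ (Fin 4 → ℂ)

theorem mem_submodule_iff {Z : PV} {y : Fin 4 → ℂ} :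
    y ∈ Z.submodule ↔ ∃ a : ℂ, a • Z.rep = y := by
  rw [Projectivization.submodule_eq, Submodule.mem_span_singleton]

theorem rep_mem (Z : PV) : Z.rep ∈ Z.submodule := mem_submodule_iff.2 ⟨1, one_smul _ _⟩

/-- Two vectors on the same line are proportional. -/
theorem exists_smul_of_mem {Z : PV} {y y' : Fin 4 → ℂ} (hy : y ∈ Z.submodule) (hy0 : y ≠ 0)
    (hy' : y' ∈ Z.submodule) : ∃ a : ℂ, y' = a • y := by
  obtain ⟨a, rfl⟩ := mem_submodule_iff.1 hy
  obtain ⟨b, rfl⟩ := mem_submodule_iff.1 hy'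
  have ha : a ≠ 0 := fun h => hy0 (by rw [h, zero_smul])
  exact ⟨b / a, by rw [smul_smul, div_mul_cancel₀ _ ha]⟩

theorem eq_of_mem {Z Z' : PV} {y : Fin 4 → ℂ} (hy : y ∈ Z.submodule) (hy' : y ∈ Z'.submodule)
    (h : y ≠ 0) : Z = Z' := by
  obtain ⟨a, rfl⟩ := mem_submodule_iff.1 hy
  obtain ⟨b, hb⟩ := mem_submodule_iff.1 hy'
  have ha : a ≠ 0 := fun h0 => h (by rw [h0, zero_smul])
  rw [← Projectivization.mk_rep Z, ← Projectivization.mk_rep Z', Projectivization.mk_eq_mk_iff']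
  exact ⟨a⁻¹ * b, by rw [mul_smul, hb, smul_smul, inv_mul_cancel₀ ha, one_smul]⟩

theorem self_mem_mk (y : Fin 4 → ℂ) (hy : y ≠ 0) :
    y ∈ (Projectivization.mk ℂ y hy).submodule := by
  rw [Projectivization.submodule_mk]; exact Submodule.mem_span_singleton_self y

section

variable {lam : Fin 4 → Circle}

theorem mem_curve_iff {Z : PV} : Z ∈ curve lam ↔ ∀ y ∈ Z.submodule, Cone (lv lam) y := by
  simp only [curve, Set.mem_ofPred_eq, Fin.sum_univ_four]
  exact forall₂_congr fun y _ => ⟨fun h => ⟨h.1, h.2⟩, fun h => ⟨h.1, h.2⟩⟩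

theorem cone_of_mem (Z : curve lam) {y : Fin 4 → ℂ} (hy : y ∈ Z.1.submodule) :
    Cone (lv lam) y := mem_curve_iff.1 Z.2 y hy

theorem mem_curve_of_cone {Z : PV} {y : Fin 4 → ℂ} (hy : y ∈ Z.submodule) (hy0 : y ≠ 0)
    (h : Cone (lv lam) y) : Z ∈ curve lam := by
  rw [mem_curve_iff]
  intro y' hy'
  obtain ⟨a, rfl⟩ := exists_smul_of_mem hy hy0 hy'
  exact h.smul a

/-- The point of the curve below a vector of the cone. -/
def pt (y : Fin 4 → ℂ) (hy : y ≠ 0) (h : Cone (lv lam) y) : curve lam :=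
  ⟨Projectivization.mk ℂ y hy, mem_curve_of_cone (self_mem_mk y hy) hy h⟩

theorem self_mem_pt (y : Fin 4 → ℂ) (hy : y ≠ 0) (h : Cone (lv lam) y) :
    y ∈ (pt y hy h).1.submodule := self_mem_mk y hy

theorem gam_iff {Z Z' : PV} {y y' : Fin 4 → ℂ} (hy : y ∈ Z.submodule) (hy0 : y ≠ 0)
    (hy' : y' ∈ Z'.submodule) (hy'0 : y' ≠ 0) : Gam lam Z Z' ↔ Chain (lv lam) y y' := by
  rw [chain_iff]
  refine ⟨fun h ω hω => h ω hω _ hy _ hy', fun h ω hω u hu u' hu' => ?_⟩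
  obtain ⟨a, rfl⟩ := exists_smul_of_mem hy hy0 hu
  obtain ⟨b, rfl⟩ := exists_smul_of_mem hy' hy'0 hu'
  rw [ev_smul_smul, h ω hω, mul_zero]

/-- The characteristic property of the correspondence, on vectors. -/
theorem IsCorrespondence.mem_iff {σ : Equiv.Perm (curve lam)} (hσ : IsCorrespondence lam σ)
    {Z : curve lam} {y y' : Fin 4 → ℂ} (hy : y ∈ Z.1.submodule) (hy0 : y ≠ 0) :
    y' ∈ (σ Z).1.submodule ↔ Chain (lv lam) y y' := by
  have h1 : Gam lam Z.1 (σ Z).1 := (hσ Z _).2 rfl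
  constructor
  · intro h
    rw [chain_iff]
    exact fun ω hω => h1 ω hω _ hy _ h
  · intro h
    by_cases h0 : y' = 0
    · rw [h0]; exact Submodule.zero_mem _
    · have := (hσ Z (Projectivization.mk ℂ y' h0)).1
        ((gam_iff hy hy0 (self_mem_mk y' h0) h0).2 h)
      rw [← this]
      exact self_mem_mk y' h0

theorem IsCorrespondence.chain {σ : Equiv.Perm (curve lam)} (hσ : IsCorrespondence lam σ)
    {Z : curve lam} {y y' : Fin 4 → ℂ} (hy : y ∈ Z.1.submodule) (hy' : y' ∈ (σ Z).1.submodule) :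
    Chain (lv lam) y y' :=
  chain_iff.2 fun ω hω => ((hσ Z _).2 rfl) ω hω _ hy _ hy'

theorem mem_jE {Z : curve lam} {y : Fin 4 → ℂ} (hy : y ∈ Z.1.submodule) :
    jV lam y ∈ (jE lam Z).1.submodule := by
  obtain ⟨a, rfl⟩ := mem_submodule_iff.1 hy
  have : (jE lam Z).1 = Projectivization.mk ℂ (jV lam Z.1.rep)
      (fun h => Z.1.rep_nonzero (jV_injective lam (by rw [h, map_zero]))) := by
    have h : (jE lam Z).1 = Projectivization.map (jV lam) (jV_injective lam) Z.1 := rfl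
    rw [h]
    conv_lhs => rw [← Projectivization.mk_rep Z.1]
    rw [Projectivization.map_mk]
  rw [this, Projectivization.submodule_mk, LinearMap.map_smulₛₗ]
  exact Submodule.smul_mem _ _ (Submodule.mem_span_singleton_self _)

theorem jV_jV (y : Fin 4 → ℂ) : jV lam (jV lam y) = y := by
  funext μ
  rw [jV_apply, jV_apply, map_mul, Complex.conj_conj, ← mul_assoc, mul_comm _ (lam μ : ℂ),
    circle_mul_conj, one_mul]

theorem jV_ne_zero {y : Fin 4 → ℂ} (hy : y ≠ 0) : jV lam y ≠ 0 := fun h =>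
  hy (jV_injective lam (by rw [h, map_zero]))

/-- The conjugation reverses the correspondence. -/
theorem Chain.jV {y y' : Fin 4 → ℂ} (h : Chain (lv lam) y y') :
    Chain (lv lam) (jV lam y') (jV lam y) := by
  have key : ∀ κ μ ν : Fin 4, lv lam κ * NCSphere.jV lam y' μ * NCSphere.jV lam y ν
      = (starRingEnd ℂ) (lv lam μ * lv lam ν * y' μ * y ν) * lv lam κ := by
    intro κ μ ν
    simp only [jV_apply, map_mul, lv]; ring
  have hu : ∀ μ ν, (starRingEnd ℂ) (lv lam μ * lv lam ν * y' μ * y ν) * lv lam ν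
      = (starRingEnd ℂ) (lv lam μ * y' μ * y ν) := by
    intro μ ν
    have := circle_mul_conj (lam ν)
    simp only [map_mul, lv] at *
    linear_combination (starRingEnd ℂ) (lam μ : ℂ) * (starRingEnd ℂ) (y' μ)
      * (starRingEnd ℂ) (y ν) * this
  have hu' : ∀ μ ν, (starRingEnd ℂ) (lv lam μ * lv lam ν * y' μ * y ν) * lv lam μ
      = (starRingEnd ℂ) (lv lam ν * y' μ * y ν) := by
    intro μ ν
    have := circle_mul_conj (lam μ)
    simp only [map_mul, lv] at *
    linear_combination (starRingEnd ℂ) (lam ν : ℂ) * (starRingEnd ℂ) (y' μ)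
      * (starRingEnd ℂ) (y ν) * this
  obtain ⟨a1, a2, a3, b1, b2, b3⟩ := h
  constructor <;> simp only [key, hu, hu'] <;> simp only [← map_sub, ← map_add, ← map_neg] <;>
    rw [map_eq_zero_iff _ (starRingEnd ℂ).injective]
  · linear_combination -a1
  · linear_combination -a2
  · linear_combination -a3
  · linear_combination -b1
  · linear_combination -b2
  · linear_combination -b3

/-- The involution of the curve given by the change of sign of the first coordinate. -/
def epsE (Z : curve lam) : curve lam :=
  pt (eps Z.1.rep) (eps_ne_zero Z.1.rep_nonzero) (cone_of_mem Z (rep_mem Z.1)).eps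

theorem mem_epsE {Z : curve lam} {y : Fin 4 → ℂ} (hy : y ∈ Z.1.submodule) :
    eps y ∈ (epsE Z).1.submodule := by
  obtain ⟨a, rfl⟩ := mem_submodule_iff.1 hy
  rw [eps_smul]
  exact Submodule.smul_mem _ _ (self_mem_pt _ _ _)

theorem epsE_epsE (Z : curve lam) : epsE (epsE Z) = Z := by
  apply Subtype.ext
  refine eq_of_mem (mem_epsE (mem_epsE (rep_mem Z.1))) ?_ ?_
  · rw [eps_eps]; exact rep_mem Z.1
  · rw [eps_eps]; exact Z.1.rep_nonzero

theorem exists_step (hL : Distinct (lv lam)) (Z : curve lam) :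
    ∃ Z' : curve lam, Chain (lv lam) Z.1.rep Z'.1.rep := by
  have hZ := cone_of_mem Z (rep_mem Z.1)
  have h0 := Z.1.rep_nonzero
  obtain ⟨k, hk⟩ := hZ.exists_stepMap_ne hL h0
  have hc := hZ.chain_stepMap hL k
  have hm := self_mem_pt _ hk (hc.cone hZ hL h0)
  refine ⟨pt _ hk (hc.cone hZ hL h0), ?_⟩
  obtain ⟨a, ha⟩ := exists_smul_of_mem hm hk (rep_mem _)
  rw [ha]
  simpa using hc.smul 1 a

/-- The relations define a bijection `σ` of the curve, and `j σ = σ⁻¹ j`. The inverse is obtained by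
conjugation with the change of sign of the first coordinate. -/
theorem exists_correspondence (hL : Distinct (lv lam)) :
    ∃ σ : Equiv.Perm (curve lam), IsCorrespondence lam σ ∧
      (∀ Z, jE lam (σ Z) = σ⁻¹ (jE lam Z)) := by
  choose f hf using exists_step hL
  have huniq : ∀ (Z : curve lam) (Z' : PV), Chain (lv lam) Z.1.rep Z'.rep → Z' = (f Z).1 := by
    intro Z Z' h
    obtain ⟨s, hs⟩ := h.unique (hf Z) (cone_of_mem Z (rep_mem _)) hL Z.1.rep_nonzero
      (f Z).1.rep_nonzero
    refine eq_of_mem (rep_mem Z') ?_ Z'.rep_nonzero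
    rw [hs]
    exact Submodule.smul_mem _ _ (rep_mem _)
  have hgam : ∀ {Z Z' : PV}, Gam lam Z Z' ↔ Chain (lv lam) Z.rep Z'.rep := fun {Z Z'} =>
    gam_iff (rep_mem Z) Z.rep_nonzero (rep_mem Z') Z'.rep_nonzero
  have hinv : ∀ Z, epsE (f (epsE (f Z))) = Z := by
    intro Z
    have h1 : Gam lam (epsE (f Z)).1 (epsE Z).1 :=
      (gam_iff (mem_epsE (rep_mem _)) (eps_ne_zero (f Z).1.rep_nonzero)
        (mem_epsE (rep_mem _)) (eps_ne_zero Z.1.rep_nonzero)).2 (hf Z).eps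
    have h2 : f (epsE (f Z)) = epsE Z := Subtype.ext (huniq _ _ (hgam.1 h1)).symm
    rw [h2, epsE_epsE]
  have hσ : ∃ σ : Equiv.Perm (curve lam), ∀ Z, σ Z = f Z :=
    ⟨⟨f, fun Z => epsE (f (epsE Z)), hinv, fun Z => by
      have := congrArg epsE (hinv (epsE Z))
      rwa [epsE_epsE, epsE_epsE] at this⟩, fun _ => rfl⟩
  obtain ⟨σ, hσ⟩ := hσ
  have hcor : IsCorrespondence lam σ := by
    intro Z Z'
    rw [hσ, hgam]
    refine ⟨huniq Z Z', ?_⟩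
    rintro rfl
    exact hf Z
  refine ⟨σ, hcor, fun Z => ?_⟩
  rw [Equiv.Perm.eq_inv_iff_eq]
  apply Subtype.ext
  symm
  apply (hcor _ _).1
  have h1 := mem_jE (rep_mem (σ Z).1)
  have h2 := mem_jE (rep_mem Z.1)
  refine (gam_iff h1 (jV_ne_zero (σ Z).1.rep_nonzero) h2 (jV_ne_zero Z.1.rep_nonzero)).2 ?_
  exact (hcor.chain (rep_mem _) (rep_mem _)).jV

/-- A fourth power different from the identity excludes the degenerate parameters. -/
theorem cc_ne_of_pow_four (hL : Distinct (lv lam)) {σ : Equiv.Perm (curve lam)}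
    (hσ : IsCorrespondence lam σ) (h4 : σ ^ 4 ≠ 1) {m : Fin 4} (hm : m ≠ 0) :
    cc (lv lam) m ≠ 0 := by
  intro hc
  apply h4
  -- the change of signs which represents the square of the correspondence
  have key : ∀ (Z : curve lam) (y : Fin 4 → ℂ), y ∈ Z.1.submodule → y ≠ 0 →
      (fun μ => if μ = 0 ∨ μ = m then -y μ else y μ) ∈ (σ (σ Z)).1.submodule := by
    intro Z y hy hy0
    have h1 := hσ.chain hy (rep_mem (σ Z).1)
    exact (hσ.mem_iff (rep_mem _) (σ Z).1.rep_nonzero).2 (h1.sign hL hm hc)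
  ext1 Z
  apply Subtype.ext
  have hZ := Z.1.rep_nonzero
  have hs : ∀ y : Fin 4 → ℂ, y ≠ 0 → (fun μ => if μ = 0 ∨ μ = m then -y μ else y μ) ≠ 0 := by
    intro y hy h
    apply hy
    funext μ
    have := congrFun h μ
    simp only [Pi.zero_apply] at this ⊢
    split_ifs at this
    · simpa using this
    · exact this
  have h2 := key _ _ (key Z _ (rep_mem _) hZ) (hs _ hZ)
  have e : (σ ^ 4) Z = σ (σ (σ (σ Z))) := rfl
  rw [e, Equiv.Perm.one_apply]
  refine eq_of_mem h2 ?_ (hs _ (hs _ hZ))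
  convert rep_mem Z.1 using 1
  funext μ
  by_cases h : μ = 0 ∨ μ = m <;> simp [h]

end

/-! ### Plane sections and local parameters -/

theorem finite_quartic {p0 p1 p2 p3 p4 : ℂ}
    (h : p0 = 0 → p1 = 0 → p2 = 0 → p3 = 0 → p4 = 0 → False) :
    {u : ℂ | p4 * u ^ 4 + p3 * u ^ 3 + p2 * u ^ 2 + p1 * u + p0 = 0}.Finite := by
  set P : Polynomial ℂ := Polynomial.C p4 * Polynomial.X ^ 4 + Polynomial.C p3 * Polynomial.X ^ 3
    + Polynomial.C p2 * Polynomial.X ^ 2 + Polynomial.C p1 * Polynomial.X + Polynomial.C p0 with hP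
  have hP0 : P ≠ 0 := by
    intro h0
    apply h
    · simpa [hP, Polynomial.coeff_X, Polynomial.coeff_C] using
        congrArg (fun Q => Polynomial.coeff Q 0) h0
    · simpa [hP, Polynomial.coeff_X, Polynomial.coeff_C] using
        congrArg (fun Q => Polynomial.coeff Q 1) h0
    · simpa [hP, Polynomial.coeff_X, Polynomial.coeff_C] using
        congrArg (fun Q => Polynomial.coeff Q 2) h0
    · simpa [hP, Polynomial.coeff_X, Polynomial.coeff_C] using
        congrArg (fun Q => Polynomial.coeff Q 3) h0
    · simpa [hP, Polynomial.coeff_X, Polynomial.coeff_C] using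
        congrArg (fun Q => Polynomial.coeff Q 4) h0
  refine (P.roots.toFinset.finite_toSet).subset fun u hu => ?_
  simp only [Finset.mem_coe, Multiset.mem_toFinset, Polynomial.mem_roots hP0, Polynomial.IsRoot]
  simpa [hP] using hu

/-- On the curve, `y₂²` and `y₃²` are linear combinations of `y₀²` and `y₁²`. -/
theorem exists_coeff {L : Fin 4 → ℂ} (hL : Distinct L) : ∃ α β γ δ : ℂ, α ≠ 0 ∧ β ≠ 0 ∧ γ ≠ 0 ∧
    δ ≠ 0 ∧ α * δ - β * γ ≠ 0 ∧ ∀ y : Fin 4 → ℂ, Cone L y ↔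
      (y 2 ^ 2 = α * y 0 ^ 2 + β * y 1 ^ 2 ∧ y 3 ^ 2 = γ * y 0 ^ 2 + δ * y 1 ^ 2) := by
  have h23 := sub_ne_zero.2 (hL 2 3 (by decide))
  have h03 := sub_ne_zero.2 (hL 0 3 (by decide))
  have h13 := sub_ne_zero.2 (hL 1 3 (by decide))
  have h02 := sub_ne_zero.2 (hL 0 2 (by decide))
  have h12 := sub_ne_zero.2 (hL 1 2 (by decide))
  have h01 := sub_ne_zero.2 (hL 0 1 (by decide))
  refine ⟨-(L 0 ^ 2 - L 3 ^ 2) / (L 2 ^ 2 - L 3 ^ 2), -(L 1 ^ 2 - L 3 ^ 2) / (L 2 ^ 2 - L 3 ^ 2),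
    (L 0 ^ 2 - L 2 ^ 2) / (L 2 ^ 2 - L 3 ^ 2), (L 1 ^ 2 - L 2 ^ 2) / (L 2 ^ 2 - L 3 ^ 2),
    div_ne_zero (neg_ne_zero.2 h03) h23, div_ne_zero (neg_ne_zero.2 h13) h23,
    div_ne_zero h02 h23, div_ne_zero h12 h23, ?_, fun y => ⟨fun h => ⟨?_, ?_⟩, fun h => ⟨?_, ?_⟩⟩⟩
  · have : -(L 0 ^ 2 - L 3 ^ 2) / (L 2 ^ 2 - L 3 ^ 2) * ((L 1 ^ 2 - L 2 ^ 2) / (L 2 ^ 2 - L 3 ^ 2))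
      - -(L 1 ^ 2 - L 3 ^ 2) / (L 2 ^ 2 - L 3 ^ 2) * ((L 0 ^ 2 - L 2 ^ 2) / (L 2 ^ 2 - L 3 ^ 2))
      = (L 0 ^ 2 - L 1 ^ 2) / (L 2 ^ 2 - L 3 ^ 2) := by
      field_simp; ring
    rw [this]
    exact div_ne_zero h01 h23
  · field_simp
    linear_combination h.h2 - L 3 ^ 2 * h.h1
  · field_simp
    linear_combination L 2 ^ 2 * h.h1 - h.h2
  · rw [h.1, h.2]; field_simp; ring
  · rw [h.1, h.2]; field_simp; ring

/-- The coordinates of the points of a curve cut out by `y₂² = α y₀² + β y₁²` and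
`y₃² = γ y₀² + δ y₁²` are linearly independent: a linear relation restricts `y₀ / y₁` to the zeros
of a non-zero polynomial. -/
theorem finite_ratio {α β γ δ : ℂ} (hα : α ≠ 0) (hβ : β ≠ 0) (hγ : γ ≠ 0) (hδ : δ ≠ 0)
    (hdet : α * δ - β * γ ≠ 0) {a : Fin 4 → ℂ} (ha : a ≠ 0) :
    {u : ℂ | ∃ v w : ℂ, v ^ 2 = α * u ^ 2 + β ∧ w ^ 2 = γ * u ^ 2 + δ ∧
      a 0 * u + a 1 + a 2 * v + a 3 * w = 0}.Finite := by
  by_cases h3 : a 3 = 0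
  · by_cases h2 : a 2 = 0
    · refine (finite_quartic (p0 := a 1) (p1 := a 0) (p2 := 0) (p3 := 0) (p4 := 0) ?_).subset ?_
      · intro h1 h0 _ _ _
        exact ha (by funext μ; fin_cases μ <;> simpa)
      · rintro u ⟨v, w, -, -, h⟩
        rw [h2, h3] at h
        simp only [Set.mem_ofPred_eq]
        linear_combination h
    · refine (finite_quartic (p0 := a 2 ^ 2 * β - a 1 ^ 2) (p1 := -2 * a 0 * a 1)
        (p2 := a 2 ^ 2 * α - a 0 ^ 2) (p3 := 0) (p4 := 0) ?_).subset ?_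
      · intro e0 e1 e2 _ _
        have h01 : a 0 * a 1 = 0 := by linear_combination -e1 / 2
        rcases mul_eq_zero.1 h01 with h | h
        · rw [h] at e2; simp [h2, hα] at e2
        · rw [h] at e0; simp [h2, hβ] at e0
      · rintro u ⟨v, w, hv, -, h⟩
        rw [h3] at h
        simp only [Set.mem_ofPred_eq]
        linear_combination -a 2 ^ 2 * hv + (-a 0 * u - a 1 + a 2 * v) * h
  · set k2 := a 3 ^ 2 * γ - a 0 ^ 2 - a 2 ^ 2 * α with hk2
    set k1 := -2 * a 0 * a 1 with hk1
    set k0 := a 3 ^ 2 * δ - a 1 ^ 2 - a 2 ^ 2 * β with hk0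
    set p := 2 * a 2 * a 0 with hp
    set q := 2 * a 2 * a 1 with hq
    refine (finite_quartic (p0 := q ^ 2 * β - k0 ^ 2) (p1 := 2 * (p * q * β - k1 * k0))
      (p2 := q ^ 2 * α + p ^ 2 * β - k1 ^ 2 - 2 * k2 * k0) (p3 := 2 * (p * q * α - k2 * k1))
      (p4 := p ^ 2 * α - k2 ^ 2) ?_).subset ?_
    · -- `4 a₂² (a₀ u + a₁)² (α u² + β)` is not a square unless it vanishes
      intro e0 e1 e2 e3 e4
      have e1 : p * q * β = k1 * k0 := by linear_combination e1 / 2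
      have e3 : p * q * α = k2 * k1 := by linear_combination e3 / 2
      have hpq : p = 0 ∧ q = 0 := by
        by_cases hp0 : p = 0
        · refine ⟨hp0, ?_⟩
          rw [hp0] at e4 e2 e1
          have hk2 : k2 = 0 := by simpa using e4
          rw [hk2] at e2
          have h10 : k1 * k0 = 0 := by rw [← e1]; ring
          have : q ^ 4 * (α * β) = 0 := by
            have e0' : q ^ 2 * β = k0 ^ 2 := by linear_combination e0
            have e2' : q ^ 2 * α = k1 ^ 2 := by linear_combination e2
            calc q ^ 4 * (α * β) = (q ^ 2 * α) * (q ^ 2 * β) := by ring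
              _ = (k1 * k0) ^ 2 := by rw [e0', e2']; ring
              _ = 0 := by rw [h10]; ring
          simpa [hα, hβ] using this
        · exfalso
          have h1 : q ^ 2 * α = k1 ^ 2 := by
            apply mul_left_cancel₀ (mul_ne_zero (pow_ne_zero 2 hp0) hα)
            linear_combination (p * q * α + k2 * k1) * e3 - k1 ^ 2 * e4
          by_cases hq0 : q = 0
          · rw [hq0] at e0 h1 e2
            have hk0 : k0 = 0 := by simpa using e0
            have hk1 : k1 = 0 := by simpa using h1.symm
            rw [hk0, hk1] at e2
            simp [hp0, hβ] at e2
          · have h2 : p ^ 2 * β = k1 ^ 2 := by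
              apply mul_left_cancel₀ (mul_ne_zero (pow_ne_zero 2 hq0) hβ)
              linear_combination (p * q * β + k1 * k0) * e1 - k1 ^ 2 * e0
            have h3 : q ^ 2 * α = 2 * k2 * k0 := by linear_combination e2 - h2
            have h4 : (q ^ 2 * α) * (q ^ 2 * α) = (q ^ 2 * α) * (4 * (p ^ 2 * β)) := by
              linear_combination (q ^ 2 * α + 2 * k2 * k0) * h3 - 4 * k0 ^ 2 * e4
                - 4 * p ^ 2 * α * e0
            have h5 := mul_left_cancel₀ (mul_ne_zero (pow_ne_zero 2 hq0) hα) h4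
            have : q ^ 2 * α = 0 := by linear_combination (4 * (h1 - h2) - h5) / 3
            simp [hq0, hα] at this
      obtain ⟨hp0, hq0⟩ := hpq
      rw [hp0] at e4
      rw [hq0] at e0
      have z2 : k2 = 0 := by simpa using e4
      have z0 : k0 = 0 := by simpa using e0
      have z1 : k1 = 0 := by
        rw [hp0, hq0, z2, z0] at e2
        simpa using e2
      have h01 : a 0 * a 1 = 0 := by rw [hk1] at z1; linear_combination -z1 / 2
      by_cases h2 : a 2 = 0
      · rw [hk2, h2] at z2
        rw [hk0, h2] at z0
        rcases mul_eq_zero.1 h01 with h | h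
        · rw [h] at z2; simp [h3, hγ] at z2
        · rw [h] at z0; simp [h3, hδ] at z0
      · have ha0 : a 0 = 0 := by simpa [hp, h2] using hp0
        have ha1 : a 1 = 0 := by simpa [hq, h2] using hq0
        rw [hk2, ha0] at z2
        rw [hk0, ha1] at z0
        have : a 3 ^ 2 * (α * δ - β * γ) = 0 := by linear_combination α * z0 - β * z2
        simp [h3, hdet] at this
    · rintro u ⟨v, w, hv, hw, h⟩
      simp only [Set.mem_ofPred_eq]
      have e : (p * u + q) * v = k2 * u ^ 2 + k1 * u + k0 := by
        rw [hp, hq, hk2, hk1, hk0]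
        linear_combination (a 0 * u + a 1 + a 2 * v - a 3 * w) * h + a 3 ^ 2 * hw - a 2 ^ 2 * hv
      linear_combination ((p * u + q) * v + (k2 * u ^ 2 + k1 * u + k0)) * e - (p * u + q) ^ 2 * hv

/-- A point of the curve is determined up to finitely many choices by the squares of the coordinates
of a vector. -/
theorem finite_sq_eq {lam : Fin 4 → Circle} (s : Fin 4 → ℂ) :
    {Z : curve lam | ∃ y ∈ Z.1.submodule, y ≠ 0 ∧ ∀ μ, y μ ^ 2 = s μ}.Finite := by
  have h1 : {y : Fin 4 → ℂ | ∀ μ, y μ ^ 2 = s μ}.Finite := by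
    have : {y : Fin 4 → ℂ | ∀ μ, y μ ^ 2 = s μ} = Set.univ.pi fun μ => {u : ℂ | u ^ 2 = s μ} := by
      ext y; simp
    rw [this]
    refine Set.Finite.pi fun μ => ?_
    refine (finite_quartic (p0 := -s μ) (p1 := 0) (p2 := 1) (p3 := 0) (p4 := 0)
      (by simp)).subset fun u hu => ?_
    simp only [Set.mem_ofPred_eq] at hu ⊢
    rw [hu]; ring
  refine (h1.biUnion (t := fun y => {Z : curve lam | y ∈ Z.1.submodule ∧ y ≠ 0})
    fun y _ => ?_).subset ?_
  · apply Set.Subsingleton.finite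
    rintro Z ⟨hZ, h0⟩ Z' ⟨hZ', -⟩
    exact Subtype.ext (eq_of_mem hZ hZ' h0)
  · rintro Z ⟨y, hy, h0, hs⟩
    exact Set.mem_biUnion hs ⟨hy, h0⟩

/-- A plane meets the curve in finitely many points. -/
theorem finite_plane_section {lam : Fin 4 → Circle} (hL : Distinct (lv lam)) {a : Fin 4 → ℂ}
    (ha : a ≠ 0) : {Z : curve lam | ∑ μ, a μ * Z.1.rep μ = 0}.Finite := by
  obtain ⟨α, β, γ, δ, hα, hβ, hγ, hδ, hdet, hc⟩ := exists_coeff hL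
  have hfin := finite_ratio hα hβ hγ hδ hdet ha
  refine ((finite_sq_eq (lam := lam) ![1, 0, α, γ]).union (hfin.biUnion fun u _ =>
    finite_sq_eq (lam := lam) ![u ^ 2, 1, α * u ^ 2 + β, γ * u ^ 2 + δ])).subset ?_
  intro Z hZ
  simp only [Set.mem_ofPred_eq, Fin.sum_univ_four] at hZ
  have hcone := cone_of_mem Z (rep_mem Z.1)
  have hne := Z.1.rep_nonzero
  obtain ⟨e2, e3⟩ := (hc _).1 hcone
  by_cases h1 : Z.1.rep 1 = 0
  · left
    have h0 := hcone.ne_zero hL hne (ν := 0) (by decide) h1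
    refine ⟨(Z.1.rep 0)⁻¹ • Z.1.rep, Submodule.smul_mem _ _ (rep_mem _),
      smul_ne_zero (inv_ne_zero h0) hne, fun μ => ?_⟩
    rw [Pi.smul_apply, smul_eq_mul, mul_pow, inv_pow, inv_mul_eq_iff_eq_mul₀ (pow_ne_zero 2 h0)]
    fin_cases μ
    · exact (mul_one _).symm
    · simp [h1]
    · simpa [h1, mul_comm] using e2
    · simpa [h1, mul_comm] using e3
  · right
    have m2 : (Z.1.rep 2 / Z.1.rep 1) ^ 2 = α * (Z.1.rep 0 / Z.1.rep 1) ^ 2 + β := by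
      field_simp; linear_combination e2
    have m3 : (Z.1.rep 3 / Z.1.rep 1) ^ 2 = γ * (Z.1.rep 0 / Z.1.rep 1) ^ 2 + δ := by
      field_simp; linear_combination e3
    refine Set.mem_biUnion (x := Z.1.rep 0 / Z.1.rep 1)
      ⟨Z.1.rep 2 / Z.1.rep 1, Z.1.rep 3 / Z.1.rep 1, m2, m3, ?_⟩ ?_
    · field_simp; linear_combination hZ
    · refine ⟨(Z.1.rep 1)⁻¹ • Z.1.rep, Submodule.smul_mem _ _ (rep_mem _),
        smul_ne_zero (inv_ne_zero h1) hne, fun μ => ?_⟩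
      rw [Pi.smul_apply, smul_eq_mul, mul_pow, inv_pow,
        inv_mul_eq_iff_eq_mul₀ (pow_ne_zero 2 h1)]
      fin_cases μ
      · simp; field_simp
      · exact (mul_one _).symm
      · simp only [Fin.reduceFinMk, Matrix.cons_val]; rw [← m2]; field_simp
      · simp only [Fin.reduceFinMk, Matrix.cons_val]; rw [← m3]; field_simp

theorem cpow_half_sq (z : ℂ) : (z ^ (1 / 2 : ℂ)) ^ 2 = z := by
  rw [← Complex.cpow_nat_mul]; norm_num

/-- Near each of its points the curve is parametrized by a holomorphic map to the cone, along which
all the coordinates are different from zero except at the given point; the parameters of every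
point are finite in number. -/
theorem exists_chart {L : Fin 4 → ℂ} (hL : Distinct L) {y : Fin 4 → ℂ} (hy : Cone L y)
    (hy0 : y ≠ 0) : ∃ (h : ℂ → Fin 4 → ℂ) (r : ℝ), 0 < r ∧ h 0 = y ∧ (∀ t, Cone L (h t)) ∧
      (∀ t, h t ≠ 0) ∧ (∀ μ, DifferentiableOn ℂ (fun t => h t μ) (Metric.ball 0 r)) ∧
      (∀ t ∈ Metric.ball (0 : ℂ) r, t ≠ 0 → ∀ μ, h t μ ≠ 0) ∧
      (∀ z, Cone L z → z ≠ 0 → {t | ∃ s : ℂ, h t = s • z}.Finite) := by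
  obtain ⟨α, β, γ, δ, hα, hβ, hγ, hδ, hdet, hc⟩ := exists_coeff hL
  obtain ⟨e2, e3⟩ := (hc _).1 hy
  -- a direction transversal to the squares of the coordinates of the given point
  obtain ⟨b0, b1, hb⟩ : ∃ b0 b1 : ℂ, y 0 ^ 2 * b1 - y 1 ^ 2 * b0 ≠ 0 := by
    by_cases h0 : y 0 = 0
    · exact ⟨1, 0, by simp [h0, hy.ne_zero hL hy0 (ν := 1) (by decide) h0]⟩
    · exact ⟨0, 1, by simp [h0]⟩
  set b : Fin 4 → ℂ := ![b0, b1, α * b0 + β * b1, γ * b0 + δ * b1] with hbdef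
  have hb0 : b 0 = b0 := rfl
  have hb1 : b 1 = b1 := rfl
  have hb2 : b 2 = α * b0 + β * b1 := rfl
  have hb3 : b 3 = γ * b0 + δ * b1 := rfl
  have hbμ : ∀ μ, y μ = 0 → b μ ≠ 0 := by
    intro μ hμ hbz
    fin_cases μ <;> simp only [Fin.zero_eta, Fin.mk_one, Fin.reduceFinMk] at hμ hbz
    · rw [hb0] at hbz; apply hb; rw [hμ, hbz]; ring
    · rw [hb1] at hbz; apply hb; rw [hμ, hbz]; ring
    · rw [hμ] at e2; rw [hb2] at hbz
      have : β * (y 0 ^ 2 * b1 - y 1 ^ 2 * b0) = 0 := by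
        linear_combination y 0 ^ 2 * hbz + b0 * e2
      exact (mul_ne_zero hβ hb) this
    · rw [hμ] at e3; rw [hb3] at hbz
      have : δ * (y 0 ^ 2 * b1 - y 1 ^ 2 * b0) = 0 := by
        linear_combination y 0 ^ 2 * hbz + b0 * e3
      exact (mul_ne_zero hδ hb) this
  -- the square roots of `y_μ² + t² b_μ`, which are holomorphic in `t` even where `y_μ = 0`
  set h : ℂ → Fin 4 → ℂ := fun t μ => if y μ = 0 then b μ ^ (1 / 2 : ℂ) * t
    else y μ * (1 + t ^ 2 * (b μ / y μ ^ 2)) ^ (1 / 2 : ℂ) with hh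
  have hsq : ∀ t μ, h t μ ^ 2 = y μ ^ 2 + t ^ 2 * b μ := by
    intro t μ
    simp only [hh]
    split_ifs with hμ
    · rw [mul_pow, cpow_half_sq, hμ]; ring
    · rw [mul_pow, cpow_half_sq]; field_simp
  have hslit : ∀ᶠ t : ℂ in nhds 0, ∀ μ, 1 + t ^ 2 * (b μ / y μ ^ 2) ∈ Complex.slitPlane := by
    rw [Filter.eventually_all]
    intro μ
    have hcont : Continuous fun t : ℂ => 1 + t ^ 2 * (b μ / y μ ^ 2) := by fun_prop
    refine hcont.continuousAt.eventually_mem (Complex.isOpen_slitPlane.mem_nhds ?_)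
    simp
  obtain ⟨r, hr, hball⟩ := Metric.eventually_nhds_iff_ball.1 hslit
  refine ⟨h, r, hr, ?_, ?_, ?_, ?_, ?_, ?_⟩
  · funext μ
    simp only [hh]
    split_ifs with hμ
    · simp [hμ]
    · simp
  · intro t
    rw [hc]
    simp only [hsq, hb0, hb1, hb2, hb3]
    constructor
    · linear_combination e2
    · linear_combination e3
  · intro t ht
    have z0 := hsq t 0
    have z1 := hsq t 1
    rw [ht, hb0] at z0
    rw [ht, hb1] at z1
    simp only [Pi.zero_apply] at z0 z1
    have q1 : t ^ 2 * (y 0 ^ 2 * b1 - y 1 ^ 2 * b0) = 0 := by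
      linear_combination y 1 ^ 2 * z0 - y 0 ^ 2 * z1
    have ht : t = 0 := by simpa [hb] using q1
    rw [ht] at z0 z1
    apply hb
    have z0' : y 0 ^ 2 = 0 := by linear_combination -z0
    have z1' : y 1 ^ 2 = 0 := by linear_combination -z1
    rw [z0', z1']; ring
  · intro μ
    by_cases hμ : y μ = 0
    · simp only [hh, hμ, if_true]
      fun_prop
    · simp only [hh, hμ, if_false]
      refine DifferentiableOn.const_mul (DifferentiableOn.cpow (by fun_prop) (by fun_prop) ?_) _
      intro t ht
      exact hball t ht μ
  · intro t ht ht0 μ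
    simp only [hh]
    split_ifs with hμ
    · refine mul_ne_zero ?_ ht0
      simp [Complex.cpow_eq_zero_iff, hbμ μ hμ]
    · refine mul_ne_zero hμ ?_
      simp [Complex.cpow_eq_zero_iff, Complex.slitPlane_ne_zero (hball t ht μ)]
  · intro z hz hz0
    refine (finite_quartic (p0 := y 0 ^ 2 * z 1 ^ 2 - y 1 ^ 2 * z 0 ^ 2) (p1 := 0)
      (p2 := b0 * z 1 ^ 2 - b1 * z 0 ^ 2) (p3 := 0) (p4 := 0) ?_).subset ?_
    · intro q0 _ q2 _ _
      have k0 : z 0 ^ 2 * (y 0 ^ 2 * b1 - y 1 ^ 2 * b0) = 0 := by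
        linear_combination b0 * q0 - y 0 ^ 2 * q2
      have k1 : z 1 ^ 2 * (y 0 ^ 2 * b1 - y 1 ^ 2 * b0) = 0 := by
        linear_combination b1 * q0 - y 1 ^ 2 * q2
      exact hz0 (hz.eq_zero hL (μ := 0) (ν := 1) (by decide) (by simpa [hb] using k0)
        (by simpa [hb] using k1))
    · rintro t ⟨s, hs⟩
      have z0 := hsq t 0
      have z1 := hsq t 1
      rw [hs, hb0] at z0
      rw [hs, hb1] at z1
      simp only [Pi.smul_apply, smul_eq_mul] at z0 z1
      simp only [Set.mem_ofPred_eq]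
      linear_combination -z 1 ^ 2 * z0 + z 0 ^ 2 * z1

theorem exists_cone {L : Fin 4 → ℂ} (hL : Distinct L) : ∃ y, Cone L y ∧ y ≠ 0 := by
  obtain ⟨α, β, γ, δ, hα, hβ, hγ, hδ, hdet, hc⟩ := exists_coeff hL
  refine ⟨![1, 0, α ^ (1 / 2 : ℂ), γ ^ (1 / 2 : ℂ)], (hc _).2 ?_, fun h => ?_⟩
  · constructor
    · simp [-one_div, cpow_half_sq]
    · simp [-one_div, cpow_half_sq]
  · simpa using congrFun h 0

theorem uncountable_curve {lam : Fin 4 → Circle} (hL : Distinct (lv lam)) :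
    Uncountable (curve lam) := by
  obtain ⟨y, hy, hy0⟩ := exists_cone hL
  obtain ⟨h, r, hr, -, hcone, hne, -, -, hfin⟩ := exists_chart hL hy hy0
  by_contra hcount
  rw [not_uncountable_iff] at hcount
  apply not_countable_complex
  refine (Set.countable_iUnion (t := fun Z : curve lam => {t | ∃ s : ℂ, h t = s • Z.1.rep})
    fun Z => (hfin _ (cone_of_mem Z (rep_mem _)) Z.1.rep_nonzero).countable).mono ?_
  intro t _
  obtain ⟨s, hs⟩ := mem_submodule_iff.1 (self_mem_pt (h t) (hne t) (hcone t))
  exact Set.mem_iUnion.2 ⟨pt (h t) (hne t) (hcone t), s, hs.symm⟩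

/-! ### Central quadratic forms -/

/-- The six relations, as linear conditions on a tensor. -/
structure TChain (L : Fin 4 → ℂ) (T : Fin 4 → Fin 4 → ℂ) : Prop where
  a1 : L 0 * T 1 0 - L 1 * T 0 1 + L 3 * T 2 3 - L 2 * T 3 2 = 0
  a2 : L 0 * T 2 0 - L 2 * T 0 2 + L 1 * T 3 1 - L 3 * T 1 3 = 0
  a3 : L 0 * T 3 0 - L 3 * T 0 3 + L 2 * T 1 2 - L 1 * T 2 1 = 0
  b1 : -(L 1 * T 1 0) + L 0 * T 0 1 + L 2 * T 2 3 - L 3 * T 3 2 = 0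
  b2 : -(L 2 * T 2 0) + L 0 * T 0 2 + L 3 * T 3 1 - L 1 * T 1 3 = 0
  b3 : -(L 3 * T 3 0) + L 0 * T 0 3 + L 1 * T 1 2 - L 2 * T 2 1 = 0

theorem TChain.kl {L : Fin 4 → ℂ} {T : Fin 4 → Fin 4 → ℂ} (h : TChain L T) (l : Fin 4) :
    TChain (L ∘ kl l) fun i j => T (kl l i) (kl l j) := by
  obtain ⟨a1, a2, a3, b1, b2, b3⟩ := h
  fin_cases l <;> refine ⟨?_, ?_, ?_, ?_, ?_, ?_⟩ <;> simp [NCSphere.kl] <;>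
    first
    | linear_combination a1
    | linear_combination -a1
    | linear_combination a2
    | linear_combination -a2
    | linear_combination a3
    | linear_combination -a3
    | linear_combination b1
    | linear_combination -b1
    | linear_combination b2
    | linear_combination -b2
    | linear_combination b3
    | linear_combination -b3

theorem TChain.add {L : Fin 4 → ℂ} {T T' : Fin 4 → Fin 4 → ℂ} (h : TChain L T)
    (h' : TChain L T') : TChain L fun i j => T i j + T' i j := by
  constructor
  · linear_combination h.a1 + h'.a1
  · linear_combination h.a2 + h'.a2
  · linear_combination h.a3 + h'.a3
  · linear_combination h.b1 + h'.b1
  · linear_combination h.b2 + h'.b2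
  · linear_combination h.b3 + h'.b3

theorem TChain.smul {L : Fin 4 → ℂ} {T : Fin 4 → Fin 4 → ℂ} (h : TChain L T) (s : ℂ) :
    TChain L fun i j => s * T i j := by
  constructor
  · linear_combination s * h.a1
  · linear_combination s * h.a2
  · linear_combination s * h.a3
  · linear_combination s * h.b1
  · linear_combination s * h.b2
  · linear_combination s * h.b3

theorem TChain.of_solved {L : Fin 4 → ℂ} {T : Fin 4 → Fin 4 → ℂ} (hL : Distinct L)
    (α1 : dd L 1 * T 1 0 + cc L 3 * T 2 3 - cc L 2 * T 3 2 = 0)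
    (α2 : dd L 2 * T 2 0 + cc L 1 * T 3 1 - cc L 3 * T 1 3 = 0)
    (α3 : dd L 3 * T 3 0 + cc L 2 * T 1 2 - cc L 1 * T 2 1 = 0)
    (β1 : dd L 1 * T 0 1 + cc L 2 * T 2 3 - cc L 3 * T 3 2 = 0)
    (β2 : dd L 2 * T 0 2 + cc L 3 * T 3 1 - cc L 1 * T 1 3 = 0)
    (β3 : dd L 3 * T 0 3 + cc L 1 * T 1 2 - cc L 2 * T 2 1 = 0) : TChain L T := by
  have d1 := hL.dd_ne (k := 1) (by decide)
  have d2 := hL.dd_ne (k := 2) (by decide)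
  have d3 := hL.dd_ne (k := 3) (by decide)
  constructor
  · apply mul_left_cancel₀ d1
    simp only [cc_two, cc_three, dd] at *; linear_combination L 0 * α1 - L 1 * β1
  · apply mul_left_cancel₀ d2
    simp only [cc_one, cc_three, dd] at *; linear_combination L 0 * α2 - L 2 * β2
  · apply mul_left_cancel₀ d3
    simp only [cc_one, cc_two, dd] at *; linear_combination L 0 * α3 - L 3 * β3
  · apply mul_left_cancel₀ d1
    simp only [cc_two, cc_three, dd] at *; linear_combination L 0 * β1 - L 1 * α1
  · apply mul_left_cancel₀ d2
    simp only [cc_one, cc_three, dd] at *; linear_combination L 0 * β2 - L 2 * α2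
  · apply mul_left_cancel₀ d3
    simp only [cc_one, cc_two, dd] at *; linear_combination L 0 * β3 - L 3 * α3

/-- The diagonal bilinear form `∑ d_μ p_μ r_μ`. -/
def dq (d p r : Fin 4 → ℂ) : ℂ :=
  d 0 * p 0 * r 0 + d 1 * p 1 * r 1 + d 2 * p 2 * r 2 + d 3 * p 3 * r 3

/-- The diagonal form `∑ (λ₀² - λ_k²) (λ₀ λ_k + λ_l λ_m) z_k²`, in which `z₀²` does not occur. -/
def om (L : Fin 4 → ℂ) : Fin 4 → ℂ := fun k => dd L k * cc L k

/-- The equation of central quadratic forms for a diagonal form, on vectors: `a` and `a'` represent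
`σ⁻¹(Z)` and `Z`, while `b` and `b'` represent `Z'` and `σ(Z')`. -/
def CForm (L d : Fin 4 → ℂ) : Prop :=
  ∀ ⦃a a' b b' : Fin 4 → ℂ⦄, Cone L a → Cone L b → Cone L a' → Cone L b' → Chain L a a' →
    Chain L b b' → a ≠ 0 → b ≠ 0 → a' ≠ 0 → b' ≠ 0 →
    TChain L fun i j => a' i * b j * dq d b' a + b' i * a j * dq d a' b

/-- The form vanishes on the graph of the correspondence. -/
def VForm (L d : Fin 4 → ℂ) : Prop :=
  ∀ ⦃a a' : Fin 4 → ℂ⦄, Cone L a → Chain L a a' → a ≠ 0 → dq d a a' = 0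

section

variable {L : Fin 4 → ℂ}

/-- Where the first coordinate vanishes, the last three coordinates of the next point are those
of the given point, multiplied by the numbers `λ₀ λ_k + λ_l λ_m`. -/
theorem Chain.exists_smul (hL : Distinct L) {a a' : Fin 4 → ℂ} (h : Chain L a a') (ha : Cone L a)
    (ha0 : a ≠ 0) (h0 : a 0 = 0) : ∃ t, a' 1 = t * (cc L 1 * a 1) ∧ a' 2 = t * (cc L 2 * a 2) ∧
      a' 3 = t * (cc L 3 * a 3) := by
  have a1 := ha.ne_zero hL ha0 (ν := 1) (by decide) h0
  have a2 := ha.ne_zero hL ha0 (ν := 2) (by decide) h0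
  have β1 := h.β1
  have β2 := h.β2
  have β3 := h.β3
  rw [h0] at β1 β2 β3
  by_cases hc : cc L 1 = 0
  · have hc2 := hL.cc_ne (l := 2) (by decide) (by decide) (by decide) hc
    refine ⟨a' 2 / (cc L 2 * a 2), ?_, ?_, ?_⟩ <;> field_simp
    · linear_combination -β3
    · linear_combination β1
  · refine ⟨a' 1 / (cc L 1 * a 1), ?_, ?_, ?_⟩ <;> field_simp
    · linear_combination β3
    · linear_combination -β2

theorem dq_om (p r : Fin 4 → ℂ) : dq (om L) p r = dd L 1 * cc L 1 * p 1 * r 1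
    + dd L 2 * cc L 2 * p 2 * r 2 + dd L 3 * cc L 3 * p 3 * r 3 := by
  simp [dq, om, dd]

theorem vForm_om (hL : Distinct L) : VForm L (om L) := by
  intro a a' ha h ha0
  rw [dq_om]
  by_cases h0 : a 0 = 0
  · obtain ⟨t, e1, e2, e3⟩ := h.exists_smul hL ha ha0 h0
    have hd := ha.det
    rw [h0] at hd
    rw [e1, e2, e3]
    linear_combination t * hd
  · apply mul_left_cancel₀ h0
    linear_combination cc L 1 * a 1 * h.β1 + cc L 2 * a 2 * h.β2 + cc L 3 * a 3 * h.β3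

/-- The half of the equation of central quadratic forms which is proved by vector calculus. With
`A = (λ₀ λ_k + λ_l λ_m) a`, the points `a`, `a'` satisfy `a₀ D a' = a' × A`, and similarly for
`b`, `b'`; the equation then follows from the triple product formula. -/
theorem central_om (hL : Distinct L) {a a' b b' : Fin 4 → ℂ} (ha : Cone L a) (hb : Cone L b)
    (h : Chain L a a') (h' : Chain L b b') (ha0 : a ≠ 0) (hb0 : b ≠ 0) :
    (dd L 1 * a' 1 * b 0 + cc L 3 * a' 2 * b 3 - cc L 2 * a' 3 * b 2) * dq (om L) b' a
      + (dd L 1 * b' 1 * a 0 + cc L 3 * b' 2 * a 3 - cc L 2 * b' 3 * a 2) * dq (om L) a' b = 0 ∧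
    (dd L 2 * a' 2 * b 0 + cc L 1 * a' 3 * b 1 - cc L 3 * a' 1 * b 3) * dq (om L) b' a
      + (dd L 2 * b' 2 * a 0 + cc L 1 * b' 3 * a 1 - cc L 3 * b' 1 * a 3) * dq (om L) a' b = 0 ∧
    (dd L 3 * a' 3 * b 0 + cc L 2 * a' 1 * b 2 - cc L 1 * a' 2 * b 1) * dq (om L) b' a
      + (dd L 3 * b' 3 * a 0 + cc L 2 * b' 1 * a 2 - cc L 1 * b' 2 * a 1) * dq (om L) a' b = 0 := by
  -- the case where the first coordinate of `a` vanishes, and that of `b` does not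
  have special : ∀ {a a' b b' : Fin 4 → ℂ}, Cone L a → Chain L a a' → Chain L b b' → a ≠ 0 →
      a 0 = 0 → b 0 ≠ 0 →
      (dd L 1 * a' 1 * b 0 + cc L 3 * a' 2 * b 3 - cc L 2 * a' 3 * b 2) * dq (om L) b' a
        + (dd L 1 * b' 1 * a 0 + cc L 3 * b' 2 * a 3 - cc L 2 * b' 3 * a 2) * dq (om L) a' b = 0 ∧
      (dd L 2 * a' 2 * b 0 + cc L 1 * a' 3 * b 1 - cc L 3 * a' 1 * b 3) * dq (om L) b' a
        + (dd L 2 * b' 2 * a 0 + cc L 1 * b' 3 * a 1 - cc L 3 * b' 1 * a 3) * dq (om L) a' b = 0 ∧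
      (dd L 3 * a' 3 * b 0 + cc L 2 * a' 1 * b 2 - cc L 1 * a' 2 * b 1) * dq (om L) b' a
        + (dd L 3 * b' 3 * a 0 + cc L 2 * b' 1 * a 2 - cc L 1 * b' 2 * a 1) * dq (om L) a' b
        = 0 := by
    intro a a' b b' ha h h' ha0 h0 hb
    obtain ⟨t, e1, e2, e3⟩ := h.exists_smul hL ha ha0 h0
    have hd := ha.det
    have p1 := h'.β1
    have p2 := h'.β2
    have p3 := h'.β3
    simp only [dq_om, h0, e1, e2, e3] at hd ⊢
    generalize hA1 : cc L 1 * a 1 = A1 at *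
    generalize hA2 : cc L 2 * a 2 = A2 at *
    generalize hA3 : cc L 3 * a 3 = A3 at *
    have hs : ∀ x y z : ℂ, dd L 1 * cc L 1 * x * a 1 + dd L 2 * cc L 2 * y * a 2
        + dd L 3 * cc L 3 * z * a 3 = dd L 1 * x * A1 + dd L 2 * y * A2 + dd L 3 * z * A3 := by
      intro x y z; rw [← hA1, ← hA2, ← hA3]; ring
    have hd' : dd L 1 * A1 ^ 2 + dd L 2 * A2 ^ 2 + dd L 3 * A3 ^ 2 = 0 := by
      rw [← hA1, ← hA2, ← hA3]; linear_combination hd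
    have hN : b 0 * (dd L 1 * b' 1 * A1 + dd L 2 * b' 2 * A2 + dd L 3 * b' 3 * A3)
        = (b' 2 * (cc L 3 * b 3) - b' 3 * (cc L 2 * b 2)) * A1
          + (b' 3 * (cc L 1 * b 1) - b' 1 * (cc L 3 * b 3)) * A2
          + (b' 1 * (cc L 2 * b 2) - b' 2 * (cc L 1 * b 1)) * A3 := by
      linear_combination A1 * p1 + A2 * p2 + A3 * p3
    rw [hs]
    refine ⟨?_, ?_, ?_⟩ <;> apply mul_left_cancel₀ hb
    · linear_combination t * b 0 * dd L 1 * A1 * hN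
        + t * b 0 * (b' 2 * (cc L 3 * b 3) - b' 3 * (cc L 2 * b 2)) * hd'
        + t * b 0 * (dd L 1 * A1 * (cc L 1 * b 1) + dd L 2 * A2 * (cc L 2 * b 2)
          + dd L 3 * A3 * (cc L 3 * b 3)) * (b' 2 * hA3 - b' 3 * hA2)
    · linear_combination t * b 0 * dd L 2 * A2 * hN
        + t * b 0 * (b' 3 * (cc L 1 * b 1) - b' 1 * (cc L 3 * b 3)) * hd'
        + t * b 0 * (dd L 1 * A1 * (cc L 1 * b 1) + dd L 2 * A2 * (cc L 2 * b 2)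
          + dd L 3 * A3 * (cc L 3 * b 3)) * (b' 3 * hA1 - b' 1 * hA3)
    · linear_combination t * b 0 * dd L 3 * A3 * hN
        + t * b 0 * (b' 1 * (cc L 2 * b 2) - b' 2 * (cc L 1 * b 1)) * hd'
        + t * b 0 * (dd L 1 * A1 * (cc L 1 * b 1) + dd L 2 * A2 * (cc L 2 * b 2)
          + dd L 3 * A3 * (cc L 3 * b 3)) * (b' 1 * hA2 - b' 2 * hA1)
  by_cases ha' : a 0 = 0
  · by_cases hb' : b 0 = 0
    · obtain ⟨t, e1, e2, e3⟩ := h.exists_smul hL ha ha0 ha'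
      obtain ⟨s, f1, f2, f3⟩ := h'.exists_smul hL hb hb0 hb'
      simp only [dq_om, ha', hb', e1, e2, e3, f1, f2, f3]
      refine ⟨?_, ?_, ?_⟩ <;> ring
    · exact special ha h h' ha0 ha' hb'
  · by_cases hb' : b 0 = 0
    · obtain ⟨q1, q2, q3⟩ := special hb h' h hb0 hb' ha'
      refine ⟨?_, ?_, ?_⟩
      · linear_combination q1
      · linear_combination q2
      · linear_combination q3
    · have p1 := h.β1
      have p2 := h.β2
      have p3 := h.β3
      have r1 := h'.β1
      have r2 := h'.β2
      have r3 := h'.β3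
      simp only [dq_om]
      generalize hA1 : cc L 1 * a 1 = A1 at *
      generalize hA2 : cc L 2 * a 2 = A2 at *
      generalize hA3 : cc L 3 * a 3 = A3 at *
      generalize hB1 : cc L 1 * b 1 = B1 at *
      generalize hB2 : cc L 2 * b 2 = B2 at *
      generalize hB3 : cc L 3 * b 3 = B3 at *
      have hs : ∀ x y z : ℂ, dd L 1 * cc L 1 * x * a 1 + dd L 2 * cc L 2 * y * a 2
          + dd L 3 * cc L 3 * z * a 3 = dd L 1 * x * A1 + dd L 2 * y * A2 + dd L 3 * z * A3 := by
        intro x y z; rw [← hA1, ← hA2, ← hA3]; ring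
      have hs' : ∀ x y z : ℂ, dd L 1 * cc L 1 * x * b 1 + dd L 2 * cc L 2 * y * b 2
          + dd L 3 * cc L 3 * z * b 3 = dd L 1 * x * B1 + dd L 2 * y * B2 + dd L 3 * z * B3 := by
        intro x y z; rw [← hB1, ← hB2, ← hB3]; ring
      -- the scalars `⟨D b', A⟩` and `⟨D a', B⟩`
      have hN : b 0 * (dd L 1 * b' 1 * A1 + dd L 2 * b' 2 * A2 + dd L 3 * b' 3 * A3)
          = (b' 2 * B3 - b' 3 * B2) * A1 + (b' 3 * B1 - b' 1 * B3) * A2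
            + (b' 1 * B2 - b' 2 * B1) * A3 := by
        linear_combination A1 * r1 + A2 * r2 + A3 * r3
      have hM : a 0 * (dd L 1 * a' 1 * B1 + dd L 2 * a' 2 * B2 + dd L 3 * a' 3 * B3)
          = (a' 2 * A3 - a' 3 * A2) * B1 + (a' 3 * A1 - a' 1 * A3) * B2
            + (a' 1 * A2 - a' 2 * A1) * B3 := by
        linear_combination B1 * p1 + B2 * p2 + B3 * p3
      have hH : b 0 * ((a' 2 * A3 - a' 3 * A2) * b' 1 + (a' 3 * A1 - a' 1 * A3) * b' 2
            + (a' 1 * A2 - a' 2 * A1) * b' 3)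
          = a 0 * ((b' 2 * B3 - b' 3 * B2) * a' 1 + (b' 3 * B1 - b' 1 * B3) * a' 2
            + (b' 1 * B2 - b' 2 * B1) * a' 3) := by
        linear_combination -b 0 * (b' 1 * p1 + b' 2 * p2 + b' 3 * p3)
          + a 0 * (a' 1 * r1 + a' 2 * r2 + a' 3 * r3)
      rw [hs, hs']
      set N := dd L 1 * b' 1 * A1 + dd L 2 * b' 2 * A2 + dd L 3 * b' 3 * A3
      set M := dd L 1 * a' 1 * B1 + dd L 2 * a' 2 * B2 + dd L 3 * a' 3 * B3
      have g1 : a 0 * (dd L 1 * a' 1 * b 0 + cc L 3 * a' 2 * b 3 - cc L 2 * a' 3 * b 2)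
          = b 0 * (a' 2 * A3 - a' 3 * A2) + a 0 * (a' 2 * B3 - a' 3 * B2) := by
        linear_combination b 0 * p1 + a 0 * a' 2 * hB3 - a 0 * a' 3 * hB2
      have g2 : a 0 * (dd L 2 * a' 2 * b 0 + cc L 1 * a' 3 * b 1 - cc L 3 * a' 1 * b 3)
          = b 0 * (a' 3 * A1 - a' 1 * A3) + a 0 * (a' 3 * B1 - a' 1 * B3) := by
        linear_combination b 0 * p2 + a 0 * a' 3 * hB1 - a 0 * a' 1 * hB3
      have g3 : a 0 * (dd L 3 * a' 3 * b 0 + cc L 2 * a' 1 * b 2 - cc L 1 * a' 2 * b 1)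
          = b 0 * (a' 1 * A2 - a' 2 * A1) + a 0 * (a' 1 * B2 - a' 2 * B1) := by
        linear_combination b 0 * p3 + a 0 * a' 1 * hB2 - a 0 * a' 2 * hB1
      have g1' : b 0 * (dd L 1 * b' 1 * a 0 + cc L 3 * b' 2 * a 3 - cc L 2 * b' 3 * a 2)
          = a 0 * (b' 2 * B3 - b' 3 * B2) + b 0 * (b' 2 * A3 - b' 3 * A2) := by
        linear_combination a 0 * r1 + b 0 * b' 2 * hA3 - b 0 * b' 3 * hA2
      have g2' : b 0 * (dd L 2 * b' 2 * a 0 + cc L 1 * b' 3 * a 1 - cc L 3 * b' 1 * a 3)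
          = a 0 * (b' 3 * B1 - b' 1 * B3) + b 0 * (b' 3 * A1 - b' 1 * A3) := by
        linear_combination a 0 * r2 + b 0 * b' 3 * hA1 - b 0 * b' 1 * hA3
      have g3' : b 0 * (dd L 3 * b' 3 * a 0 + cc L 2 * b' 1 * a 2 - cc L 1 * b' 2 * a 1)
          = a 0 * (b' 1 * B2 - b' 2 * B1) + b 0 * (b' 1 * A2 - b' 2 * A1) := by
        linear_combination a 0 * r3 + b 0 * b' 1 * hA2 - b 0 * b' 2 * hA1
      have fin : ∀ {x y x' y' : ℂ}, a 0 * x = x' → b 0 * y = y' →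
          x' * (b 0 * N) + y' * (a 0 * M) = 0 → x * N + y * M = 0 := by
        intro x y x' y' hx hy hxy
        apply mul_left_cancel₀ (mul_ne_zero ha' hb')
        rw [← hx, ← hy] at hxy
        linear_combination hxy
      refine ⟨fin g1 g1' ?_, fin g2 g2' ?_, fin g3 g3' ?_⟩ <;> rw [hN, hM]
      · linear_combination (A3 * B2 - A2 * B3) * hH
      · linear_combination (A1 * B3 - A3 * B1) * hH
      · linear_combination (A2 * B1 - A1 * B2) * hH

theorem cForm_om (hL : Distinct L) : CForm L (om L) := by
  intro a a' b b' ha hb ha' hb' h h' ha0 hb0 ha'0 hb'0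
  obtain ⟨α1, α2, α3⟩ := central_om hL ha hb h h' ha0 hb0
  -- the change of sign of the first coordinate exchanges the two kinds of relations
  obtain ⟨β1, β2, β3⟩ := central_om hL hb'.eps ha'.eps h'.eps h.eps (eps_ne_zero hb'0)
    (eps_ne_zero ha'0)
  simp only [dq_om, eps, Matrix.cons_val] at α1 α2 α3 β1 β2 β3 ⊢
  apply TChain.of_solved hL
  · linear_combination α1
  · linear_combination α2
  · linear_combination α3
  · linear_combination -β1
  · linear_combination -β2
  · linear_combination -β3

theorem dq_kl (d p r : Fin 4 → ℂ) (l : Fin 4) :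
    dq (d ∘ kl l) (p ∘ kl l) (r ∘ kl l) = dq d p r := by
  fin_cases l <;> simp [dq, NCSphere.kl] <;> ring

theorem comp_ne_zero {y : Fin 4 → ℂ} (hy : y ≠ 0) (l : Fin 4) : y ∘ kl l ≠ 0 := by
  intro h
  apply hy
  rw [← comp_kl_kl l y, h]
  rfl

theorem CForm.kl {d : Fin 4 → ℂ} {l : Fin 4} (h : CForm (L ∘ kl l) d) : CForm L (d ∘ kl l) := by
  intro a a' b b' ha hb ha' hb' hc hc' ha0 hb0 ha'0 hb'0
  have := (h (ha.kl l) (hb.kl l) (ha'.kl l) (hb'.kl l) (hc.kl l) (hc'.kl l) (comp_ne_zero ha0 l)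
    (comp_ne_zero hb0 l) (comp_ne_zero ha'0 l) (comp_ne_zero hb'0 l)).kl l
  rw [comp_kl_kl] at this
  rw [← dq_kl (d ∘ NCSphere.kl l) b' a l, ← dq_kl (d ∘ NCSphere.kl l) a' b l, comp_kl_kl]
  simpa only [Function.comp_apply, kl_kl] using this

theorem VForm.kl {d : Fin 4 → ℂ} {l : Fin 4} (h : VForm (L ∘ kl l) d) : VForm L (d ∘ kl l) := by
  intro a a' ha hc ha0
  rw [← dq_kl _ _ _ l, comp_kl_kl]
  exact h (ha.kl l) (hc.kl l) (comp_ne_zero ha0 l)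

theorem dq_lin (s t : ℂ) (d d' p r : Fin 4 → ℂ) :
    dq (s • d + t • d') p r = s * dq d p r + t * dq d' p r := by
  simp only [dq, Pi.add_apply, Pi.smul_apply, smul_eq_mul]; ring

theorem CForm.lin {d d' : Fin 4 → ℂ} (h : CForm L d) (h' : CForm L d') (s t : ℂ) :
    CForm L (s • d + t • d') := by
  intro a a' b b' ha hb ha' hb' hc hc' ha0 hb0 ha'0 hb'0
  have := ((h ha hb ha' hb' hc hc' ha0 hb0 ha'0 hb'0).smul s).add
    ((h' ha hb ha' hb' hc hc' ha0 hb0 ha'0 hb'0).smul t)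
  convert this using 3
  rw [dq_lin, dq_lin]; ring

theorem VForm.lin {d d' : Fin 4 → ℂ} (h : VForm L d) (h' : VForm L d') (s t : ℂ) :
    VForm L (s • d + t • d') := by
  intro a a' ha hc ha0
  rw [dq_lin, h ha hc ha0, h' ha hc ha0, mul_zero, mul_zero, add_zero]

/-- The linear condition on a diagonal form which expresses that it vanishes at the points of the
graph of the correspondence whose first coordinate is zero. -/
def baseCond (L d : Fin 4 → ℂ) : Prop :=
  d 1 * (cc L 1 * xx L 1) + d 2 * (cc L 2 * xx L 2) + d 3 * (cc L 3 * xx L 3) = 0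

/-- The four linear conditions at the points with a zero coordinate define a space of dimension
two, spanned by `om` and one of its transforms by the Klein four-group. -/
theorem exists_span_of_baseCond (hL : Distinct L) {d : Fin 4 → ℂ}
    (h : ∀ l, baseCond (L ∘ kl l) (d ∘ kl l)) :
    ∃ (l : Fin 4) (s t : ℂ), d = s • (om (L ∘ kl l) ∘ kl l) + t • om L := by
  have d1 := hL.dd_ne (k := 1) (by decide)
  have d2 := hL.dd_ne (k := 2) (by decide)
  have N1 := h 1
  have N2 := h 2
  have N3 := h 3
  by_cases hc : cc L 1 = 0
  · have hc2 := hL.cc_ne (l := 2) (by decide) (by decide) (by decide) hc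
    refine ⟨2, -d 0 / (dd L 2 * cc L 2), d 2 / (dd L 2 * cc L 2), funext fun μ => ?_⟩
    have hn := mul_ne_zero d2 hc2
    fin_cases μ <;> simp [om] <;> rw [← sub_eq_zero] <;> field_simp <;>
      simp [baseCond, cc, xx, dd, NCSphere.kl] at N1 N2 N3 ⊢
    · ring
    · linear_combination N3
    · linear_combination -N1
  · refine ⟨1, -d 0 / (dd L 1 * cc L 1), d 1 / (dd L 1 * cc L 1), funext fun μ => ?_⟩
    have hn := mul_ne_zero d1 hc
    fin_cases μ <;> simp [om] <;> rw [← sub_eq_zero] <;> field_simp <;>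
      simp [baseCond, cc, xx, dd, NCSphere.kl] at N1 N2 N3 ⊢
    · ring
    · linear_combination -N3
    · linear_combination N2

theorem cForm_of_baseCond (hL : Distinct L) {d : Fin 4 → ℂ}
    (h : ∀ l, baseCond (L ∘ kl l) (d ∘ kl l)) : CForm L d := by
  obtain ⟨l, s, t, rfl⟩ := exists_span_of_baseCond hL h
  exact (CForm.kl (cForm_om (hL.kl l))).lin (cForm_om hL) s t

theorem vForm_of_baseCond (hL : Distinct L) {d : Fin 4 → ℂ}
    (h : ∀ l, baseCond (L ∘ kl l) (d ∘ kl l)) : VForm L d := by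
  obtain ⟨l, s, t, rfl⟩ := exists_span_of_baseCond hL h
  exact (VForm.kl (vForm_om (hL.kl l))).lin (vForm_om hL) s t

/-- The four changes of signs which fix the product of the last three coordinates; the first
coordinate is replaced by `0`. -/
def sgn : Fin 4 → Fin 4 → ℂ :=
  ![![0, 1, 1, 1], ![0, 1, -1, -1], ![0, -1, 1, -1], ![0, -1, -1, 1]]

/-- Square roots of the numbers `λ_l² - λ_m²`. -/
def rt (L : Fin 4 → ℂ) (k : Fin 4) : ℂ := xx L k ^ (1 / 2 : ℂ)

theorem rt_sq (L : Fin 4 → ℂ) (k : Fin 4) : rt L k ^ 2 = xx L k := cpow_half_sq _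

theorem rt_ne (hL : Distinct L) {k : Fin 4} (hk : k ≠ 0) : rt L k ≠ 0 := by
  intro h
  have := rt_sq L k
  rw [h] at this
  exact hL.xx_ne hk (by simpa using this.symm)

/-- The four points of the curve whose first coordinate is zero. -/
def base (L : Fin 4 → ℂ) (s : Fin 4) : Fin 4 → ℂ := fun μ => sgn s μ * rt L μ

/-- The images of the four points whose first coordinate is zero under the correspondence. -/
def baseNext (L : Fin 4 → ℂ) (s : Fin 4) : Fin 4 → ℂ :=
  ![rt L 1 * rt L 2 * rt L 3, cc L 1 * base L s 1, cc L 2 * base L s 2, cc L 3 * base L s 3]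

theorem base_zero (s : Fin 4) : base L s 0 = 0 := by
  fin_cases s <;> simp [base, sgn]

theorem base_ne (hL : Distinct L) (s : Fin 4) {k : Fin 4} (hk : k ≠ 0) : base L s k ≠ 0 := by
  refine mul_ne_zero ?_ (rt_ne hL hk)
  fin_cases s <;> fin_cases k <;> simp [sgn] at hk ⊢

theorem base_ne_zero (hL : Distinct L) (s : Fin 4) : base L s ≠ 0 := fun h =>
  base_ne hL s (k := 1) (by decide) (congrFun h 1)

theorem base_sq (s : Fin 4) {k : Fin 4} (hk : k ≠ 0) : base L s k ^ 2 = xx L k := by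
  rw [base, mul_pow, rt_sq]
  fin_cases s <;> fin_cases k <;> simp [sgn] at hk ⊢

theorem base_prod (s : Fin 4) : base L s 1 * base L s 2 * base L s 3 =
    rt L 1 * rt L 2 * rt L 3 := by
  fin_cases s <;> simp [base, sgn]

theorem base_cone (s : Fin 4) : Cone L (base L s) := by
  have e1 := base_sq (L := L) s (k := 1) (by decide)
  have e2 := base_sq (L := L) s (k := 2) (by decide)
  have e3 := base_sq (L := L) s (k := 3) (by decide)
  constructor
  · rw [base_zero, e1, e2, e3, xx_one, xx_two, xx_three]; ring
  · rw [base_zero, e1, e2, e3, xx_one, xx_two, xx_three]; ring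

theorem base_chain (hL : Distinct L) (s : Fin 4) : Chain L (base L s) (baseNext L s) := by
  have e1 := base_sq (L := L) s (k := 1) (by decide)
  have e2 := base_sq (L := L) s (k := 2) (by decide)
  have e3 := base_sq (L := L) s (k := 3) (by decide)
  have hp := base_prod (L := L) s
  have h0 := base_zero (L := L) s
  have c1 := cc_sq_one L
  have c2 := cc_sq_two L
  have c3 := cc_sq_three L
  apply Chain.of_solved hL <;>
    simp only [baseNext, Matrix.cons_val, Matrix.cons_val_zero, Matrix.cons_val_one, h0, ← hp]
  · linear_combination base L s 2 * base L s 3 * (dd L 1 * e1 - c1)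
  · linear_combination base L s 3 * base L s 1 * (dd L 2 * e2 - c2)
  · linear_combination base L s 1 * base L s 2 * (dd L 3 * e3 - c3)
  · ring
  · ring
  · ring

theorem baseNext_ne_zero (hL : Distinct L) (s : Fin 4) : baseNext L s ≠ 0 := fun h =>
  mul_ne_zero (mul_ne_zero (rt_ne hL (k := 1) (by decide)) (rt_ne hL (k := 2) (by decide)))
    (rt_ne hL (k := 3) (by decide)) (congrFun h 0)

/-- If a symmetric form vanishes on the graph of the correspondence at the four points whose first
coordinate is zero, the characters of the group of changes of signs separate the values into one
linear condition on the diagonal entries and three on the other entries. -/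
theorem baseCond_of_vanish (hL : Distinct L) {q : Matrix (Fin 4) (Fin 4) ℂ} (hq : q.IsSymm)
    (h : ∀ s, ev q (base L s) (baseNext L s) = 0) :
    baseCond L (fun μ => q μ μ) ∧ q 0 1 * xx L 1 + q 2 3 * (cc L 2 + cc L 3) = 0 ∧
      q 0 2 * xx L 2 + q 3 1 * (cc L 3 + cc L 1) = 0 ∧
      q 0 3 * xx L 3 + q 1 2 * (cc L 1 + cc L 2) = 0 := by
  have r1 := rt_ne hL (k := 1) (by decide)
  have r2 := rt_ne hL (k := 2) (by decide)
  have r3 := rt_ne hL (k := 3) (by decide)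
  have x1 := rt_sq L 1
  have x2 := rt_sq L 2
  have x3 := rt_sq L 3
  have s01 := hq.apply 0 1
  have s02 := hq.apply 0 2
  have s03 := hq.apply 0 3
  have s12 := hq.apply 1 2
  have s13 := hq.apply 1 3
  have s23 := hq.apply 2 3
  have h0 := h 0
  have h1 := h 1
  have h2 := h 2
  have h3 := h 3
  simp [ev, Fin.sum_univ_four, base, baseNext, sgn, s01, s02, s03, s12, s13, s23] at h0 h1 h2 h3
  rw [baseCond, s13, ← x1, ← x2, ← x3]
  refine ⟨?_, ?_, ?_, ?_⟩
  · linear_combination (h0 + h1 + h2 + h3) / 4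
  · apply mul_left_cancel₀ (mul_ne_zero r2 r3)
    linear_combination (h0 + h1 - h2 - h3) / 4
  · apply mul_left_cancel₀ (mul_ne_zero r1 r3)
    linear_combination (h0 - h1 + h2 - h3) / 4
  · apply mul_left_cancel₀ (mul_ne_zero r1 r2)
    linear_combination (h0 - h1 - h2 + h3) / 4

/-- A symmetric form which vanishes on the graph of the correspondence at all the points with a
zero coordinate is diagonal: each of the off-diagonal entries occurs in several of the conditions,
which together determine it to be zero. -/
theorem diagonal_of_vanish (hL : Distinct L) {q : Matrix (Fin 4) (Fin 4) ℂ} (hq : q.IsSymm)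
    (h : ∀ l s, ev q (base (L ∘ kl l) s ∘ kl l) (baseNext (L ∘ kl l) s ∘ kl l) = 0) :
    (∀ l, baseCond (L ∘ kl l) ((fun μ => q μ μ) ∘ kl l)) ∧ ∀ i j, i ≠ j → q i j = 0 := by
  have key : ∀ l, _ := fun l => baseCond_of_vanish (hL.kl l)
    (q := q.submatrix (kl l) (kl l)) (hq.submatrix _) fun s => by
      rw [← h l s]
      fin_cases l <;> simp [ev, Fin.sum_univ_four, NCSphere.kl] <;> ring
  refine ⟨fun l => (key l).1, ?_⟩
  obtain ⟨-, p1, p2, p3⟩ := key 0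
  obtain ⟨-, p1', p2', p3'⟩ := key 1
  obtain ⟨-, p1'', p2'', p3''⟩ := key 2
  obtain ⟨-, q1, q2, q3⟩ := key 3
  have s01 := hq.apply 0 1
  have s02 := hq.apply 0 2
  have s03 := hq.apply 0 3
  have s12 := hq.apply 1 2
  have s13 := hq.apply 1 3
  have s23 := hq.apply 2 3
  have n : ∀ {μ ν : Fin 4}, μ ≠ ν → L μ + L ν ≠ 0 ∧ L μ - L ν ≠ 0 := by
    intro μ ν hμν
    have := sub_ne_zero.2 (hL μ ν hμν)
    rw [sq_sub_sq] at this
    exact mul_ne_zero_iff.1 this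
  have n01 := n (μ := 0) (ν := 1) (by decide)
  have n02 := n (μ := 0) (ν := 2) (by decide)
  have n03 := n (μ := 0) (ν := 3) (by decide)
  have n12 := n (μ := 1) (ν := 2) (by decide)
  have n13 := n (μ := 1) (ν := 3) (by decide)
  have n23 := n (μ := 2) (ν := 3) (by decide)
  simp [cc, xx, NCSphere.kl, Matrix.submatrix_apply] at p1 p1' p2 p2'' p3 q3
  have f23 : q 2 3 = 0 := by
    apply mul_left_cancel₀ (mul_ne_zero n01.1 n23.1)
    linear_combination (p1 + p1' - (L 3 ^ 2 - L 2 ^ 2) * s01 - (L 0 + L 1) * (L 2 + L 3) * s23) / 2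
  have f01 : q 0 1 = 0 := by
    apply mul_left_cancel₀ (mul_ne_zero n23.1 n23.2)
    linear_combination (p1 - p1' + (L 3 ^ 2 - L 2 ^ 2) * s01 + (L 0 + L 1) * (L 2 + L 3) * s23) / 2
  have f13 : q 1 3 = 0 := by
    apply mul_left_cancel₀ (mul_ne_zero n02.1 n13.1)
    linear_combination (p2 + p2'' - (L 1 ^ 2 - L 3 ^ 2) * s02 - (L 0 + L 2) * (L 1 + L 3) * s13) / 2
  have f02 : q 0 2 = 0 := by
    apply mul_left_cancel₀ (mul_ne_zero n13.1 n13.2)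
    linear_combination -(p2 - p2'' + (L 1 ^ 2 - L 3 ^ 2) * s02 - (L 0 + L 2) * (L 1 + L 3) * s13) / 2
  have f12 : q 1 2 = 0 := by
    apply mul_left_cancel₀ (mul_ne_zero n03.1 n12.1)
    linear_combination (p3 + q3 - (L 2 ^ 2 - L 1 ^ 2) * s03 - (L 0 + L 3) * (L 1 + L 2) * s12) / 2
  have f03 : q 0 3 = 0 := by
    apply mul_left_cancel₀ (mul_ne_zero n12.1 n12.2)
    linear_combination (p3 - q3 + (L 2 ^ 2 - L 1 ^ 2) * s03 + (L 0 + L 3) * (L 1 + L 2) * s12) / 2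
  rw [f01] at s01
  rw [f02] at s02
  rw [f03] at s03
  rw [f12] at s12
  rw [f13] at s13
  rw [f23] at s23
  intro i j hij
  fin_cases i <;> fin_cases j <;> first | exact absurd rfl hij | assumption

end

/-! ### The quadratic algebra -/

/-- The six relations, for elements `T i j` of a vector space. -/
structure Rels (L : Fin 4 → ℂ) {M : Type*} [AddCommGroup M] [Module ℂ M] (T : Fin 4 → Fin 4 → M) :
    Prop where
  a1 : L 0 • T 1 0 - L 1 • T 0 1 + L 3 • T 2 3 - L 2 • T 3 2 = 0
  a2 : L 0 • T 2 0 - L 2 • T 0 2 + L 1 • T 3 1 - L 3 • T 1 3 = 0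
  a3 : L 0 • T 3 0 - L 3 • T 0 3 + L 2 • T 1 2 - L 1 • T 2 1 = 0
  b1 : -(L 1 • T 1 0) + L 0 • T 0 1 + L 2 • T 2 3 - L 3 • T 3 2 = 0
  b2 : -(L 2 • T 2 0) + L 0 • T 0 2 + L 3 • T 3 1 - L 1 • T 1 3 = 0
  b3 : -(L 3 • T 3 0) + L 0 • T 0 3 + L 1 • T 1 2 - L 2 • T 2 1 = 0

section

variable {L : Fin 4 → ℂ} {M : Type*} [AddCommGroup M] [Module ℂ M] {T : Fin 4 → Fin 4 → M}

theorem Rels.kl (h : Rels L T) (l : Fin 4) :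
    Rels (L ∘ kl l) fun i j => T (kl l i) (kl l j) := by
  obtain ⟨a1, a2, a3, b1, b2, b3⟩ := h
  fin_cases l <;> refine ⟨?_, ?_, ?_, ?_, ?_, ?_⟩ <;> simp [NCSphere.kl] <;>
    first
    | linear_combination (norm := module) a1
    | linear_combination (norm := module) a2
    | linear_combination (norm := module) a3
    | linear_combination (norm := module) b1
    | linear_combination (norm := module) b2
    | linear_combination (norm := module) b3
    | linear_combination (norm := module) -a1
    | linear_combination (norm := module) -a2
    | linear_combination (norm := module) -a3
    | linear_combination (norm := module) -b1
    | linear_combination (norm := module) -b2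
    | linear_combination (norm := module) -b3

theorem Rels.α1 (h : Rels L T) : dd L 1 • T 1 0 + cc L 3 • T 2 3 - cc L 2 • T 3 2 = 0 := by
  simp only [cc_two, cc_three, dd]
  linear_combination (norm := module) L 0 • h.a1 + L 1 • h.b1

theorem Rels.α2 (h : Rels L T) : dd L 2 • T 2 0 + cc L 1 • T 3 1 - cc L 3 • T 1 3 = 0 := by
  simp only [cc_one, cc_three, dd]
  linear_combination (norm := module) L 0 • h.a2 + L 2 • h.b2

theorem Rels.α3 (h : Rels L T) : dd L 3 • T 3 0 + cc L 2 • T 1 2 - cc L 1 • T 2 1 = 0 := by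
  simp only [cc_one, cc_two, dd]
  linear_combination (norm := module) L 0 • h.a3 + L 3 • h.b3

theorem Rels.β1 (h : Rels L T) : dd L 1 • T 0 1 + cc L 2 • T 2 3 - cc L 3 • T 3 2 = 0 := by
  simp only [cc_two, cc_three, dd]
  linear_combination (norm := module) L 1 • h.a1 + L 0 • h.b1

theorem Rels.β2 (h : Rels L T) : dd L 2 • T 0 2 + cc L 3 • T 3 1 - cc L 1 • T 1 3 = 0 := by
  simp only [cc_one, cc_three, dd]
  linear_combination (norm := module) L 2 • h.a2 + L 0 • h.b2

theorem Rels.β3 (h : Rels L T) : dd L 3 • T 0 3 + cc L 1 • T 1 2 - cc L 2 • T 2 1 = 0 := by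
  simp only [cc_one, cc_two, dd]
  linear_combination (norm := module) L 3 • h.a3 + L 0 • h.b3

end

section

variable {A : Type*} [Ring A] [Algebra ℂ A]

/-- The quadratic elements, as a linear function of their coefficients. -/
def quadLin (x : Fin 4 → A) : Matrix (Fin 4) (Fin 4) ℂ →ₗ[ℂ] A where
  toFun := quad x
  map_add' c c' := by simp [quad, add_smul, Finset.sum_add_distrib]
  map_smul' a c := by simp [quad, mul_smul, Finset.smul_sum]

theorem quad_add (x : Fin 4 → A) (c c' : Matrix (Fin 4) (Fin 4) ℂ) :
    quad x (c + c') = quad x c + quad x c' := (quadLin x).map_add c c'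

theorem quad_sub (x : Fin 4 → A) (c c' : Matrix (Fin 4) (Fin 4) ℂ) :
    quad x (c - c') = quad x c - quad x c' := (quadLin x).map_sub c c'

theorem quad_neg (x : Fin 4 → A) (c : Matrix (Fin 4) (Fin 4) ℂ) :
    quad x (-c) = -quad x c := (quadLin x).map_neg c

theorem quad_smul (x : Fin 4 → A) (a : ℂ) (c : Matrix (Fin 4) (Fin 4) ℂ) :
    quad x (a • c) = a • quad x c := (quadLin x).map_smul a c

theorem quad_zero (x : Fin 4 → A) : quad x 0 = 0 := (quadLin x).map_zero

theorem quad_single (x : Fin 4 → A) (i j : Fin 4) (a : ℂ) :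
    quad x (Matrix.single i j a) = a • (x i * x j) := by
  unfold quad
  rw [Finset.sum_eq_single i, Finset.sum_eq_single j]
  · simp
  · intro b _ hb
    simp [hb.symm]
  · simp
  · intro b _ hb
    exact Finset.sum_eq_zero fun j' _ => by simp [hb.symm]
  · simp

theorem map_quad {B : Type*} [Ring B] [Algebra ℂ B] (f : A →ₐ[ℂ] B) (x : Fin 4 → A)
    (c : Matrix (Fin 4) (Fin 4) ℂ) : f (quad x c) = quad (fun μ => f (x μ)) c := by
  simp [quad]

theorem map_lin {B : Type*} [Ring B] [Algebra ℂ B] (f : A →ₐ[ℂ] B) (x : Fin 4 → A)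
    (Y : Fin 4 → ℂ) : f (lin x Y) = lin (fun μ => f (x μ)) Y := by
  simp [lin]

theorem rels_iff {lam : Fin 4 → Circle} {x : Fin 4 → A} :
    Rels (lv lam) (fun i j => x i * x j) ↔ ∀ ω ∈ relSpace lam, quad x ω = 0 := by
  have hA : ∀ k l m, quad x (relA lam k l m) = lv lam 0 • (x k * x 0) - lv lam k • (x 0 * x k)
      + lv lam m • (x l * x m) - lv lam l • (x m * x l) := by
    intro k l m; simp only [relA, quad_add, quad_sub, quad_single, lv]
  have hB : ∀ k l m, quad x (relB lam k l m) = -(lv lam k • (x k * x 0)) + lv lam 0 • (x 0 * x k)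
      + lv lam l • (x l * x m) - lv lam m • (x m * x l) := by
    intro k l m; simp only [relB, quad_add, quad_sub, quad_neg, quad_single, lv]
  constructor
  · rintro ⟨a1, a2, a3, b1, b2, b3⟩ ω hω
    refine relSpace_induction (p := fun ω => quad x ω = 0) ?_ ?_ ?_ ?_ ?_ ?_ (quad_zero _) ?_ ?_ hω
    · rw [hA]; exact a1
    · rw [hA]; exact a2
    · rw [hA]; exact a3
    · rw [hB]; exact b1
    · rw [hB]; exact b2
    · rw [hB]; exact b3
    · intro ω ω' h h'; rw [quad_add, h, h', add_zero]
    · intro a ω h; rw [quad_smul, h, smul_zero]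
  · intro h
    obtain ⟨a1, a2, a3, b1, b2, b3⟩ := relA_mem lam
    refine ⟨?_, ?_, ?_, ?_, ?_, ?_⟩
    · rw [← hA]; exact h _ a1
    · rw [← hA]; exact h _ a2
    · rw [← hA]; exact h _ a3
    · rw [← hB]; exact h _ b1
    · rw [← hB]; exact h _ b2
    · rw [← hB]; exact h _ b3

end

section

variable {lam : Fin 4 → Circle}

theorem quad_zQ_of_mem {ω : Matrix (Fin 4) (Fin 4) ℂ} (hω : ω ∈ relSpace lam) :
    quad (zQ lam) ω = 0 := by
  have h := RingQuot.mkAlgHom_rel ℂ (s := quadRel lam) (x := quad (FreeAlgebra.ι ℂ) ω) (y := 0)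
    ⟨rfl, ω, hω, rfl⟩
  rw [map_zero, map_quad] at h
  exact h

theorem rels_zQ : Rels (lv lam) (fun i j => zQ lam i * zQ lam j) :=
  rels_iff.2 fun _ => quad_zQ_of_mem

/-- The homomorphism from the quadratic algebra given by four elements which satisfy the relations. -/
def liftQ {A : Type*} [Ring A] [Algebra ℂ A] (x : Fin 4 → A)
    (h : ∀ ω ∈ relSpace lam, quad x ω = 0) : QuadAlg lam →ₐ[ℂ] A :=
  RingQuot.liftAlgHom ℂ ⟨FreeAlgebra.lift ℂ x, by
    rintro a b ⟨rfl, ω, hω, rfl⟩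
    rw [map_zero, map_quad]
    simpa using h ω hω⟩

theorem liftQ_zQ {A : Type*} [Ring A] [Algebra ℂ A] (x : Fin 4 → A)
    (h : ∀ ω ∈ relSpace lam, quad x ω = 0) (μ : Fin 4) : liftQ x h (zQ lam μ) = x μ := by
  rw [liftQ, zQ, RingQuot.liftAlgHom_mkAlgHom_apply, FreeAlgebra.lift_ι_apply]

/-- The quadratic algebra is generated by the `z_μ`. -/
theorem adjoin_zQ : Algebra.adjoin ℂ (Set.range (zQ lam)) = ⊤ := by
  have : Set.range (zQ lam) = RingQuot.mkAlgHom ℂ (quadRel lam) '' Set.range (FreeAlgebra.ι ℂ) := by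
    rw [← Set.range_comp]; rfl
  rw [this, ← AlgHom.map_adjoin, FreeAlgebra.adjoin_range_ι, Algebra.map_top,
    AlgHom.range_eq_top]
  exact RingQuot.mkAlgHom_surjective ℂ _

theorem mem_center_of_commute {a : QuadAlg lam} (h : ∀ μ, a * zQ lam μ = zQ lam μ * a) :
    a ∈ Subalgebra.center ℂ (QuadAlg lam) := by
  rw [Subalgebra.mem_center_iff]
  intro b
  have hb : b ∈ Algebra.adjoin ℂ (Set.range (zQ lam)) := by rw [adjoin_zQ]; trivial
  induction hb using Algebra.adjoin_induction with
  | mem b hb => obtain ⟨μ, rfl⟩ := hb; exact (h μ).symm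
  | algebraMap r => exact Algebra.commutes r a
  | add b c _ _ hb hc => rw [add_mul, mul_add, hb, hc]
  | mul b c _ _ hb hc => rw [mul_assoc, hc, ← mul_assoc, hb, mul_assoc]

end

/-- The diagonal quadratic forms which commute with the first generator. For the coefficients
`D_k c_k` the commutators of the three squares add up to zero; for the coefficients `D_k c_l c_m`
one also uses the two ways of rewriting `z_k z_0 z_k`. -/
theorem commute_zero_of_rels {A : Type*} [Ring A] [Algebra ℂ A] {z : Fin 4 → A} {L : Fin 4 → ℂ}
    (h : Rels L fun i j => z i * z j) (d0 s t : ℂ) :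
    (d0 • (z 0 * z 0) + (dd L 1 * (s * cc L 1 + t * (cc L 2 * cc L 3))) • (z 1 * z 1)
      + (dd L 2 * (s * cc L 2 + t * (cc L 3 * cc L 1))) • (z 2 * z 2)
      + (dd L 3 * (s * cc L 3 + t * (cc L 1 * cc L 2))) • (z 3 * z 3)) * z 0
    = z 0 * (d0 • (z 0 * z 0) + (dd L 1 * (s * cc L 1 + t * (cc L 2 * cc L 3))) • (z 1 * z 1)
      + (dd L 2 * (s * cc L 2 + t * (cc L 3 * cc L 1))) • (z 2 * z 2)
      + (dd L 3 * (s * cc L 3 + t * (cc L 1 * cc L 2))) • (z 3 * z 3)) := by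
  have mz : ∀ (x : A) {a : A}, a = 0 → x * a = 0 := fun x a h => by rw [h, mul_zero]
  have zm : ∀ (x : A) {a : A}, a = 0 → a * x = 0 := fun x a h => by rw [h, zero_mul]
  have a1 := mz (z 1) h.α1
  have a2 := mz (z 2) h.α2
  have a3 := mz (z 3) h.α3
  have a1' := zm (z 1) h.α1
  have a2' := zm (z 2) h.α2
  have a3' := zm (z 3) h.α3
  have b1 := mz (z 1) h.β1
  have b2 := mz (z 2) h.β2
  have b3 := mz (z 3) h.β3
  have b1' := zm (z 1) h.β1
  have b2' := zm (z 2) h.β2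
  have b3' := zm (z 3) h.β3
  simp only [mul_add, add_mul, mul_sub, sub_mul, mul_smul_comm, smul_mul_assoc, mul_assoc] at *
  linear_combination (norm := module)
    (s * cc L 1 + t * (cc L 2 * cc L 3)) • (a1 - b1')
    + (s * cc L 2 + t * (cc L 3 * cc L 1)) • (a2 - b2')
    + (s * cc L 3 + t * (cc L 1 * cc L 2)) • (a3 - b3')
    - (t * cc L 1 ^ 2) • (a1' - b1) - (t * cc L 2 ^ 2) • (a2' - b2) - (t * cc L 3 ^ 2) • (a3' - b3)

theorem quad_diagonal {A : Type*} [Ring A] [Algebra ℂ A] (x : Fin 4 → A) (d : Fin 4 → ℂ) :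
    quad x (Matrix.diagonal d) = d 0 • (x 0 * x 0) + d 1 • (x 1 * x 1) + d 2 • (x 2 * x 2)
      + d 3 • (x 3 * x 3) := by
  simp [quad, Fin.sum_univ_four, Matrix.diagonal_apply]

theorem quad_diagonal_kl {A : Type*} [Ring A] [Algebra ℂ A] (x : Fin 4 → A) (d : Fin 4 → ℂ)
    (l : Fin 4) :
    quad (x ∘ kl l) (Matrix.diagonal (d ∘ kl l)) = quad x (Matrix.diagonal d) := by
  rw [quad_diagonal, quad_diagonal]
  fin_cases l <;> simp [kl] <;> abel

theorem commute_zero_om {A : Type*} [Ring A] [Algebra ℂ A] {z : Fin 4 → A} {L : Fin 4 → ℂ}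
    (h : Rels L fun i j => z i * z j) :
    quad z (Matrix.diagonal (om L)) * z 0 = z 0 * quad z (Matrix.diagonal (om L)) := by
  have := commute_zero_of_rels h 0 1 0
  rw [quad_diagonal]
  simp only [om, cc, Matrix.cons_val_zero, mul_zero, zero_mul, one_mul, add_zero] at this ⊢
  exact this

/-- The form `∑ λ_μ z_μ²` is one of the forms of `commute_zero_of_rels`. -/
theorem commute_zero_sphere {A : Type*} [Ring A] [Algebra ℂ A] {z : Fin 4 → A} {L : Fin 4 → ℂ}
    (hL : Distinct L) (h : Rels L fun i j => z i * z j) :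
    quad z (Matrix.diagonal L) * z 0 = z 0 * quad z (Matrix.diagonal L) := by
  have d1 := hL.dd_ne (k := 1) (by decide)
  have d2 := hL.dd_ne (k := 2) (by decide)
  have d3 := hL.dd_ne (k := 3) (by decide)
  have e1 : dd L 1 * ((L 0 ^ 3 + L 1 * L 2 * L 3) / (dd L 1 * dd L 2 * dd L 3) * cc L 1
      + -L 0 / (dd L 1 * dd L 2 * dd L 3) * (cc L 2 * cc L 3)) = L 1 := by
    field_simp; simp only [dd, cc_one, cc_two, cc_three]; ring
  have e2 : dd L 2 * ((L 0 ^ 3 + L 1 * L 2 * L 3) / (dd L 1 * dd L 2 * dd L 3) * cc L 2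
      + -L 0 / (dd L 1 * dd L 2 * dd L 3) * (cc L 3 * cc L 1)) = L 2 := by
    field_simp; simp only [dd, cc_one, cc_two, cc_three]; ring
  have e3 : dd L 3 * ((L 0 ^ 3 + L 1 * L 2 * L 3) / (dd L 1 * dd L 2 * dd L 3) * cc L 3
      + -L 0 / (dd L 1 * dd L 2 * dd L 3) * (cc L 1 * cc L 2)) = L 3 := by
    field_simp; simp only [dd, cc_one, cc_two, cc_three]; ring
  have := commute_zero_of_rels h (L 0)
    ((L 0 ^ 3 + L 1 * L 2 * L 3) / (dd L 1 * dd L 2 * dd L 3))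
    (-L 0 / (dd L 1 * dd L 2 * dd L 3))
  rw [e1, e2, e3] at this
  rw [quad_diagonal]
  exact this

section

variable {lam : Fin 4 → Circle}

theorem sphereForm_eq (lam : Fin 4 → Circle) : sphereForm lam = Matrix.diagonal (lv lam) := rfl

/-- The element `C` is central. -/
theorem sphere_mem_center (hL : Distinct (lv lam)) :
    quad (zQ lam) (sphereForm lam) ∈ Subalgebra.center ℂ (QuadAlg lam) := by
  apply mem_center_of_commute
  intro l
  have := commute_zero_sphere (z := zQ lam ∘ kl l) (hL.kl l) (rels_zQ.kl l)
  rw [quad_diagonal_kl, Function.comp_apply, kl_zero] at this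
  exact this

theorem isCentralQuad_sphere (hL : Distinct (lv lam)) :
    IsCentralQuad lam ((2 : ℂ) • sphereForm lam) := by
  refine ⟨?_, ?_⟩
  · rw [sphereForm_eq]
    exact (Matrix.isSymm_diagonal _).smul _
  · rw [quad_smul]
    exact Subalgebra.smul_mem _ (sphere_mem_center hL) _

/-! ### Evaluation along paths -/

/-- Sequences of vectors on which the relations vanish successively. Zero vectors are allowed. -/
def Path (lam : Fin 4 → Circle) : Type :=
  {v : ℕ → Fin 4 → ℂ // ∀ n, Chain (lv lam) (v n) (v (n + 1))}

/-- The path without its first `m` vectors. -/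
def Path.drop (v : Path lam) (m : ℕ) : Path lam :=
  ⟨fun n => v.1 (n + m), fun n => by have := v.2 (n + m); rwa [add_right_comm] at this⟩

/-- The weighted shifts on sequences by which the generators act. -/
def shiftOp (v : ℕ → Fin 4 → ℂ) (μ : Fin 4) : Module.End ℂ (ℕ → ℂ) where
  toFun f := fun n => v n μ * f (n + 1)
  map_add' f g := by funext n; simp [mul_add]
  map_smul' a f := by funext n; simp only [Pi.smul_apply, smul_eq_mul, RingHom.id_apply]; ring

theorem quad_shiftOp (v : ℕ → Fin 4 → ℂ) (c : Matrix (Fin 4) (Fin 4) ℂ) (f : ℕ → ℂ) (n : ℕ) :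
    quad (shiftOp v) c f n = ev c (v n) (v (n + 1)) * f (n + 2) := by
  simp only [quad, ev, LinearMap.sum_apply, Finset.sum_apply, LinearMap.smul_apply, Pi.smul_apply,
    smul_eq_mul, Finset.sum_mul]
  refine Finset.sum_congr rfl fun i _ => Finset.sum_congr rfl fun j _ => ?_
  simp only [Module.End.mul_apply, shiftOp, LinearMap.coe_mk, AddHom.coe_mk]
  ring

/-- The representation of the quadratic algebra by weighted shifts defined by a path. -/
def pathRep (v : Path lam) : QuadAlg lam →ₐ[ℂ] Module.End ℂ (ℕ → ℂ) :=
  liftQ (shiftOp v.1) fun ω hω => by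
    refine LinearMap.ext fun f => funext fun n => ?_
    rw [quad_shiftOp, chain_iff.1 (v.2 n) ω hω, zero_mul]
    rfl

theorem pathRep_zQ (v : Path lam) (μ : Fin 4) (f : ℕ → ℂ) (n : ℕ) :
    pathRep v (zQ lam μ) f n = v.1 n μ * f (n + 1) := by
  rw [pathRep, liftQ_zQ]; rfl

theorem pathRep_quad (v : Path lam) (c : Matrix (Fin 4) (Fin 4) ℂ) (f : ℕ → ℂ) (n : ℕ) :
    pathRep v (quad (zQ lam) c) f n = ev c (v.1 n) (v.1 (n + 1)) * f (n + 2) := by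
  rw [map_quad, ← quad_shiftOp]
  simp only [pathRep, liftQ_zQ]

theorem pathRep_drop (v : Path lam) (m : ℕ) (a : QuadAlg lam) :
    ∀ (f : ℕ → ℂ) (n : ℕ), pathRep v a f (n + m) = pathRep (v.drop m) a (fun k => f (k + m)) n := by
  have ha : a ∈ Algebra.adjoin ℂ (Set.range (zQ lam)) := by rw [adjoin_zQ]; trivial
  induction ha using Algebra.adjoin_induction with
  | mem b hb =>
    obtain ⟨μ, rfl⟩ := hb
    intro f n
    rw [pathRep_zQ, pathRep_zQ, add_right_comm]; rfl
  | algebraMap r => intro f n; simp [Module.algebraMap_end_apply]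
  | add b c _ _ hb hc => intro f n; simp only [map_add, LinearMap.add_apply, Pi.add_apply, hb, hc]
  | mul b c _ _ hb hc =>
    intro f n
    simp only [map_mul, Module.End.mul_apply, hb]
    have e : (fun k => pathRep v c f (k + m)) = pathRep (v.drop m) c fun k => f (k + m) :=
      funext fun k => hc f k
    rw [e]

/-- The value of an element of the quadratic algebra along a path: for a homogeneous element this
is a multilinear function of the first vectors of the path. -/
def pathEval (v : Path lam) : QuadAlg lam →ₗ[ℂ] ℂ where
  toFun a := pathRep v a 1 0
  map_add' a b := by simp
  map_smul' c a := by simp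

theorem pathEval_apply (v : Path lam) (a : QuadAlg lam) : pathEval v a = pathRep v a 1 0 := rfl

theorem pathEval_one (v : Path lam) : pathEval v 1 = 1 := by
  have h : pathRep v 1 = 1 := map_one _
  rw [pathEval_apply, h]; rfl

theorem pathEval_zQ_mul (v : Path lam) (μ : Fin 4) (a : QuadAlg lam) :
    pathEval v (zQ lam μ * a) = v.1 0 μ * pathEval (v.drop 1) a := by
  rw [pathEval_apply, map_mul, Module.End.mul_apply, pathRep_zQ]
  congr 1
  exact pathRep_drop v 1 a 1 0

theorem pathEval_quad_mul (v : Path lam) (c : Matrix (Fin 4) (Fin 4) ℂ) (a : QuadAlg lam) :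
    pathEval v (quad (zQ lam) c * a) = ev c (v.1 0) (v.1 1) * pathEval (v.drop 2) a := by
  rw [pathEval_apply, map_mul, Module.End.mul_apply, pathRep_quad]
  congr 1
  exact pathRep_drop v 2 a 1 0

theorem pathEval_quad (v : Path lam) (c : Matrix (Fin 4) (Fin 4) ℂ) :
    pathEval v (quad (zQ lam) c) = ev c (v.1 0) (v.1 1) := by
  have := pathEval_quad_mul v c 1
  rwa [mul_one, pathEval_one, mul_one] at this

variable (lam) in
/-- The elements of degree `n` of the quadratic algebra. -/
def Vn (n : ℕ) : Submodule ℂ (QuadAlg lam) := (Submodule.span ℂ (Set.range (zQ lam))) ^ n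

theorem zQ_mem (μ : Fin 4) : zQ lam μ ∈ Vn lam 1 := by
  rw [Vn, pow_one]; exact Submodule.subset_span ⟨μ, rfl⟩

theorem mul_mem_Vn {m n : ℕ} {a b : QuadAlg lam} (ha : a ∈ Vn lam m) (hb : b ∈ Vn lam n) :
    a * b ∈ Vn lam (m + n) := by
  rw [Vn, pow_add]; exact Submodule.mul_mem_mul ha hb

theorem zQ_mul_mem {n : ℕ} {a : QuadAlg lam} (μ : Fin 4) (ha : a ∈ Vn lam n) :
    zQ lam μ * a ∈ Vn lam (n + 1) := by
  rw [add_comm]; exact mul_mem_Vn (zQ_mem μ) ha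

theorem mul_zQ_mem {n : ℕ} {a : QuadAlg lam} (μ : Fin 4) (ha : a ∈ Vn lam n) :
    a * zQ lam μ ∈ Vn lam (n + 1) := mul_mem_Vn ha (zQ_mem μ)

theorem quad_mem (c : Matrix (Fin 4) (Fin 4) ℂ) : quad (zQ lam) c ∈ Vn lam 2 :=
  Submodule.sum_mem _ fun i _ => Submodule.sum_mem _ fun j _ =>
    Submodule.smul_mem _ _ (mul_mem_Vn (zQ_mem i) (zQ_mem j))

theorem mem_Vn_zero {a : QuadAlg lam} : a ∈ Vn lam 0 ↔ ∃ r : ℂ, r • (1 : QuadAlg lam) = a := by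
  rw [Vn, pow_zero, Submodule.mem_one]
  exact exists_congr fun r => by rw [Algebra.algebraMap_eq_smul_one]

theorem exists_left {n : ℕ} {a : QuadAlg lam} (ha : a ∈ Vn lam (n + 1)) :
    ∃ b : Fin 4 → QuadAlg lam, (∀ μ, b μ ∈ Vn lam n) ∧ a = ∑ μ, zQ lam μ * b μ := by
  rw [Vn, pow_succ'] at ha
  induction ha using Submodule.mul_induction_on' with
  | mem_mul_mem m hm x hx =>
    obtain ⟨y, rfl⟩ := (Submodule.mem_span_range_iff_exists_fun ℂ).1 hm
    refine ⟨fun μ => y μ • x, fun μ => Submodule.smul_mem _ _ hx, ?_⟩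
    simp [Finset.sum_mul]
  | add x _ y _ hx hy =>
    obtain ⟨b, hb, rfl⟩ := hx
    obtain ⟨b', hb', rfl⟩ := hy
    refine ⟨b + b', fun μ => Submodule.add_mem _ (hb μ) (hb' μ), ?_⟩
    simp [mul_add, Finset.sum_add_distrib]

theorem exists_right {n : ℕ} {a : QuadAlg lam} (ha : a ∈ Vn lam (n + 1)) :
    ∃ b : Fin 4 → QuadAlg lam, (∀ μ, b μ ∈ Vn lam n) ∧ a = ∑ μ, b μ * zQ lam μ := by
  rw [Vn, pow_succ] at ha
  induction ha using Submodule.mul_induction_on' with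
  | mem_mul_mem x hx m hm =>
    obtain ⟨y, rfl⟩ := (Submodule.mem_span_range_iff_exists_fun ℂ).1 hm
    refine ⟨fun μ => y μ • x, fun μ => Submodule.smul_mem _ _ hx, ?_⟩
    simp [Finset.mul_sum]
  | add x _ y _ hx hy =>
    obtain ⟨b, hb, rfl⟩ := hx
    obtain ⟨b', hb', rfl⟩ := hy
    refine ⟨b + b', fun μ => Submodule.add_mem _ (hb μ) (hb' μ), ?_⟩
    simp [add_mul, Finset.sum_add_distrib]

theorem pathEval_mul {n : ℕ} (v : Path lam) {a : QuadAlg lam} (ha : a ∈ Vn lam n)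
    (b : QuadAlg lam) : pathEval v (a * b) = pathEval v a * pathEval (v.drop n) b := by
  induction n generalizing a v with
  | zero =>
    obtain ⟨r, rfl⟩ := mem_Vn_zero.1 ha
    rw [smul_mul_assoc, one_mul, map_smul, map_smul, pathEval_one, smul_eq_mul, smul_eq_mul, mul_one]
    rfl
  | succ n ih =>
    obtain ⟨c, hc, rfl⟩ := exists_left ha
    simp only [Finset.sum_mul, map_sum, mul_assoc, pathEval_zQ_mul, ih _ (hc _)]
    rfl

theorem pathEval_mul_zQ {n : ℕ} (v : Path lam) {a : QuadAlg lam} (ha : a ∈ Vn lam n) (μ : Fin 4) :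
    pathEval v (a * zQ lam μ) = pathEval v a * v.1 n μ := by
  have h := pathEval_zQ_mul (v.drop n) μ 1
  rw [mul_one, pathEval_one, mul_one] at h
  rw [pathEval_mul v ha, h]
  simp [Path.drop]

/-- The value of a homogeneous element is multilinear in the vectors of the path. -/
theorem pathEval_scale {n : ℕ} {v w : Path lam} (c : ℕ → ℂ) (h : ∀ i < n, w.1 i = c i • v.1 i)
    {a : QuadAlg lam} (ha : a ∈ Vn lam n) :
    pathEval w a = (∏ i ∈ Finset.range n, c i) * pathEval v a := by
  induction n generalizing a v w c with
  | zero =>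
    obtain ⟨r, rfl⟩ := mem_Vn_zero.1 ha
    simp [pathEval_one]
  | succ n ih =>
    obtain ⟨b, hb, rfl⟩ := exists_left ha
    simp only [map_sum, pathEval_zQ_mul, Finset.mul_sum]
    refine Finset.sum_congr rfl fun μ _ => ?_
    rw [ih (v := v.drop 1) (fun i => c (i + 1)) (fun i hi => h (i + 1) (by omega)) (hb μ),
      h 0 (by omega), Finset.prod_range_succ']
    simp only [Pi.smul_apply, smul_eq_mul]
    ring

theorem tendsto_pathEval {T : Type*} {l : Filter T} {n : ℕ} {w : T → Path lam} {v : Path lam}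
    (h : ∀ i < n, Filter.Tendsto (fun t => (w t).1 i) l (nhds (v.1 i))) {a : QuadAlg lam}
    (ha : a ∈ Vn lam n) : Filter.Tendsto (fun t => pathEval (w t) a) l (nhds (pathEval v a)) := by
  induction n generalizing a v w with
  | zero =>
    obtain ⟨r, rfl⟩ := mem_Vn_zero.1 ha
    simp only [map_smul, pathEval_one]
    exact tendsto_const_nhds
  | succ n ih =>
    obtain ⟨b, hb, rfl⟩ := exists_left ha
    simp only [map_sum, pathEval_zQ_mul]
    refine tendsto_finsetSum _ fun μ _ => Filter.Tendsto.mul ?_ ?_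
    · exact (tendsto_pi_nhds.1 (h 0 (by omega))) μ
    · exact ih (w := fun t => (w t).drop 1) (v := v.drop 1) (fun i hi => h (i + 1) (by omega)) (hb μ)

/-! ### Quadratic elements -/

theorem Chain.zero (y : Fin 4 → ℂ) (L : Fin 4 → ℂ) : Chain L y 0 := by
  refine ⟨?_, ?_, ?_, ?_, ?_, ?_⟩ <;> simp

/-- The path which begins with three given vectors and continues with zeros. -/
def path3 {y y' y'' : Fin 4 → ℂ} (h : Chain (lv lam) y y') (h' : Chain (lv lam) y' y'') :
    Path lam :=
  ⟨fun n => match n with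
    | 0 => y
    | 1 => y'
    | 2 => y''
    | _ => 0, fun n => match n with
    | 0 => h
    | 1 => h'
    | 2 => Chain.zero _ _
    | _ + 3 => Chain.zero _ _⟩

/-- A quadratic element which is zero vanishes, as a bilinear form, at every pair of vectors on which
the relations vanish, since it acts by zero along the path formed by the pair. -/
theorem ev_eq_zero_of_quad {c : Matrix (Fin 4) (Fin 4) ℂ} (h : quad (zQ lam) c = 0)
    {y y' : Fin 4 → ℂ} (hy : Chain (lv lam) y y') : ev c y y' = 0 := by
  have := pathEval_quad (path3 hy (Chain.zero y' _)) c
  rw [h, map_zero] at this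
  exact this.symm

theorem quad_eq_zero {c : Matrix (Fin 4) (Fin 4) ℂ} (hL : Distinct (lv lam)) (hc : c.IsSymm)
    (h : quad (zQ lam) c = 0) : c = 0 := by
  have h1 := (diagonal_of_vanish hL hc fun l s => by
    have := (base_chain (hL.kl l) s).kl l
    rw [comp_kl_kl] at this
    exact ev_eq_zero_of_quad h this).2
  ext i j
  by_cases hij : i = j
  · subst hij
    have hy : Chain (lv lam) (Pi.single i 1) (Pi.single i 1) := by
      fin_cases i <;> refine ⟨?_, ?_, ?_, ?_, ?_, ?_⟩ <;> simp
    have := ev_eq_zero_of_quad h hy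
    simpa [ev, Pi.single_apply] using this
  · exact h1 i j hij

/-- The relations express the commutators of the generators by anticommutators. -/
theorem exists_symm_commutator (hL : Distinct (lv lam)) (i j : Fin 4) :
    ∃ q : Matrix (Fin 4) (Fin 4) ℂ, q.IsSymm ∧
      quad (zQ lam) q = zQ lam i * zQ lam j - zQ lam j * zQ lam i := by
  -- the symmetric matrices of the anticommutators
  have hS : ∀ (a : ℂ) (i j : Fin 4), (Matrix.single i j a + Matrix.single j i a).IsSymm := by
    intro a i j
    rw [Matrix.IsSymm, Matrix.transpose_add, Matrix.transpose_single, Matrix.transpose_single,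
      add_comm]
  have hn : ∀ μ ν : Fin 4, μ ≠ ν → lv lam μ + lv lam ν ≠ 0 := by
    intro μ ν hμν h
    apply hL μ ν hμν
    linear_combination (lv lam μ - lv lam ν) * h
  have main : ∀ (k l m : Fin 4) (_ : 0 ≠ k) (_ : l ≠ m)
      (_ : lv lam 0 • (zQ lam k * zQ lam 0) - lv lam k • (zQ lam 0 * zQ lam k)
        + lv lam m • (zQ lam l * zQ lam m) - lv lam l • (zQ lam m * zQ lam l) = 0)
      (_ : -(lv lam k • (zQ lam k * zQ lam 0)) + lv lam 0 • (zQ lam 0 * zQ lam k)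
        + lv lam l • (zQ lam l * zQ lam m) - lv lam m • (zQ lam m * zQ lam l) = 0),
      (∃ q : Matrix (Fin 4) (Fin 4) ℂ, q.IsSymm ∧
        quad (zQ lam) q = zQ lam k * zQ lam 0 - zQ lam 0 * zQ lam k) ∧
      ∃ q : Matrix (Fin 4) (Fin 4) ℂ, q.IsSymm ∧
        quad (zQ lam) q = zQ lam l * zQ lam m - zQ lam m * zQ lam l := by
    intro k l m hk hlm a b
    have n1 := hn 0 k hk
    have n2 := hn l m hlm
    refine ⟨⟨_, hS ((lv lam l - lv lam m) / (lv lam 0 + lv lam k)) l m, ?_⟩,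
      ⟨_, hS ((lv lam k - lv lam 0) / (lv lam l + lv lam m)) k 0, ?_⟩⟩
    · rw [quad_add, quad_single, quad_single]
      apply smul_right_injective _ n1
      simp only [smul_add, smul_smul, mul_div_cancel₀ _ n1]
      linear_combination (norm := module) b - a
    · rw [quad_add, quad_single, quad_single]
      apply smul_right_injective _ n2
      simp only [smul_add, smul_smul, mul_div_cancel₀ _ n2]
      linear_combination (norm := module) -(a + b)
  have hneg : ∀ i j : Fin 4, (∃ q : Matrix (Fin 4) (Fin 4) ℂ, q.IsSymm ∧
        quad (zQ lam) q = zQ lam i * zQ lam j - zQ lam j * zQ lam i) →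
      ∃ q : Matrix (Fin 4) (Fin 4) ℂ, q.IsSymm ∧
        quad (zQ lam) q = zQ lam j * zQ lam i - zQ lam i * zQ lam j := by
    rintro i j ⟨q, hq, h⟩
    exact ⟨-q, hq.neg, by rw [quad_neg, h, neg_sub]⟩
  have h0 : ∀ i : Fin 4, ∃ q : Matrix (Fin 4) (Fin 4) ℂ, q.IsSymm ∧
        quad (zQ lam) q = zQ lam i * zQ lam i - zQ lam i * zQ lam i :=
    fun i => ⟨0, Matrix.isSymm_zero, by rw [quad_zero, sub_self]⟩
  have r := rels_zQ (lam := lam)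
  obtain ⟨h10, h23⟩ := main 1 2 3 (by decide) (by decide) r.a1 r.b1
  obtain ⟨h20, h31⟩ := main 2 3 1 (by decide) (by decide) r.a2 r.b2
  obtain ⟨h30, h12⟩ := main 3 1 2 (by decide) (by decide) r.a3 r.b3
  fin_cases i <;> fin_cases j <;> first | exact h0 _ | assumption | (apply hneg; assumption)

theorem existsUnique_symm (hL : Distinct (lv lam)) (c : Matrix (Fin 4) (Fin 4) ℂ) :
    ∃! q : Matrix (Fin 4) (Fin 4) ℂ, q.IsSymm ∧ quad (zQ lam) q = quad (zQ lam) c := by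
  obtain ⟨q, hq, h⟩ : ∃ q : Matrix (Fin 4) (Fin 4) ℂ,
      q.IsSymm ∧ quad (zQ lam) q = quad (zQ lam) c := by
    choose p hp hp' using exists_symm_commutator hL
    refine ⟨(1 / 2 : ℂ) • (c + c.transpose) + (1 / 2 : ℂ) • ∑ i, ∑ j, c i j • p i j, ?_, ?_⟩
    · refine ((Matrix.isSymm_add_transpose_self c).smul _).add (Matrix.IsSymm.smul ?_ _)
      simp only [Matrix.IsSymm, Matrix.transpose_sum, Matrix.transpose_smul, (hp _ _).eq]
    · have e : quad (zQ lam) (∑ i, ∑ j, c i j • p i j)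
          = ∑ i, ∑ j, c i j • quad (zQ lam) (p i j) := by
        change quadLin (zQ lam) _ = ∑ i, ∑ j, c i j • quadLin (zQ lam) (p i j)
        simp only [map_sum, map_smul]
      have e' : quad (zQ lam) c.transpose = ∑ i, ∑ j, c i j • (zQ lam j * zQ lam i) := by
        rw [quad, Finset.sum_comm]; rfl
      rw [quad_add, quad_smul, quad_smul, quad_add, e, e']
      simp only [hp', smul_sub, Finset.sum_sub_distrib]
      rw [← quad]
      module
  refine ⟨q, ⟨hq, h⟩, fun q' ⟨hq', h'⟩ => sub_eq_zero.1 (quad_eq_zero hL (hq'.sub hq) ?_)⟩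
  rw [quad_sub, h, h', sub_self]

/-- A central quadratic element commutes with the action of the generators along three successive
vectors. Where the two neighbours of a point are independent, this forces the form to vanish on the
graph of the correspondence. -/
theorem vanish_of_central {q : Matrix (Fin 4) (Fin 4) ℂ}
    (hq : quad (zQ lam) q ∈ Subalgebra.center ℂ (QuadAlg lam)) {y y' y'' : Fin 4 → ℂ}
    (h : Chain (lv lam) y y') (h' : Chain (lv lam) y' y'') (μ : Fin 4) :
    ev q y y' * y'' μ = y μ * ev q y' y'' := by
  have := pathEval_mul_zQ (path3 h h') (quad_mem q) μ
  rw [← Subalgebra.mem_center_iff.1 hq (zQ lam μ), pathEval_zQ_mul, pathEval_quad, pathEval_quad]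
    at this
  exact this.symm

/-- The matrix of a central quadratic element is diagonal. At a point with a zero coordinate the change
of sign of this coordinate takes one of the two neighbours to the other, so that they are
independent and `vanish_of_central` applies. -/
theorem IsCentralQuad.diagonal (hL : Distinct (lv lam)) {q : Matrix (Fin 4) (Fin 4) ℂ}
    (hq : IsCentralQuad lam q) :
    q = Matrix.diagonal (fun μ => q μ μ) ∧
      ∀ l, baseCond (lv lam ∘ kl l) ((fun μ => q μ μ) ∘ kl l) := by
  have h1 := diagonal_of_vanish hL hq.1 fun l s => by
    have hb := base_chain (hL.kl l) s
    have hb' := hb.eps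
    have heb : eps (base (lv lam ∘ kl l) s) = base (lv lam ∘ kl l) s := by
      funext μ; fin_cases μ <;> simp [eps, base_zero]
    rw [heb] at hb'
    have k1 := hb.kl l
    have k2 := hb'.kl l
    rw [comp_kl_kl] at k1 k2
    have key := vanish_of_central hq.2 k2 k1
    have n0 : baseNext (lv lam ∘ kl l) s 0 ≠ 0 := by
      have hL' := hL.kl l
      exact mul_ne_zero (mul_ne_zero (rt_ne hL' (k := 1) (by decide))
        (rt_ne hL' (k := 2) (by decide))) (rt_ne hL' (k := 3) (by decide))
    obtain ⟨k, hk, nk⟩ : ∃ k : Fin 4, k ≠ 0 ∧ baseNext (lv lam ∘ kl l) s k ≠ 0 := by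
      have hL' := hL.kl l
      by_cases hc : cc (lv lam ∘ kl l) 1 = 0
      · exact ⟨2, by decide, mul_ne_zero (hL'.cc_ne (by decide) (by decide) (by decide) hc)
          (base_ne hL' s (by decide))⟩
      · exact ⟨1, by decide, mul_ne_zero hc (base_ne hL' s (by decide))⟩
    have key0 := key (kl l 0)
    have keyk := key (kl l k)
    simp only [Function.comp_apply, kl_kl] at key0 keyk
    have ek : eps (baseNext (lv lam ∘ kl l) s) k = baseNext (lv lam ∘ kl l) s k := by
      fin_cases k <;> simp [eps] at hk ⊢
    have e0 : eps (baseNext (lv lam ∘ kl l) s) 0 = -baseNext (lv lam ∘ kl l) s 0 := by simp [eps]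
    rw [ek, mul_comm (baseNext _ _ _)] at keyk
    rw [e0, neg_mul, mul_comm (baseNext _ _ _), ← neg_mul] at key0
    have f0 := mul_right_cancel₀ n0 key0
    have fk := mul_right_cancel₀ nk keyk
    linear_combination (f0 - fk) / 2
  refine ⟨?_, h1.1⟩
  ext i j
  by_cases hij : i = j
  · subst hij; simp
  · rw [Matrix.diagonal_apply_ne _ hij, h1.2 i j hij]

theorem ev_diagonal (d p r : Fin 4 → ℂ) : ev (Matrix.diagonal d) p r = dq d p r := by
  simp [ev, dq, Fin.sum_univ_four, Matrix.diagonal_apply]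

theorem TChain.sum_eq_zero {T : Fin 4 → Fin 4 → ℂ} (h : TChain (lv lam) T)
    {ω : Matrix (Fin 4) (Fin 4) ℂ} (hω : ω ∈ relSpace lam) : ∑ i, ∑ j, ω i j * T i j = 0 := by
  obtain ⟨a1, a2, a3, b1, b2, b3⟩ := h
  simp only [lv] at a1 a2 a3 b1 b2 b3
  refine relSpace_induction (p := fun ω => ∑ i, ∑ j, ω i j * T i j = 0)
    ?_ ?_ ?_ ?_ ?_ ?_ (by simp) ?_ ?_ hω
  · simp [relA, Fin.sum_univ_four, Matrix.single_apply]; linear_combination a1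
  · simp [relA, Fin.sum_univ_four, Matrix.single_apply]; linear_combination a2
  · simp [relA, Fin.sum_univ_four, Matrix.single_apply]; linear_combination a3
  · simp [relB, Fin.sum_univ_four, Matrix.single_apply]; linear_combination b1
  · simp [relB, Fin.sum_univ_four, Matrix.single_apply]; linear_combination b2
  · simp [relB, Fin.sum_univ_four, Matrix.single_apply]; linear_combination b3
  · intro ω ω' h h'
    simp only [Matrix.add_apply, add_mul, Finset.sum_add_distrib, h, h', add_zero]
  · intro a ω h
    simp only [Matrix.smul_apply, smul_eq_mul, mul_assoc, ← Finset.mul_sum, h, mul_zero]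

theorem CForm.centralEq {σ : Equiv.Perm (curve lam)} (hσ : IsCorrespondence lam σ) {d : Fin 4 → ℂ}
    (hC : CForm (lv lam) d) : CentralEq lam σ (Matrix.diagonal d) := by
  intro ω hω Z Z' y hy y' hy' u' hu' u hu
  have hu2 : Chain (lv lam) u y := hσ.chain hu (by
    rw [show σ (σ⁻¹ Z) = Z from σ.apply_symm_apply Z]; exact hy)
  by_cases hy0 : y = 0
  · simp [hy0, ev]
  by_cases hy'0 : y' = 0
  · simp [hy'0, ev]
  by_cases hu'0 : u' = 0
  · simp [hu'0, ev]
  by_cases hu0 : u = 0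
  · simp [hu0, ev]
  have := (hC (cone_of_mem _ hu) (cone_of_mem _ hy') (cone_of_mem _ hy) (cone_of_mem _ hu') hu2
    (hσ.chain hy' hu') hu0 hy'0 hy0 hu'0).sum_eq_zero hω
  rw [ev_diagonal, ev_diagonal, ev, ev, Finset.sum_mul, Finset.sum_mul,
    ← Finset.sum_add_distrib, ← this]
  refine Finset.sum_congr rfl fun i _ => ?_
  rw [Finset.sum_mul, Finset.sum_mul, ← Finset.sum_add_distrib]
  exact Finset.sum_congr rfl fun j _ => by ring

theorem IsCentralQuad.centralEq (hL : Distinct (lv lam)) {σ : Equiv.Perm (curve lam)}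
    (hσ : IsCorrespondence lam σ) {q : Matrix (Fin 4) (Fin 4) ℂ} (hq : IsCentralQuad lam q) :
    CentralEq lam σ q := by
  obtain ⟨h1, h2⟩ := hq.diagonal hL
  rw [h1]
  exact (cForm_of_baseCond hL h2).centralEq hσ

/-- A central quadratic element vanishes on the graph of the correspondence. -/
theorem IsCentralQuad.ev_eq_zero (hL : Distinct (lv lam)) {q : Matrix (Fin 4) (Fin 4) ℂ}
    (hq : IsCentralQuad lam q) {y y' : Fin 4 → ℂ} (hy : Cone (lv lam) y)
    (h : Chain (lv lam) y y') : ev q y y' = 0 := by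
  obtain ⟨h1, h2⟩ := hq.diagonal hL
  rw [h1, ev_diagonal]
  by_cases hy0 : y = 0
  · simp [hy0, dq]
  · exact vForm_of_baseCond hL h2 hy h hy0

end

/-! ### Frames -/

section

variable {lam : Fin 4 → Circle} {σ : Equiv.Perm (curve lam)} {q : Matrix (Fin 4) (Fin 4) ℂ}
  {X : Set (curve lam × curve lam)}

theorem frame_norm (p : frames lam σ q X) (k : ℤ) : ev q (p.1.1 k) (p.1.2 k) = 1 := by
  obtain ⟨x, hx⟩ := p.2
  exact (hx k).2.2.2

theorem frame_cone (p : frames lam σ q X) (k : ℤ) :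
    Cone (lv lam) (p.1.1 k) ∧ Cone (lv lam) (p.1.2 k) := by
  obtain ⟨x, hx⟩ := p.2
  exact ⟨cone_of_mem _ (hx k).2.1, cone_of_mem _ (hx k).2.2.1⟩

theorem frame_chain (hσ : IsCorrespondence lam σ) (p : frames lam σ q X) (k : ℤ) :
    Chain (lv lam) (p.1.1 k) (p.1.1 (k + 1)) := by
  obtain ⟨x, hx⟩ := p.2
  refine hσ.chain (hx k).2.1 ?_
  have := (hx (k + 1)).2.1
  simp only [tw] at this ⊢
  rwa [← Equiv.Perm.mul_apply, ← zpow_one_add, add_comm 1 k]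

theorem frame_chain' (hσ : IsCorrespondence lam σ) (p : frames lam σ q X) {k l : ℤ}
    (h : k = l + 1) : Chain (lv lam) (p.1.2 k) (p.1.2 l) := by
  subst h
  obtain ⟨x, hx⟩ := p.2
  refine hσ.chain (hx (l + 1)).2.2.1 ?_
  have := (hx l).2.2.1
  simp only [tw] at this ⊢
  rwa [← Equiv.Perm.mul_apply, ← zpow_one_add, show 1 + -(l + 1) = -l by ring]

theorem ev_comm (hq : q.IsSymm) (y y' : Fin 4 → ℂ) : ev q y y' = ev q y' y := by
  unfold ev
  rw [Finset.sum_comm]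
  refine Finset.sum_congr rfl fun i _ => Finset.sum_congr rfl fun j _ => ?_
  rw [hq.apply]; ring

/-- The equation of central quadratic forms, on a frame. -/
theorem frame_central (hC : CentralEq lam σ q) (hq : q.IsSymm) (p : frames lam σ q X)
    {ω : Matrix (Fin 4) (Fin 4) ℂ} (hω : ω ∈ relSpace lam) :
    ev ω (p.1.1 0) (p.1.2 0) + ev ω (p.1.2 (-1)) (p.1.1 (-1)) = 0 := by
  have n0 := frame_norm p 0
  have n1 := frame_norm p (-1)
  obtain ⟨x, hx⟩ := p.2
  have h0 := hx 0
  have h1 := hx (-1)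
  simp only [tw, neg_zero, zpow_zero, neg_neg, zpow_one, zpow_neg_one, Equiv.Perm.one_apply]
    at h0 h1
  have := hC ω hω _ _ _ h0.2.1 _ h0.2.2.1 _ h1.2.2.1 _ h1.2.1
  rw [ev_comm hq, n0, n1, mul_one, mul_one] at this
  exact this

/-! ### The representation in the cross product -/

variable (lam σ q X) in
/-- The monomial `f W^n`. -/
def sgl (n : ℤ) (f : Fn lam σ q X) : BigCross lam σ q X :=
  SkewMonoidAlgebra.single (Multiplicative.ofAdd n) f

theorem sgl_mul (m n : ℤ) (f g : Fn lam σ q X) : sgl lam σ q X m f * sgl lam σ q X n g =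
    sgl lam σ q X (m + n) (f * (Multiplicative.ofAdd m • g)) :=
  SkewMonoidAlgebra.single_mul_single

theorem sgl_add (n : ℤ) (f g : Fn lam σ q X) :
    sgl lam σ q X n (f + g) = sgl lam σ q X n f + sgl lam σ q X n g :=
  SkewMonoidAlgebra.single_add _ _ _

theorem sgl_smul (n : ℤ) (a : ℂ) (f : Fn lam σ q X) :
    sgl lam σ q X n (a • f) = a • sgl lam σ q X n f :=
  (SkewMonoidAlgebra.smul_single _ _ _).symm

theorem sgl_sum {ι : Type*} (s : Finset ι) (n : ℤ) (f : ι → Fn lam σ q X) :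
    sgl lam σ q X n (∑ i ∈ s, f i) = ∑ i ∈ s, sgl lam σ q X n (f i) :=
  map_sum (SkewMonoidAlgebra.singleAddHom _) _ _

theorem sgl_zero (n : ℤ) : sgl lam σ q X n 0 = 0 := SkewMonoidAlgebra.single_zero _

theorem sgl_eq_zero (n : ℤ) {f : Fn lam σ q X} (h : ∀ p, f p = 0) : sgl lam σ q X n f = 0 := by
  rw [show f = 0 from funext h, sgl_zero]

theorem sgl_zero_one : sgl lam σ q X 0 1 = 1 := rfl

theorem sgl_mem {n : ℤ} {f : Fn lam σ q X} (hf : f ∈ sections lam σ q X n) :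
    sgl lam σ q X n f ∈ CrossProd lam σ q X := by
  classical
  intro m
  change (SkewMonoidAlgebra.single (Multiplicative.ofAdd n) f).coeff _ ∈ _
  rw [SkewMonoidAlgebra.coeff_single_apply]
  split_ifs with h
  · rw [← Multiplicative.ofAdd.injective h]; exact hf
  · exact Submodule.zero_mem _

variable (lam σ q X) in
/-- The coordinates of the `k`-th vectors of the frames. -/
def co (k : ℤ) (μ : Fin 4) : Fn lam σ q X := fun p => p.1.1 k μ

variable (lam σ q X) in
/-- The coordinates of the `k`-th vectors of the second kind of the frames. -/
def co' (k : ℤ) (μ : Fin 4) : Fn lam σ q X := fun p => p.1.2 k μ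

theorem co_eq (k : ℤ) (μ : Fin 4) : co lam σ q X k μ = fnZ lam σ q X k (Pi.single μ 1) := by
  funext p; simp [co, fnZ, Pi.single_apply]

theorem co'_eq (k : ℤ) (μ : Fin 4) : co' lam σ q X k μ = fnZ' lam σ q X k (Pi.single μ 1) := by
  funext p; simp [co', fnZ', Pi.single_apply]

theorem co_mem (μ : Fin 4) : co lam σ q X 0 μ ∈ sections lam σ q X 1 := by
  refine ⟨?_, fun i c p => ?_⟩
  · rw [co_eq]; exact Algebra.subset_adjoin (Or.inl ⟨_, _, rfl⟩)
  · have hw : wt 1 i = if 0 = i then 1 else 0 := by unfold wt; split_ifs <;> omega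
    simp only [co, rescale, hw, Pi.smul_apply, smul_eq_mul]
    split_ifs <;> simp

theorem co'_mem (μ : Fin 4) : co' lam σ q X (-1) μ ∈ sections lam σ q X (-1) := by
  refine ⟨?_, fun i c p => ?_⟩
  · rw [co'_eq]; exact Algebra.subset_adjoin (Or.inr ⟨_, _, rfl⟩)
  · have hw : wt (-1) i = if -1 = i then -1 else 0 := by unfold wt; split_ifs <;> omega
    simp only [co', rescale, hw, Pi.smul_apply, smul_eq_mul]
    split_ifs <;> simp

variable (lam σ q X) in
/-- The images of the generators in the cross product. -/
def xB (μ : Fin 4) : BigCross lam σ q X :=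
  sgl lam σ q X 1 (co lam σ q X 0 μ) + sgl lam σ q X (-1) (co' lam σ q X (-1) μ)

theorem xB_mem (μ : Fin 4) : xB lam σ q X μ ∈ CrossProd lam σ q X :=
  Subalgebra.add_mem _ (sgl_mem (co_mem μ)) (sgl_mem (co'_mem μ))

variable (lam σ q X) in
/-- The images of the generators, as elements of the cross product. -/
def xC (μ : Fin 4) : CrossProd lam σ q X := ⟨xB lam σ q X μ, xB_mem μ⟩

theorem xB_mul (μ ν : Fin 4) : xB lam σ q X μ * xB lam σ q X ν =
    sgl lam σ q X 2 (co lam σ q X 0 μ * co lam σ q X 1 ν)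
      + sgl lam σ q X 0 (co lam σ q X 0 μ * co' lam σ q X 0 ν
        + co' lam σ q X (-1) μ * co lam σ q X (-1) ν)
      + sgl lam σ q X (-2) (co' lam σ q X (-1) μ * co' lam σ q X (-2) ν) := by
  rw [xB, xB, add_mul, mul_add, mul_add, sgl_mul, sgl_mul, sgl_mul, sgl_mul, sgl_add, add_assoc,
    add_assoc, add_assoc]
  rfl

variable (lam σ q X) in
/-- The coefficient of `W²` in the image of a quadratic element. -/
def valPos (c : Matrix (Fin 4) (Fin 4) ℂ) : Fn lam σ q X := fun p => ev c (p.1.1 0) (p.1.1 1)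

variable (lam σ q X) in
/-- The constant coefficient of the image of a quadratic element. -/
def valMid (c : Matrix (Fin 4) (Fin 4) ℂ) : Fn lam σ q X := fun p =>
  ev c (p.1.1 0) (p.1.2 0) + ev c (p.1.2 (-1)) (p.1.1 (-1))

variable (lam σ q X) in
/-- The coefficient of `W⁻²` in the image of a quadratic element. -/
def valNeg (c : Matrix (Fin 4) (Fin 4) ℂ) : Fn lam σ q X := fun p =>
  ev c (p.1.2 (-1)) (p.1.2 (-2))

/-- A quadratic element is represented by a sum of three monomials, whose coefficients are the
values of the quadratic form on pairs of neighbouring vectors of the frame. -/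
theorem quad_xB (c : Matrix (Fin 4) (Fin 4) ℂ) : quad (xB lam σ q X) c =
    sgl lam σ q X 2 (valPos lam σ q X c) + sgl lam σ q X 0 (valMid lam σ q X c)
      + sgl lam σ q X (-2) (valNeg lam σ q X c) := by
  unfold quad
  simp only [xB_mul, smul_add, ← sgl_smul, Finset.sum_add_distrib, ← sgl_sum]
  have hs : ∀ (F : Fin 4 → Fin 4 → Fn lam σ q X) (p : frames lam σ q X),
      (∑ i, ∑ j, F i j) p = ∑ i, ∑ j, F i j p := by
    intro F p
    exact (Finset.sum_apply p _ _).trans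
      (Finset.sum_congr rfl fun i _ => Finset.sum_apply p _ _)
  congr 1
  · congr 1
    · congr 1
      funext p
      rw [hs]
      exact Finset.sum_congr rfl fun i _ => Finset.sum_congr rfl fun j _ => (mul_assoc _ _ _).symm
    · congr 1
      funext p
      change (∑ i, ∑ j, c i j • (co lam σ q X 0 i * co' lam σ q X 0 j)) p
        + (∑ i, ∑ j, c i j • (co' lam σ q X (-1) i * co lam σ q X (-1) j)) p = _
      rw [hs, hs]
      congr 1
      · exact Finset.sum_congr rfl fun i _ => Finset.sum_congr rfl fun j _ => (mul_assoc _ _ _).symm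
      · exact Finset.sum_congr rfl fun i _ => Finset.sum_congr rfl fun j _ => (mul_assoc _ _ _).symm
  · congr 1
    funext p
    rw [hs]
    exact Finset.sum_congr rfl fun i _ => Finset.sum_congr rfl fun j _ => (mul_assoc _ _ _).symm

theorem quad_xB_rel (hσ : IsCorrespondence lam σ) (hC : CentralEq lam σ q) (hq : q.IsSymm)
    {ω : Matrix (Fin 4) (Fin 4) ℂ} (hω : ω ∈ relSpace lam) : quad (xB lam σ q X) ω = 0 := by
  rw [quad_xB, sgl_eq_zero (f := valPos lam σ q X ω) 2 fun p =>
      chain_iff.1 (frame_chain hσ p 0) ω hω,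
    sgl_eq_zero (f := valMid lam σ q X ω) 0 fun p => frame_central hC hq p hω,
    sgl_eq_zero (f := valNeg lam σ q X ω) (-2) fun p =>
      chain_iff.1 (frame_chain' hσ p (by norm_num)) ω hω, add_zero, add_zero]

/-- A form which vanishes on the graph of the correspondence is represented by a
function. -/
theorem quad_xB_of_vanish (hσ : IsCorrespondence lam σ) {c : Matrix (Fin 4) (Fin 4) ℂ}
    (hc : ∀ y y', Cone (lv lam) y → Chain (lv lam) y y' → ev c y y' = 0) :
    quad (xB lam σ q X) c = sgl lam σ q X 0 (valMid lam σ q X c) := by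
  rw [quad_xB, sgl_eq_zero (f := valPos lam σ q X c) 2 fun p =>
      hc _ _ (frame_cone p 0).1 (frame_chain hσ p 0),
    sgl_eq_zero (f := valNeg lam σ q X c) (-2) fun p =>
      hc _ _ (frame_cone p (-1)).2 (frame_chain' hσ p (by norm_num)),
    add_zero, zero_add]

theorem quad_xB_one (hL : Distinct (lv lam)) (hσ : IsCorrespondence lam σ)
    (hq : IsCentralQuad lam q) {c : Matrix (Fin 4) (Fin 4) ℂ} (hc : (2 : ℂ) • c = q) :
    quad (xB lam σ q X) c = 1 := by
  have hv : ∀ y y', ev c y y' = 1 / 2 * ev q y y' := by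
    intro y y'; rw [← hc, ev_smul]; ring
  rw [quad_xB_of_vanish hσ fun y y' hy h => by rw [hv, hq.ev_eq_zero hL hy h, mul_zero]]
  rw [← sgl_zero_one]
  congr 1
  funext p
  rw [valMid, hv, hv, ev_comm hq.1 (p.1.2 (-1)), frame_norm, frame_norm]
  norm_num
  rfl

theorem val_quad_xC (c : Matrix (Fin 4) (Fin 4) ℂ) :
    ((quad (xC lam σ q X) c : CrossProd lam σ q X) : BigCross lam σ q X) = quad (xB lam σ q X) c :=
  map_quad (CrossProd lam σ q X).val (xC lam σ q X) c

/-- The representation of the quadratic algebra in the cross product. -/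
def repQ (hσ : IsCorrespondence lam σ) (hC : CentralEq lam σ q) (hq : q.IsSymm) :
    QuadAlg lam →ₐ[ℂ] CrossProd lam σ q X :=
  liftQ (xC lam σ q X) fun ω hω => Subtype.ext <| by
    rw [val_quad_xC, quad_xB_rel hσ hC hq hω]; rfl

/-- The representation of the sphere algebra in the cross product. -/
def rep (hL : Distinct (lv lam)) (hσ : IsCorrespondence lam σ) (hq : IsCentralQuad lam q)
    {c : Matrix (Fin 4) (Fin 4) ℂ} (hc : (2 : ℂ) • c = q) :
    SphereAlg lam c →ₐ[ℂ] CrossProd lam σ q X :=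
  RingQuot.liftAlgHom ℂ ⟨repQ hσ (hq.centralEq hL hσ) hq.1, by
    rintro a b ⟨rfl, rfl⟩
    rw [map_one, map_quad]
    refine Subtype.ext ?_
    simp only [repQ, liftQ_zQ]
    rw [val_quad_xC, quad_xB_one hL hσ hq hc]; rfl⟩

theorem rep_zS (hL : Distinct (lv lam)) (hσ : IsCorrespondence lam σ) (hq : IsCentralQuad lam q)
    {c : Matrix (Fin 4) (Fin 4) ℂ} (hc : (2 : ℂ) • c = q) (μ : Fin 4) :
    rep (X := X) hL hσ hq hc (zS lam c μ) = xC lam σ q X μ := by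
  rw [rep, zS, RingQuot.liftAlgHom_mkAlgHom_apply, repQ, liftQ_zQ]

theorem rep_hasFormula (hL : Distinct (lv lam)) (hσ : IsCorrespondence lam σ)
    (hq : IsCentralQuad lam q) {c : Matrix (Fin 4) (Fin 4) ℂ} (hc : (2 : ℂ) • c = q) :
    HasFormula (rep (X := X) hL hσ hq hc) := by
  intro Y
  have h1 : fn lam σ q X (fnZ lam σ q X 0 Y) * W lam σ q X = sgl lam σ q X 1 (fnZ lam σ q X 0 Y) :=
    (sgl_mul 0 1 _ _).trans (by rw [smul_one, mul_one]; rfl)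
  have h2 : Wst lam σ q X * fn lam σ q X (fnZ' lam σ q X 0 Y)
      = sgl lam σ q X (-1) (fnZ' lam σ q X (-1) Y) :=
    (sgl_mul (-1) 0 _ _).trans (by rw [one_mul]; rfl)
  have h4 := map_lin (rep (X := X) hL hσ hq hc) (zS lam c) Y
  have h3 : (fun μ => rep (X := X) hL hσ hq hc (zS lam c μ)) = xC lam σ q X :=
    funext fun μ => rep_zS hL hσ hq hc μ
  rw [h3] at h4
  rw [h1, h2]
  refine (congrArg Subtype.val h4).trans ?_
  refine (map_lin (CrossProd lam σ q X).val (xC lam σ q X) Y).trans ?_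
  change ∑ μ, Y μ • xB lam σ q X μ = _
  simp only [xB, smul_add, ← sgl_smul, Finset.sum_add_distrib, ← sgl_sum]
  congr 2

/-! ### The exceptional points -/

theorem ev_eq_linear (y y' : Fin 4 → ℂ) :
    ev q y y' = ∑ j, (∑ i, q i j * y i) * y' j := by
  rw [ev, Finset.sum_comm]
  simp only [Finset.sum_mul]

/-- Outside a countable set of points `Z`, the form vanishes somewhere on the orbit of `(Z, Z')` only
for countably many `Z'`: for a given iterate the condition is that `Z'` lies in a plane, unless the
iterate of `Z` lies in the plane defined by a nonzero column of the matrix. -/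
theorem countable_exceptional (hL : Distinct (lv lam)) (hq0 : q ≠ 0) :
    {Z : curve lam | ¬ {Z' : curve lam | ∃ k : ℤ,
      ev q ((σ ^ k) Z).1.rep ((σ ^ (-k)) Z').1.rep = 0}.Countable}.Countable := by
  obtain ⟨i, j, hij⟩ : ∃ i j, q i j ≠ 0 := by
    by_contra! h
    exact hq0 (Matrix.ext h)
  have hfin := finite_plane_section hL (a := fun i => q i j) fun h => hij (congrFun h i)
  refine Set.Countable.mono ?_
    (Set.countable_iUnion fun k : ℤ => (hfin.preimage (σ ^ k).injective.injOn).countable)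
  intro Z hZ
  by_contra hne
  apply hZ
  simp only [Set.mem_iUnion, not_exists, Set.mem_preimage, Set.mem_ofPred_eq] at hne
  refine Set.Countable.mono ?_ (Set.countable_iUnion fun k : ℤ =>
    ((finite_plane_section hL (a := fun j => ∑ i, q i j * ((σ ^ k) Z).1.rep i)
      fun h => hne k (congrFun h j)).preimage (σ ^ (-k)).injective.injOn).countable)
  rintro Z' ⟨k, hk⟩
  rw [ev_eq_linear] at hk
  exact Set.mem_iUnion.2 ⟨k, hk⟩

end

/-! ### The adjunction of the sphere algebra -/

section

/-- The opposite algebra with the conjugate action of the complex numbers: homomorphisms to it are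
antilinear anti-homomorphisms. -/
def ConjOp (A : Type*) : Type _ := Aᵐᵒᵖ

instance {A : Type*} [Ring A] : Ring (ConjOp A) := inferInstanceAs (Ring Aᵐᵒᵖ)

instance {A : Type*} [Ring A] [Algebra ℂ A] : Algebra ℂ (ConjOp A) :=
  RingHom.toAlgebra' (S := ConjOp A) ((algebraMap ℂ Aᵐᵒᵖ).comp (starRingEnd ℂ)) fun a x =>
    Algebra.commutes (A := Aᵐᵒᵖ) ((starRingEnd ℂ) a) x

/-- The identity map to the conjugate opposite algebra. -/
def toConjOp {A : Type*} (a : A) : ConjOp A := MulOpposite.op a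

/-- The identity map from the conjugate opposite algebra. -/
def ofConjOp {A : Type*} (a : ConjOp A) : A := MulOpposite.unop a

theorem toConjOp_smul {A : Type*} [Ring A] [Algebra ℂ A] (c : ℂ) (a : A) :
    c • toConjOp a = toConjOp ((starRingEnd ℂ) c • a) := by
  rw [Algebra.smul_def]
  exact (Algebra.smul_def (A := Aᵐᵒᵖ) ((starRingEnd ℂ) c) (MulOpposite.op a)).symm

theorem toConjOp_mul {A : Type*} [Ring A] (a b : A) :
    toConjOp a * toConjOp b = toConjOp (b * a) := rfl

theorem toConjOp_sum {A ι : Type*} [Ring A] (s : Finset ι) (f : ι → A) :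
    toConjOp (∑ i ∈ s, f i) = ∑ i ∈ s, toConjOp (f i) := map_sum MulOpposite.opAddEquiv f s

/-- The adjoint of a quadratic element, on the matrices of coefficients. -/
def adjMat (lam : Fin 4 → Circle) (c : Matrix (Fin 4) (Fin 4) ℂ) : Matrix (Fin 4) (Fin 4) ℂ :=
  Matrix.of fun i j => (starRingEnd ℂ) (c j i) * ((lam i : ℂ) * (lam j : ℂ))

variable {lam : Fin 4 → Circle}

theorem adjMat_add (c c' : Matrix (Fin 4) (Fin 4) ℂ) :
    adjMat lam (c + c') = adjMat lam c + adjMat lam c' := by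
  ext i j; simp [adjMat, add_mul]

theorem adjMat_sub (c c' : Matrix (Fin 4) (Fin 4) ℂ) :
    adjMat lam (c - c') = adjMat lam c - adjMat lam c' := by
  ext i j; simp [adjMat, sub_mul]

theorem adjMat_neg (c : Matrix (Fin 4) (Fin 4) ℂ) : adjMat lam (-c) = -adjMat lam c := by
  ext i j; simp [adjMat]

theorem adjMat_smul (a : ℂ) (c : Matrix (Fin 4) (Fin 4) ℂ) :
    adjMat lam (a • c) = (starRingEnd ℂ) a • adjMat lam c := by
  ext i j; simp [adjMat, mul_assoc]

theorem adjMat_single (i j κ : Fin 4) (h : κ = i ∨ κ = j) :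
    adjMat lam (Matrix.single i j (lam κ : ℂ))
      = Matrix.single j i (if κ = i then (lam j : ℂ) else (lam i : ℂ)) := by
  ext a b
  simp only [adjMat, Matrix.of_apply, Matrix.single_apply]
  have := circle_mul_conj (lam κ)
  by_cases h1 : i = b ∧ j = a
  · obtain ⟨rfl, rfl⟩ := h1
    simp only [and_self, if_true]
    split_ifs with h2
    · subst h2; linear_combination (lam j : ℂ) * this
    · obtain rfl := h.resolve_left h2
      linear_combination (lam i : ℂ) * this
  · rw [if_neg h1, if_neg (fun h2 => h1 h2.symm)]
    simp

theorem adjMat_relA {k l m : Fin 4} (hk : 0 ≠ k) (hl : l ≠ m) :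
    adjMat lam (relA lam k l m) = -relA lam k l m := by
  rw [relA, adjMat_sub, adjMat_add, adjMat_sub, adjMat_single _ _ _ (Or.inr rfl),
    adjMat_single _ _ _ (Or.inr rfl), adjMat_single _ _ _ (Or.inr rfl),
    adjMat_single _ _ _ (Or.inr rfl), if_neg hk, if_neg hk.symm, if_neg hl.symm, if_neg hl]
  abel

theorem adjMat_relB {k l m : Fin 4} : adjMat lam (relB lam k l m) = -relB lam k l m := by
  rw [relB, adjMat_sub, adjMat_add, adjMat_add, adjMat_neg, adjMat_single _ _ _ (Or.inl rfl),
    adjMat_single _ _ _ (Or.inl rfl), adjMat_single _ _ _ (Or.inl rfl),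
    adjMat_single _ _ _ (Or.inl rfl), if_pos rfl, if_pos rfl, if_pos rfl, if_pos rfl]
  abel

theorem adjMat_mem {ω : Matrix (Fin 4) (Fin 4) ℂ} (hω : ω ∈ relSpace lam) :
    adjMat lam ω ∈ relSpace lam := by
  obtain ⟨a1, a2, a3, b1, b2, b3⟩ := relA_mem lam
  refine relSpace_induction (p := fun ω => adjMat lam ω ∈ relSpace lam) ?_ ?_ ?_ ?_ ?_ ?_ ?_ ?_ ?_ hω
  · rw [adjMat_relA (by decide) (by decide)]; exact Submodule.neg_mem _ a1
  · rw [adjMat_relA (by decide) (by decide)]; exact Submodule.neg_mem _ a2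
  · rw [adjMat_relA (by decide) (by decide)]; exact Submodule.neg_mem _ a3
  · rw [adjMat_relB]; exact Submodule.neg_mem _ b1
  · rw [adjMat_relB]; exact Submodule.neg_mem _ b2
  · rw [adjMat_relB]; exact Submodule.neg_mem _ b3
  · rw [show adjMat lam 0 = 0 by ext i j; simp [adjMat]]; exact Submodule.zero_mem _
  · intro ω ω' h h'; rw [adjMat_add]; exact Submodule.add_mem _ h h'
  · intro a ω h; rw [adjMat_smul]; exact Submodule.smul_mem _ _ h

theorem quad_toConjOp {A : Type*} [Ring A] [Algebra ℂ A] (z : Fin 4 → A)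
    (c : Matrix (Fin 4) (Fin 4) ℂ) :
    quad (fun μ => toConjOp (lv lam μ • z μ)) c = toConjOp (quad z (adjMat lam c)) := by
  unfold quad
  rw [Finset.sum_comm]
  simp only [toConjOp_sum, toConjOp_mul, toConjOp_smul]
  refine Finset.sum_congr rfl fun i _ => Finset.sum_congr rfl fun j _ => ?_
  congr 1
  rw [smul_mul_smul_comm, smul_smul]
  rfl

variable {c : Matrix (Fin 4) (Fin 4) ℂ}

variable (lam c) in
/-- The projection of the quadratic algebra to the sphere algebra. -/
def piS : QuadAlg lam →ₐ[ℂ] SphereAlg lam c := RingQuot.mkAlgHom ℂ (sphereRel lam c)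

theorem piS_surjective : Function.Surjective (piS lam c) := RingQuot.mkAlgHom_surjective ℂ _

theorem piS_quad (ω : Matrix (Fin 4) (Fin 4) ℂ) :
    piS lam c (quad (zQ lam) ω) = quad (zS lam c) ω :=
  map_quad (B := SphereAlg lam c) (piS lam c) (zQ lam) ω

theorem quad_zS_of_mem {ω : Matrix (Fin 4) (Fin 4) ℂ} (hω : ω ∈ relSpace lam) :
    quad (zS lam c) ω = 0 := by
  rw [← piS_quad, quad_zQ_of_mem hω, map_zero]

theorem quad_zS : quad (zS lam c) c = 1 := by
  have : piS lam c (quad (zQ lam) c) = piS lam c 1 :=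
    RingQuot.mkAlgHom_rel ℂ (s := sphereRel lam c) (x := quad (zQ lam) c) (y := 1) ⟨rfl, rfl⟩
  rw [← piS_quad, this, map_one]

theorem adjoin_zS : Algebra.adjoin ℂ (Set.range (zS lam c)) = ⊤ := by
  have h1 : Set.range (zS lam c) = piS lam c '' Set.range (zQ lam) :=
    Set.range_comp (piS lam c) (zQ lam)
  have h2 := AlgHom.map_adjoin (piS lam c) (Set.range (zQ lam))
  rw [adjoin_zQ, Algebra.map_top, (AlgHom.range_eq_top (piS lam c)).2 piS_surjective] at h2
  exact (congrArg (Algebra.adjoin ℂ) h1).trans h2.symm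

/-- The adjunction of the sphere algebra, as a homomorphism. -/
def tauHom (hc : adjMat lam c = c) : SphereAlg lam c →ₐ[ℂ] ConjOp (SphereAlg lam c) :=
  RingQuot.liftAlgHom ℂ ⟨liftQ (fun μ => toConjOp (lv lam μ • zS lam c μ)) fun ω hω => by
      refine (quad_toConjOp (A := SphereAlg lam c) (zS lam c) ω).trans ?_
      rw [quad_zS_of_mem (adjMat_mem hω)]; rfl, by
    rintro a b ⟨rfl, rfl⟩
    rw [map_one, map_quad]
    simp only [liftQ_zQ]
    refine (quad_toConjOp (A := SphereAlg lam c) (zS lam c) c).trans ?_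
    rw [hc, quad_zS]; rfl⟩

/-- The adjunction of the sphere algebra. -/
def tau (hc : adjMat lam c = c) (a : SphereAlg lam c) : SphereAlg lam c := ofConjOp (tauHom hc a)

theorem tau_zS (hc : adjMat lam c = c) (μ : Fin 4) :
    tau hc (zS lam c μ) = (lam μ : ℂ) • zS lam c μ := by
  rw [tau, tauHom, zS, RingQuot.liftAlgHom_mkAlgHom_apply, liftQ_zQ]; rfl

theorem tau_add (hc : adjMat lam c = c) (a b : SphereAlg lam c) :
    tau hc (a + b) = tau hc a + tau hc b := by rw [tau, map_add]; rfl

theorem tau_mul (hc : adjMat lam c = c) (a b : SphereAlg lam c) :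
    tau hc (a * b) = tau hc b * tau hc a := by rw [tau, map_mul]; rfl

theorem tau_smul (hc : adjMat lam c = c) (r : ℂ) (a : SphereAlg lam c) :
    tau hc (r • a) = (starRingEnd ℂ) r • tau hc a := by
  rw [tau, map_smul]
  exact congrArg ofConjOp (toConjOp_smul r (tau hc a))

theorem tau_one (hc : adjMat lam c = c) : tau hc 1 = 1 := by rw [tau, map_one]; rfl

theorem tau_algebraMap (hc : adjMat lam c = c) (r : ℂ) :
    tau hc (algebraMap ℂ _ r) = algebraMap ℂ _ ((starRingEnd ℂ) r) := by
  rw [Algebra.algebraMap_eq_smul_one, tau_smul, tau_one, Algebra.algebraMap_eq_smul_one]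

theorem tau_isAdjunction (hc : adjMat lam c = c) : IsAdjunction lam (zS lam c) (tau hc) where
  add := tau_add hc
  smul := tau_smul hc
  mul := tau_mul hc
  gen := tau_zS hc
  invol a := by
    have ha : a ∈ Algebra.adjoin ℂ (Set.range (zS lam c)) := by rw [adjoin_zS]; trivial
    induction ha using Algebra.adjoin_induction with
    | mem b hb =>
      obtain ⟨μ, rfl⟩ := hb
      rw [tau_zS, tau_smul, tau_zS, smul_smul, mul_comm, circle_mul_conj, one_smul]
    | algebraMap r => rw [tau_algebraMap, tau_algebraMap, Complex.conj_conj]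
    | add a b _ _ ha hb => rw [tau_add, tau_add, ha, hb]
    | mul a b _ _ ha hb => rw [tau_mul, tau_mul, ha, hb]

end

/-! ### Real forms -/

section

variable {lam : Fin 4 → Circle} {σ : Equiv.Perm (curve lam)} {q : Matrix (Fin 4) (Fin 4) ℂ}
  {X : Set (curve lam × curve lam)}

theorem ev_jV (y y' : Fin 4 → ℂ) :
    ev q (jV lam y') (jV lam y) = (starRingEnd ℂ) (ev (adjMat lam q) y y') := by
  simp only [ev, adjMat, jV_apply, map_sum, map_mul, Matrix.of_apply, Complex.conj_conj]
  rw [Finset.sum_comm]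
  exact Finset.sum_congr rfl fun i _ => Finset.sum_congr rfl fun j _ => by ring

/-- A bilinear form which vanishes on the curve is zero, because the curve spans the space. -/
theorem eq_zero_of_ev (hL : Distinct (lv lam)) {δ : Matrix (Fin 4) (Fin 4) ℂ}
    (h : ∀ Z Z' : curve lam, ev δ Z.1.rep Z'.1.rep = 0) : δ = 0 := by
  have hinf : ¬ (Set.univ : Set (curve lam)).Finite := by
    have := uncountable_curve hL
    exact fun hf => Set.not_countable_univ hf.countable
  have key : ∀ a : Fin 4 → ℂ, (∀ Z : curve lam, ∑ μ, a μ * Z.1.rep μ = 0) → a = 0 := by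
    intro a ha
    by_contra h0
    refine hinf ((finite_plane_section hL h0).subset fun Z _ => ha Z)
  ext i j
  have h1 : ∀ Z : curve lam, (fun j => ∑ i, δ i j * Z.1.rep i) = 0 := fun Z =>
    key _ fun Z' => by rw [← ev_eq_linear]; exact h Z Z'
  exact congrFun (key (fun i => δ i j) fun Z => congrFun (h1 Z) j) i

theorem adjMat_of_isReal (hL : Distinct (lv lam)) (h : IsReal lam q) : adjMat lam q = q := by
  rw [← sub_eq_zero]
  refine eq_zero_of_ev hL fun Z Z' => ?_
  have := h Z Z' _ (rep_mem _) _ (rep_mem _)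
  rw [ev_jV] at this
  rw [ev_sub, (starRingEnd ℂ).injective this, sub_self]

theorem isReal_of_adjMat (h : adjMat lam q = q) : IsReal lam q := by
  intro Z Z' y _ y' _
  rw [ev_jV, h]

theorem adjMat_sphere : adjMat lam (sphereForm lam) = sphereForm lam := by
  ext i j
  by_cases hij : i = j
  · subst hij
    simp only [adjMat, sphereForm, Matrix.of_apply, Matrix.diagonal_apply_eq]
    linear_combination (lam i : ℂ) * circle_mul_conj (lam i)
  · simp [adjMat, sphereForm, Matrix.diagonal_apply_ne _ hij, Matrix.diagonal_apply_ne _ (Ne.symm hij)]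

theorem isReal_sphere : IsReal lam ((2 : ℂ) • sphereForm lam) :=
  isReal_of_adjMat (by rw [adjMat_smul, adjMat_sphere, Complex.conj_ofNat])

theorem ev_sphere_jV (y : Fin 4 → ℂ) :
    ev ((2 : ℂ) • sphereForm lam) y (jV lam y) = ((2 * ∑ μ, ‖y μ‖ ^ 2 : ℝ) : ℂ) := by
  rw [ev_smul, sphereForm_eq, ev_diagonal]
  have : ∀ μ, lv lam μ * y μ * jV lam y μ = ((‖y μ‖ ^ 2 : ℝ) : ℂ) := by
    intro μ
    rw [jV_apply, map_mul]
    have h1 := circle_mul_conj (lam μ)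
    have h2 := Complex.mul_conj' (y μ)
    push_cast
    rw [← h2, lv]
    linear_combination y μ * (starRingEnd ℂ) (y μ) * h1
  simp only [dq, this]
  push_cast [Fin.sum_univ_four]
  ring

theorem isPositive_sphere : IsPositive lam ((2 : ℂ) • sphereForm lam) := by
  intro Z y _ hy0
  refine ⟨_, ?_, ev_sphere_jV y⟩
  obtain ⟨μ, hμ⟩ := Function.ne_iff.1 hy0
  have : 0 < ∑ μ, ‖y μ‖ ^ 2 :=
    Finset.sum_pos' (fun _ _ => by positivity) ⟨μ, Finset.mem_univ _, by
      have : 0 < ‖y μ‖ := norm_pos_iff.2 hμ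
      positivity⟩
  positivity

/-! ### The adjunction of the cross product -/

theorem jE_jE (Z : curve lam) : jE lam (jE lam Z) = Z := by
  apply Subtype.ext
  have h := mem_jE (mem_jE (rep_mem Z.1) : jV lam Z.1.rep ∈ (jE lam Z).1.submodule)
  rw [jV_jV] at h
  exact eq_of_mem h (rep_mem Z.1) Z.1.rep_nonzero

theorem jE_zpow (hj : ∀ Z, jE lam (σ Z) = σ⁻¹ (jE lam Z)) (n : ℤ) (Z : curve lam) :
    jE lam ((σ ^ n) Z) = (σ ^ (-n)) (jE lam Z) := by
  let J : Equiv.Perm (curve lam) := ⟨jE lam, jE lam, jE_jE, jE_jE⟩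
  have h1 : J * σ = σ⁻¹ * J := Equiv.ext hj
  have h2 : J * σ * J⁻¹ = σ⁻¹ := by rw [h1, mul_inv_cancel_right]
  have h3 : J * σ ^ n * J⁻¹ = σ ^ (-n) := by
    rw [← conj_zpow, h2, inv_zpow, zpow_neg]
  have h4 : J * σ ^ n = σ ^ (-n) * J := by rw [← h3, inv_mul_cancel_right]
  exact Equiv.ext_iff.1 h4 Z

/-- The frames are invariant by the conjugation if the set of orbits is. -/
theorem mapsTo_jSeq (hj : ∀ Z, jE lam (σ Z) = σ⁻¹ (jE lam Z)) (hq : IsReal lam q)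
    (hX : ∀ x ∈ X, (jE lam x.2, jE lam x.1) ∈ X) :
    Set.MapsTo (jSeq lam) (frames lam σ q X) (frames lam σ q X) := by
  rintro p ⟨x, hx⟩
  refine ⟨(jE lam x.2, jE lam x.1), fun k => ?_⟩
  obtain ⟨h1, h2, h3, h4⟩ := hx k
  have e : tw σ k (jE lam x.2, jE lam x.1) = (jE lam (tw σ k x).2, jE lam (tw σ k x).1) := by
    simp only [tw, jE_zpow hj, neg_neg]
  rw [e]
  refine ⟨hX _ h1, mem_jE h3, mem_jE h2, ?_⟩
  change ev q (jV lam (p.2 k)) (jV lam (p.1 k)) = 1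
  rw [hq _ _ _ h2 _ h3, h4, map_one]

theorem realLocus_invariant : ∀ x ∈ realLocus lam, (jE lam x.2, jE lam x.1) ∈ realLocus lam := by
  rintro ⟨x, y⟩ h
  change y = jE lam x at h
  change jE lam x = jE lam (jE lam y)
  rw [jE_jE, h]

variable (hj : Set.MapsTo (jSeq lam) (frames lam σ q X) (frames lam σ q X))

theorem fnStar_add (f g : Fn lam σ q X) : fnStar hj (f + g) = fnStar hj f + fnStar hj g :=
  funext fun _ => map_add (starRingEnd ℂ) _ _

theorem fnStar_mul (f g : Fn lam σ q X) : fnStar hj (f * g) = fnStar hj f * fnStar hj g :=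
  funext fun _ => map_mul (starRingEnd ℂ) _ _

theorem fnStar_zero : fnStar hj (0 : Fn lam σ q X) = 0 := funext fun _ => map_zero (starRingEnd ℂ)

theorem fnStar_act (g : Multiplicative ℤ) (f : Fn lam σ q X) :
    fnStar hj (g • f) = g • fnStar hj f := rfl

theorem fnStar_algebraMap (r : ℂ) : fnStar hj (algebraMap ℂ (Fn lam σ q X) r)
    = algebraMap ℂ (Fn lam σ q X) ((starRingEnd ℂ) r) := rfl

theorem crossStar_single (g : Multiplicative ℤ) (f : Fn lam σ q X) :
    crossStar hj (SkewMonoidAlgebra.single g f)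
      = SkewMonoidAlgebra.single g⁻¹ (g⁻¹ • fnStar hj f) := by
  rw [crossStar, SkewMonoidAlgebra.sum_single_index]
  · rw [fn, SkewMonoidAlgebra.single_mul_single, mul_one, one_mul]
  · rw [fnStar_zero, fn, SkewMonoidAlgebra.single_zero, mul_zero]

theorem crossStar_add (F G : BigCross lam σ q X) :
    crossStar hj (F + G) = crossStar hj F + crossStar hj G := by
  refine SkewMonoidAlgebra.sum_add_index' (fun g => ?_) fun g f f' => ?_
  · rw [fnStar_zero, fn, SkewMonoidAlgebra.single_zero, mul_zero]
  · rw [fnStar_add, fn, SkewMonoidAlgebra.single_add, mul_add]; rfl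

theorem crossStar_zero : crossStar hj 0 = 0 := SkewMonoidAlgebra.sum_zero_index

theorem crossStar_mul (F G : BigCross lam σ q X) :
    crossStar hj (F * G) = crossStar hj G * crossStar hj F := by
  induction F using SkewMonoidAlgebra.induction_on with
  | zero => rw [zero_mul, crossStar_zero, mul_zero]
  | add F F' h h' => rw [add_mul, crossStar_add, h, h', crossStar_add, mul_add]
  | single g f =>
    induction G using SkewMonoidAlgebra.induction_on with
    | zero => rw [mul_zero, crossStar_zero, zero_mul]
    | add F F' h h' => rw [mul_add, crossStar_add, h, h', crossStar_add, add_mul]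
    | single g' f' =>
      rw [SkewMonoidAlgebra.single_mul_single, crossStar_single, crossStar_single,
        crossStar_single, SkewMonoidAlgebra.single_mul_single, fnStar_mul, fnStar_act, mul_inv_rev,
        smul_mul', smul_smul, smul_smul, inv_mul_cancel_right, mul_comm (_ • fnStar hj f)]

theorem crossStar_algebraMap (r : ℂ) : crossStar hj (algebraMap ℂ (BigCross lam σ q X) r)
    = algebraMap ℂ (BigCross lam σ q X) ((starRingEnd ℂ) r) := by
  refine (crossStar_single hj 1 _).trans ?_
  rw [inv_one, one_smul, fnStar_algebraMap]
  rfl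

theorem crossStar_xB (μ : Fin 4) :
    crossStar hj (xB lam σ q X μ) = (lam μ : ℂ) • xB lam σ q X μ := by
  have h1 : ∀ y : Fin 4 → ℂ, (starRingEnd ℂ) (jV lam y μ) = (lam μ : ℂ) * y μ := by
    intro y; rw [jV_apply, Complex.conj_conj]
  rw [xB, crossStar_add, smul_add, ← sgl_smul, ← sgl_smul, add_comm]
  refine congrArg₂ (· + ·) ((crossStar_single hj _ _).trans ?_)
    ((crossStar_single hj _ _).trans ?_)
  · exact congrArg (sgl lam σ q X 1) (funext fun p => h1 _)
  · exact congrArg (sgl lam σ q X (-1)) (funext fun p => h1 _)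

theorem rep_isStarRep (hL : Distinct (lv lam)) (hσ : IsCorrespondence lam σ)
    (hq : IsCentralQuad lam q) {c : Matrix (Fin 4) (Fin 4) ℂ} (hc : (2 : ℂ) • c = q)
    (hr : IsReal lam q) (hs : ∀ Z, jE lam (σ Z) = σ⁻¹ (jE lam Z))
    (hX : ∀ x ∈ X, (jE lam x.2, jE lam x.1) ∈ X) : IsStarRep (rep (X := X) hL hσ hq hc) := by
  have hcc : adjMat lam c = c := by
    have := adjMat_of_isReal hL hr
    rw [← hc, adjMat_smul, Complex.conj_ofNat] at this
    exact smul_right_injective _ two_ne_zero this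
  refine ⟨tau hcc, tau_isAdjunction hcc, mapsTo_jSeq hs hr hX, fun a => ?_⟩
  have ha : a ∈ Algebra.adjoin ℂ (Set.range (zS lam c)) := by rw [adjoin_zS]; trivial
  induction ha using Algebra.adjoin_induction with
  | mem b hb =>
    obtain ⟨μ, rfl⟩ := hb
    rw [tau_zS, map_smul, rep_zS]
    exact (crossStar_xB _ μ).symm
  | algebraMap r =>
    rw [tau_algebraMap, AlgHom.commutes, AlgHom.commutes]
    exact (crossStar_algebraMap _ r).symm
  | add a b _ _ ha hb =>
    rw [tau_add, map_add, map_add, Subalgebra.coe_add, Subalgebra.coe_add, crossStar_add, ha, hb]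
  | mul a b _ _ ha hb =>
    rw [tau_mul, map_mul, map_mul, Subalgebra.coe_mul, Subalgebra.coe_mul, crossStar_mul, ha, hb]

end

/-! ### The quotient of the quadratic algebra by the first generator and the central elements -/

section

variable {L : Fin 4 → ℂ} {M : Type*} [AddCommGroup M] [Module ℂ M]

/-- The relations which hold in degree two modulo the right ideal generated by `z₀` and by the
quadratic elements `C` and `Ω`. -/
structure Reduced (L : Fin 4 → ℂ) (T : Fin 4 → Fin 4 → M) : Prop where
  rels : Rels L T
  zero : ∀ j, T 0 j = 0
  sphere : L 1 • T 1 1 + L 2 • T 2 2 + L 3 • T 3 3 = 0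
  om : om L 1 • T 1 1 + om L 2 • T 2 2 + om L 3 • T 3 3 = 0

/-- Elements which span the reduced degree two part: the squares of the last three generators are
multiples of the first one, the products of two different generators of the other three. -/
def wT (L : Fin 4 → ℂ) (T : Fin 4 → Fin 4 → M) : Fin 4 → M :=
  ![(cc L 1 * xx L 1)⁻¹ • T 1 1, (xx L 1)⁻¹ • T 1 0, (xx L 2)⁻¹ • T 2 0, (xx L 3)⁻¹ • T 3 0]

variable {T : Fin 4 → Fin 4 → M}

theorem Reduced.diag (hL : Distinct L) (h0 : L 0 ≠ 0) (hc : cc L 1 ≠ 0) (h : Reduced L T) :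
    T 1 1 = (cc L 1 * xx L 1) • wT L T 0 ∧ T 2 2 = (cc L 2 * xx L 2) • wT L T 0 ∧
      T 3 3 = (cc L 3 * xx L 3) • wT L T 0 := by
  have hn := mul_ne_zero hc (hL.xx_ne (k := 1) (by decide))
  have h1 : T 1 1 = (cc L 1 * xx L 1) • wT L T 0 := by
    rw [wT, Matrix.cons_val_zero, smul_smul, mul_inv_cancel₀ hn, one_smul]
  have hs := h.sphere
  have ho := h.om
  rw [h1] at hs ho
  refine ⟨h1, ?_, ?_⟩
  · apply smul_right_injective M (mul_ne_zero h0 hn)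
    simp only [NCSphere.om, dd, cc_one, cc_two, cc_three, xx_one, xx_two] at *
    linear_combination (norm := module)
      -(L 3 • ho - ((L 0 ^ 2 - L 3 ^ 2) * (L 0 * L 3 + L 1 * L 2)) • hs)
  · apply smul_right_injective M (mul_ne_zero h0 hn)
    simp only [NCSphere.om, dd, cc_one, cc_two, cc_three, xx_one, xx_three] at *
    linear_combination (norm := module)
      L 2 • ho - ((L 0 ^ 2 - L 2 ^ 2) * (L 0 * L 2 + L 3 * L 1)) • hs

theorem Reduced.col (hL : Distinct L) :
    T 1 0 = xx L 1 • wT L T 1 ∧ T 2 0 = xx L 2 • wT L T 2 ∧ T 3 0 = xx L 3 • wT L T 3 := by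
  have x1 := hL.xx_ne (k := 1) (by decide)
  have x2 := hL.xx_ne (k := 2) (by decide)
  have x3 := hL.xx_ne (k := 3) (by decide)
  refine ⟨?_, ?_, ?_⟩ <;> simp [wT, smul_smul, x1, x2, x3]

/-- The elimination behind `Reduced.off`. -/
theorem pair_of_reduced {D x c c' : ℂ} {u w t t' : M} (hD : D ≠ 0) (hx : x ≠ 0)
    (hs : c ^ 2 - c' ^ 2 = D * x) (hu : u = x • w) (hα : D • u + c' • t - c • t' = 0)
    (hβ : c • t - c' • t' = 0) : t = c' • w ∧ t' = c • w := by
  subst hu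
  constructor
  · apply smul_right_injective M (mul_ne_zero hD hx)
    linear_combination (norm := module) c • hβ - c' • hα - hs • t
  · apply smul_right_injective M (mul_ne_zero hD hx)
    linear_combination (norm := module) c' • hβ - c • hα - hs • t'

theorem Reduced.off (hL : Distinct L) (h : Reduced L T) :
    (T 2 3 = cc L 3 • wT L T 1 ∧ T 3 2 = cc L 2 • wT L T 1) ∧
      (T 3 1 = cc L 1 • wT L T 2 ∧ T 1 3 = cc L 3 • wT L T 2) ∧
      (T 1 2 = cc L 2 • wT L T 3 ∧ T 2 1 = cc L 1 • wT L T 3) := by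
  obtain ⟨w1, w2, w3⟩ := Reduced.col (T := T) hL
  have b1 := h.rels.β1
  have b2 := h.rels.β2
  have b3 := h.rels.β3
  rw [h.zero, smul_zero, zero_add] at b1 b2 b3
  exact ⟨pair_of_reduced (hL.dd_ne (k := 1) (by decide)) (hL.xx_ne (by decide))
      (by simp only [dd, cc_two, cc_three, xx_one]; ring) w1 h.rels.α1 b1,
    pair_of_reduced (hL.dd_ne (k := 2) (by decide)) (hL.xx_ne (by decide))
      (by simp only [dd, cc_one, cc_three, xx_two]; ring) w2 h.rels.α2 b2,
    pair_of_reduced (hL.dd_ne (k := 3) (by decide)) (hL.xx_ne (by decide))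
      (by simp only [dd, cc_one, cc_two, xx_three]; ring) w3 h.rels.α3 b3⟩

/-- The factors of the coordinates in `baseThird`: at the index `0` the number `2 c₁ c₂ c₃`, at the
other indices `c_k² c_l² + c_k² c_m² - c_l² c_m²`, where `c_k = λ₀ λ_k + λ_l λ_m`. -/
def nn (L : Fin 4 → ℂ) : Fin 4 → ℂ :=
  ![2 * (cc L 1 * cc L 2 * cc L 3),
    cc L 1 ^ 2 * cc L 2 ^ 2 + cc L 1 ^ 2 * cc L 3 ^ 2 - cc L 2 ^ 2 * cc L 3 ^ 2,
    cc L 2 ^ 2 * cc L 3 ^ 2 + cc L 2 ^ 2 * cc L 1 ^ 2 - cc L 3 ^ 2 * cc L 1 ^ 2,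
    cc L 3 ^ 2 * cc L 1 ^ 2 + cc L 3 ^ 2 * cc L 2 ^ 2 - cc L 1 ^ 2 * cc L 2 ^ 2]

/-- The elimination in degree three, for the products which involve an odd number of factors of
each of two kinds. -/
theorem triple_of_reduced {D D' x x' c c' c'' : ℂ} {a b b' w : M} (hD : D ≠ 0)
    (hs : c' ^ 2 - c'' ^ 2 = D * x) (hs' : c'' ^ 2 - c ^ 2 = D' * x')
    (h1 : (D * c) • w + (c' * c'') • (x' • a - b) = 0)
    (h2 : (D * x') • b' + (c' ^ 2 * x') • a - c'' ^ 2 • b = 0)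
    (h3 : (D' * c') • w + (c * c'') • (b' - x • a) = 0) :
    (2 * (c * c' * c'') * (x * x')) • a
        = (c'' ^ 2 * c ^ 2 + c'' ^ 2 * c' ^ 2 - c ^ 2 * c' ^ 2) • w ∧
      (2 * (c * c' * c'') * x) • b
        = (c' ^ 2 * c'' ^ 2 + c' ^ 2 * c ^ 2 - c'' ^ 2 * c ^ 2) • w ∧
      (2 * (c * c' * c'') * x') • b'
        = (c ^ 2 * c' ^ 2 + c ^ 2 * c'' ^ 2 - c' ^ 2 * c'' ^ 2) • w := by
  have ha : (2 * (c * c' * c'') * (x * x')) • a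
        = (c'' ^ 2 * c ^ 2 + c'' ^ 2 * c' ^ 2 - c ^ 2 * c' ^ 2) • w := by
    apply smul_right_injective M hD
    linear_combination (norm := module) (c * c' * c'') • h2 - (D * x' * c') • h3
      - (c'' ^ 2 * c) • h1 - hs • ((c * c' * c'' * x') • a) - hs' • ((D * c' ^ 2) • w)
  refine ⟨ha, ?_, ?_⟩
  · linear_combination (norm := module) ha - (2 * c * x) • h1 - hs • ((2 * c ^ 2) • w)
  · linear_combination (norm := module) ha + (2 * c' * x') • h3 + hs' • ((2 * c' ^ 2) • w)

/-- The elimination in degree three, for the remaining products. -/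
theorem cube_of_reduced {D D' D'' x x' x'' c c' c'' : ℂ} {a b d w : M} (hD : D ≠ 0) (hx : x ≠ 0)
    (hs : c' ^ 2 - c'' ^ 2 = D * x) (hs' : c'' ^ 2 - c ^ 2 = D' * x')
    (hs'' : c ^ 2 - c' ^ 2 = D'' * x'')
    (h1 : (D * x) • a + c' ^ 2 • d - c'' ^ 2 • b = 0)
    (h2 : (D' * (c' * x')) • w + (c'' * c) • (a - d) = 0)
    (h3 : (D'' * (c'' * x'')) • w + (c * c') • (b - a) = 0) :
    (2 * (c * c' * c'')) • a = (c ^ 2 * c' ^ 2 + c ^ 2 * c'' ^ 2 - c' ^ 2 * c'' ^ 2) • w := by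
  apply smul_right_injective M (mul_ne_zero hD hx)
  linear_combination (norm := module) (c * c' * c'') • h1 + c' ^ 3 • h2 + c'' ^ 3 • h3
    - hs • ((c * c' * c'') • a) + hs' • (c' ^ 4 • w) + hs'' • (c'' ^ 4 • w)
    + hs • ((c ^ 2 * c' ^ 2 + c ^ 2 * c'' ^ 2 - c' ^ 2 * c'' ^ 2) • w)

theorem sq_sub_sq_cc (L : Fin 4 → ℂ) : cc L 2 ^ 2 - cc L 3 ^ 2 = dd L 1 * xx L 1 ∧
    cc L 3 ^ 2 - cc L 1 ^ 2 = dd L 2 * xx L 2 ∧ cc L 1 ^ 2 - cc L 2 ^ 2 = dd L 3 * xx L 3 :=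
  ⟨cc_sq_one L, cc_sq_two L, cc_sq_three L⟩

/-- The third vectors of the paths which begin with the four points with first coordinate zero. -/
def baseThird (L : Fin 4 → ℂ) (s : Fin 4) : Fin 4 → ℂ :=
  ![nn L 0 * (rt L 1 * rt L 2 * rt L 3), nn L 1 * base L s 1, nn L 2 * base L s 2,
    nn L 3 * base L s 3]

/-- The elements of the reduced degree two part which are dual to the four points with first
coordinate zero. -/
def eT (L : Fin 4 → ℂ) (T : Fin 4 → Fin 4 → M) (s : Fin 4) : M :=
  (4 * (rt L 1 * rt L 2 * rt L 3))⁻¹ • ((rt L 1 * rt L 2 * rt L 3) • wT L T 0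
    + base L s 1 • wT L T 1 + base L s 2 • wT L T 2 + base L s 3 • wT L T 3)

/-- In degree three the product of the element dual to a point with a generator is proportional to
the coordinate of the third vector of the path. -/
theorem baseThird_smul_eT (hL : Distinct L) (h0 : L 0 ≠ 0) (hc : cc L 1 ≠ 0)
    {S : Fin 4 → Fin 4 → Fin 4 → M} (h : ∀ κ, Reduced L fun i j => S i j κ)
    (h' : ∀ i, Rels L (S i)) (s κ : Fin 4) :
    baseThird L s 0 • eT L (fun i j => S i j κ) s
      = baseThird L s κ • eT L (fun i j => S i j 0) s := by
  have dg := fun κ => (h κ).diag hL h0 hc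
  have cl := fun κ => Reduced.col (T := fun i j => S i j κ) hL
  have of := fun κ => (h κ).off hL
  have zr := fun κ => (h κ).zero
  obtain ⟨s1, s2, s3⟩ := sq_sub_sq_cc L
  have d1 := hL.dd_ne (k := 1) (by decide)
  have d2 := hL.dd_ne (k := 2) (by decide)
  have d3 := hL.dd_ne (k := 3) (by decide)
  have x1 := hL.xx_ne (k := 1) (by decide)
  have x2 := hL.xx_ne (k := 2) (by decide)
  have x3 := hL.xx_ne (k := 3) (by decide)
  set Y : Fin 4 → Fin 4 → M := fun μ κ => wT L (fun i j => S i j κ) μ with hY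
  have al : ∀ i, _ := fun i => (h' i).α1
  have be : ∀ i, _ := fun i => (h' i).β1
  have al2 : ∀ i, _ := fun i => (h' i).α2
  have be2 : ∀ i, _ := fun i => (h' i).β2
  have al3 : ∀ i, _ := fun i => (h' i).α3
  have be3 : ∀ i, _ := fun i => (h' i).β3
  -- the products of two different indices
  have t3 := triple_of_reduced (a := Y 0 3) (b := Y 1 2) (b' := Y 2 1) (w := Y 3 0) d1 s1 s2
    (by have := al 2
        rw [(of 0).2.2.2, (dg 3).2.1, (of 2).1.1] at this
        linear_combination (norm := module) this)
    (by have := be 2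
        rw [(cl 1).2.1, (dg 3).2.1, (of 2).1.1] at this
        linear_combination (norm := module) this)
    (by have := al2 1
        rw [(of 0).2.2.1, (dg 3).1, (of 1).2.1.2] at this
        linear_combination (norm := module) this)
  have t1 := triple_of_reduced (a := Y 0 1) (b := Y 2 3) (b' := Y 3 2) (w := Y 1 0) d2 s2 s3
    (by have := al2 3
        rw [(of 0).1.2, (dg 1).2.2, (of 3).2.1.1] at this
        linear_combination (norm := module) this)
    (by have := be2 3
        rw [(cl 2).2.2, (dg 1).2.2, (of 3).2.1.1] at this
        linear_combination (norm := module) this)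
    (by have := al3 2
        rw [(of 0).1.1, (dg 1).2.1, (of 2).2.2.2] at this
        linear_combination (norm := module) this)
  have t2 := triple_of_reduced (a := Y 0 2) (b := Y 3 1) (b' := Y 1 3) (w := Y 2 0) d3 s3 s1
    (by have := al3 1
        rw [(of 0).2.1.2, (dg 2).1, (of 1).2.2.1] at this
        linear_combination (norm := module) this)
    (by have := be3 1
        rw [(cl 3).1, (dg 2).1, (of 1).2.2.1] at this
        linear_combination (norm := module) this)
    (by have := al 3
        rw [(of 0).2.1.1, (dg 2).2.2, (of 3).1.2] at this
        linear_combination (norm := module) this)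
  -- the products of equal indices
  have r1 := cube_of_reduced (a := Y 1 1) (b := Y 2 2) (d := Y 3 3) (w := Y 0 0) d1 x1 s1 s2 s3
    (by have := be 1
        rw [(cl 1).1, (of 3).2.2.1, (of 2).2.1.2] at this
        linear_combination (norm := module) this)
    (by have := al2 2
        rw [(dg 0).2.1, (of 1).1.1, (of 3).2.2.2] at this
        linear_combination (norm := module) this)
    (by have := al3 3
        rw [(dg 0).2.2, (of 2).2.1.1, (of 1).1.2] at this
        linear_combination (norm := module) this)
  have r2 := cube_of_reduced (a := Y 2 2) (b := Y 3 3) (d := Y 1 1) (w := Y 0 0) d2 x2 s2 s3 s1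
    (by have := be2 2
        rw [(cl 2).2.1, (of 1).1.1, (of 3).2.2.2] at this
        linear_combination (norm := module) this)
    (by have := al3 3
        rw [(dg 0).2.2, (of 2).2.1.1, (of 1).1.2] at this
        linear_combination (norm := module) this)
    (by have := al 1
        rw [(dg 0).1, (of 3).2.2.1, (of 2).2.1.2] at this
        linear_combination (norm := module) this)
  have r3 := cube_of_reduced (a := Y 3 3) (b := Y 1 1) (d := Y 2 2) (w := Y 0 0) d3 x3 s3 s1 s2
    (by have := be3 3
        rw [(cl 3).2.2, (of 2).2.1.1, (of 1).1.2] at this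
        linear_combination (norm := module) this)
    (by have := al 1
        rw [(dg 0).1, (of 3).2.2.1, (of 2).2.1.2] at this
        linear_combination (norm := module) this)
    (by have := al2 2
        rw [(dg 0).2.1, (of 1).1.1, (of 3).2.2.2] at this
        linear_combination (norm := module) this)
  rw [eT, eT, smul_comm (baseThird L s 0), smul_comm (baseThird L s κ)]
  congr 1
  change baseThird L s 0 • (_ • Y 0 κ + _ • Y 1 κ + _ • Y 2 κ + _ • Y 3 κ)
    = baseThird L s κ • (_ • Y 0 0 + _ • Y 1 0 + _ • Y 2 0 + _ • Y 3 0)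
  have hp := base_prod (L := L) s
  clear_value Y
  simp only [← base_sq (L := L) s (k := 1) (by decide), ← base_sq (L := L) s (k := 2) (by decide),
    ← base_sq (L := L) s (k := 3) (by decide)] at t1 t2 t3 r1 r2 r3
  obtain ⟨t11, t12, t13⟩ := t1
  obtain ⟨t21, t22, t23⟩ := t2
  obtain ⟨t31, t32, t33⟩ := t3
  simp only [← hp]
  fin_cases κ
  · rfl
  · simp only [baseThird, ← hp, nn, Matrix.cons_val, Fin.mk_one, Fin.isValue]
    linear_combination (norm := module) base L s 1 ^ 2 • t11
      + (base L s 1 * base L s 2 * base L s 3 * base L s 1) • r1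
      + (base L s 1 * base L s 3) • t33 + (base L s 1 * base L s 2) • t22
  · simp only [baseThird, ← hp, nn, Matrix.cons_val, Fin.isValue, Fin.reduceFinMk]
    linear_combination (norm := module) base L s 2 ^ 2 • t21
      + (base L s 1 * base L s 2 * base L s 3 * base L s 2) • r2
      + (base L s 2 * base L s 3) • t32 + (base L s 1 * base L s 2) • t13
  · simp only [baseThird, ← hp, nn, Matrix.cons_val, Fin.isValue, Fin.reduceFinMk]
    linear_combination (norm := module) base L s 3 ^ 2 • t31
      + (base L s 1 * base L s 2 * base L s 3 * base L s 3) • r3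
      + (base L s 2 * base L s 3) • t23 + (base L s 1 * base L s 3) • t12

end

/-! ### Paths on the curve -/

section

variable {L : Fin 4 → ℂ}

theorem stepMap_zero (k : Fin 3) : stepMap L k 0 = 0 := by
  fin_cases k <;> funext μ <;> fin_cases μ <;> simp [stepMap]

theorem Cone.stepMap {y : Fin 4 → ℂ} (h : Cone L y) (hL : Distinct L) (k : Fin 3) :
    Cone L (stepMap L k y) := by
  by_cases hy : y = 0
  · rw [hy, stepMap_zero]; exact ⟨by simp, by simp⟩
  · exact (h.chain_stepMap hL k).cone h hL hy

/-- The sequence of vectors obtained from a vector by applying successively the given ones of the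
three polynomial maps which represent the correspondence. -/
def orb (L : Fin 4 → ℂ) (k : ℕ → Fin 3) (y : Fin 4 → ℂ) : ℕ → Fin 4 → ℂ
  | 0 => y
  | n + 1 => stepMap L (k n) (orb L k y n)

theorem Cone.orb {y : Fin 4 → ℂ} (h : Cone L y) (hL : Distinct L) (k : ℕ → Fin 3) (n : ℕ) :
    Cone L (orb L k y n) := by
  induction n with
  | zero => exact h
  | succ n ih => exact ih.stepMap hL (k n)

/-- Every point of the curve has an orbit given by nonzero vectors. -/
theorem Cone.exists_orb_ne {y : Fin 4 → ℂ} (h : Cone L y) (hL : Distinct L) (hy : y ≠ 0) :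
    ∃ k, ∀ n, NCSphere.orb L k y n ≠ 0 := by
  classical
  have key : ∀ z : Fin 4 → ℂ, ∃ j : Fin 3, Cone L z → z ≠ 0 → NCSphere.stepMap L j z ≠ 0 := by
    intro z
    by_cases hz : Cone L z ∧ z ≠ 0
    · obtain ⟨j, hj⟩ := hz.1.exists_stepMap_ne hL hz.2
      exact ⟨j, fun _ _ => hj⟩
    · exact ⟨0, fun h1 h2 => absurd ⟨h1, h2⟩ hz⟩
  choose f hf using key
  -- the vectors and the choices of the maps are constructed together
  let u : ℕ → Fin 4 → ℂ := fun n => Nat.rec y (fun _ z => NCSphere.stepMap L (f z) z) n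
  have hu : ∀ n, NCSphere.orb L (fun n => f (u n)) y n = u n := by
    intro n
    induction n with
    | zero => rfl
    | succ n ih => rw [NCSphere.orb, ih]
  refine ⟨fun n => f (u n), fun n => ?_⟩
  induction n with
  | zero => exact hy
  | succ n ih =>
    have hc := h.orb hL (fun n => f (u n)) n
    rw [NCSphere.orb]
    rw [hu n] at ih hc ⊢
    exact hf _ hc ih

end

section

variable {lam : Fin 4 → Circle}

/-- The paths on the curve, given by nonzero vectors. -/
def IsCurve (v : Path lam) : Prop := ∀ n, Cone (lv lam) (v.1 n) ∧ v.1 n ≠ 0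

/-- The path which is the orbit of a vector. -/
def orbPath (hL : Distinct (lv lam)) (k : ℕ → Fin 3) {y : Fin 4 → ℂ} (hy : Cone (lv lam) y) :
    Path lam :=
  ⟨orb (lv lam) k y, fun n => (hy.orb hL k n).chain_stepMap hL (k n)⟩

theorem exists_isCurve (hL : Distinct (lv lam)) {y : Fin 4 → ℂ} (hy : Cone (lv lam) y)
    (hy0 : y ≠ 0) : ∃ v : Path lam, IsCurve v ∧ v.1 0 = y := by
  obtain ⟨k, hk⟩ := hy.exists_orb_ne hL hy0
  exact ⟨orbPath hL k hy, fun n => ⟨hy.orb hL k n, hk n⟩, rfl⟩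

/-- The path obtained by adding a vector in front. -/
def Path.cons (y : Fin 4 → ℂ) (v : Path lam) (h : Chain (lv lam) y (v.1 0)) : Path lam :=
  ⟨fun n => Nat.casesOn n y v.1, fun n => Nat.casesOn n h v.2⟩

theorem IsCurve.cons {y : Fin 4 → ℂ} {v : Path lam} (hv : IsCurve v)
    (h : Chain (lv lam) y (v.1 0)) (hy : Cone (lv lam) y) (hy0 : y ≠ 0) : IsCurve (v.cons y h) :=
  fun n => Nat.casesOn n ⟨hy, hy0⟩ hv

/-- Every point of the curve has a predecessor. -/
theorem exists_pred (hL : Distinct (lv lam)) {y : Fin 4 → ℂ} (hy : Cone (lv lam) y)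
    (hy0 : y ≠ 0) : ∃ z, Cone (lv lam) z ∧ z ≠ 0 ∧ Chain (lv lam) z y := by
  obtain ⟨k, hk⟩ := hy.eps.exists_stepMap_ne hL (eps_ne_zero hy0)
  have h := hy.eps.chain_stepMap hL k
  have h' := h.eps
  rw [eps_eps] at h'
  exact ⟨_, (h.cone hy.eps hL (eps_ne_zero hy0)).eps, eps_ne_zero hk, h'⟩

/-- A sequence of points of the curve, in which zero is followed by zero, is proportional to the
path on the curve with the same origin. -/
theorem exists_scale (hL : Distinct (lv lam)) {v w : Path lam} (hv : IsCurve v) {c : ℂ}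
    (h0 : w.1 0 = c • v.1 0) (hz : ∀ n, w.1 n = 0 → w.1 (n + 1) = 0) :
    ∃ c : ℕ → ℂ, ∀ n, w.1 n = c n • v.1 n := by
  have key : ∀ n, ∃ c : ℂ, w.1 n = c • v.1 n := by
    intro n
    induction n with
    | zero => exact ⟨c, h0⟩
    | succ n ih =>
      obtain ⟨c, hc⟩ := ih
      by_cases hc0 : c = 0
      · exact ⟨0, by rw [zero_smul]; exact hz n (by rw [hc, hc0, zero_smul])⟩
      · have h1 := w.2 n
        rw [hc] at h1
        have h2 := h1.smul c⁻¹ 1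
        rw [smul_smul, inv_mul_cancel₀ hc0, one_smul, one_smul] at h2
        exact h2.unique (v.2 n) (hv n).1 hL (hv n).2 (hv (n + 1)).2
  choose c hc using key
  exact ⟨c, hc⟩

theorem pathEval_orb_eq (hL : Distinct (lv lam)) (k : ℕ → Fin 3) {y : Fin 4 → ℂ}
    (hy : Cone (lv lam) y) {v : Path lam} (hv : IsCurve v) (h0 : v.1 0 = y) {n : ℕ}  :
    ∃ c : ℂ, ∀ a ∈ Vn lam n, pathEval (orbPath hL k hy) a = c * pathEval v a := by
  obtain ⟨c, hc⟩ := exists_scale hL (w := orbPath hL k hy) hv (c := 1) (by rw [h0, one_smul]; rfl)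
    fun n h => by
      change stepMap (lv lam) (k n) (orb (lv lam) k y n) = 0
      rw [show orb (lv lam) k y n = 0 from h, stepMap_zero]
  exact ⟨_, fun a ha => pathEval_scale c (fun i _ => hc i) ha⟩

theorem pathEval_eq_of_isCurve (hL : Distinct (lv lam)) {v w : Path lam} (hv : IsCurve v)
    (hw : IsCurve w) {c : ℂ} (h0 : w.1 0 = c • v.1 0) {n : ℕ} {a : QuadAlg lam}
    (ha : a ∈ Vn lam n) (h : pathEval v a = 0) : pathEval w a = 0 := by
  obtain ⟨c, hc⟩ := exists_scale hL hv h0 fun n h => absurd h (hw n).2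
  rw [pathEval_scale c (fun i _ => hc i) ha, h, mul_zero]

theorem continuous_orb (L : Fin 4 → ℂ) (k : ℕ → Fin 3) (n : ℕ) :
    Continuous fun y => orb L k y n := by
  induction n with
  | zero => exact continuous_id
  | succ n ih => exact (continuous_stepMap L (k n)).comp ih

/-! ### The elements which vanish on the curve -/

variable (lam) in
/-- The element `C`. -/
def CQ : QuadAlg lam := quad (zQ lam) (sphereForm lam)

variable (lam) in
/-- The element `Ω`. -/
def OQ : QuadAlg lam := quad (zQ lam) (Matrix.diagonal (om (lv lam)))

theorem CQ_commute (hL : Distinct (lv lam)) (a : QuadAlg lam) : CQ lam * a = a * CQ lam :=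
  (Subalgebra.mem_center_iff.1 (sphere_mem_center hL) a).symm

theorem OQ_commute_zero : OQ lam * zQ lam 0 = zQ lam 0 * OQ lam := commute_zero_om rels_zQ

theorem ev_om (hL : Distinct (lv lam)) {y y' : Fin 4 → ℂ} (hy : Cone (lv lam) y)
    (h : Chain (lv lam) y y') : ev (Matrix.diagonal (om (lv lam))) y y' = 0 := by
  rw [ev_diagonal]
  by_cases hy0 : y = 0
  · simp [hy0, dq]
  · exact vForm_om hL hy h hy0

theorem ev_sphere (hL : Distinct (lv lam)) {y y' : Fin 4 → ℂ} (hy : Cone (lv lam) y)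
    (h : Chain (lv lam) y y') : ev (sphereForm lam) y y' = 0 := by
  have := (isCentralQuad_sphere hL).ev_eq_zero hL hy h
  rwa [ev_smul, mul_eq_zero, or_iff_right two_ne_zero] at this

theorem pathEval_CQ_mul (hL : Distinct (lv lam)) {v : Path lam} (hv : Cone (lv lam) (v.1 0))
    (a : QuadAlg lam) : pathEval v (CQ lam * a) = 0 := by
  rw [CQ, pathEval_quad_mul, ev_sphere hL hv (v.2 0), zero_mul]

theorem pathEval_OQ_mul (hL : Distinct (lv lam)) {v : Path lam} (hv : Cone (lv lam) (v.1 0))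
    (a : QuadAlg lam) : pathEval v (OQ lam * a) = 0 := by
  rw [OQ, pathEval_quad_mul, ev_om hL hv (v.2 0), zero_mul]

variable (lam) in
/-- The elements of degree `n + 2` of the right ideal generated by `C` and `Ω`. -/
def Jn (n : ℕ) : Submodule ℂ (QuadAlg lam) :=
  (Vn lam n).map (LinearMap.mulLeft ℂ (CQ lam)) ⊔ (Vn lam n).map (LinearMap.mulLeft ℂ (OQ lam))

variable (lam) in
/-- The elements of degree `n + 2` of the right ideal generated by `z₀`, `C` and `Ω`. -/
def In (n : ℕ) : Submodule ℂ (QuadAlg lam) :=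
  (Vn lam (n + 1)).map (LinearMap.mulLeft ℂ (zQ lam 0)) ⊔ Jn lam n

theorem mem_Jn {n : ℕ} {x : QuadAlg lam} :
    x ∈ Jn lam n ↔ ∃ b ∈ Vn lam n, ∃ c ∈ Vn lam n, x = CQ lam * b + OQ lam * c := by
  rw [Jn, Submodule.mem_sup]
  constructor
  · rintro ⟨_, ⟨b, hb, rfl⟩, _, ⟨c, hc, rfl⟩, rfl⟩
    exact ⟨b, hb, c, hc, rfl⟩
  · rintro ⟨b, hb, c, hc, rfl⟩
    exact ⟨_, ⟨b, hb, rfl⟩, _, ⟨c, hc, rfl⟩, rfl⟩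

theorem mem_In {n : ℕ} {x : QuadAlg lam} : x ∈ In lam n ↔
    ∃ a ∈ Vn lam (n + 1), ∃ y ∈ Jn lam n, x = zQ lam 0 * a + y := by
  rw [In, Submodule.mem_sup]
  constructor
  · rintro ⟨_, ⟨a, ha, rfl⟩, y, hy, rfl⟩
    exact ⟨a, ha, y, hy, rfl⟩
  · rintro ⟨a, ha, y, hy, rfl⟩
    exact ⟨_, ⟨a, ha, rfl⟩, y, hy, rfl⟩

theorem Jn_mul {n : ℕ} {x : QuadAlg lam} (hx : x ∈ Jn lam n) (μ : Fin 4) :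
    x * zQ lam μ ∈ Jn lam (n + 1) := by
  obtain ⟨b, hb, c, hc, rfl⟩ := mem_Jn.1 hx
  refine mem_Jn.2 ⟨_, mul_zQ_mem μ hb, _, mul_zQ_mem μ hc, ?_⟩
  rw [add_mul, mul_assoc, mul_assoc]

theorem In_mul {n : ℕ} {x : QuadAlg lam} (hx : x ∈ In lam n) (μ : Fin 4) :
    x * zQ lam μ ∈ In lam (n + 1) := by
  obtain ⟨a, ha, y, hy, rfl⟩ := mem_In.1 hx
  refine mem_In.2 ⟨_, mul_zQ_mem μ ha, _, Jn_mul hy μ, ?_⟩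
  rw [add_mul, mul_assoc]

theorem zero_mul_mem_In {n : ℕ} {a : QuadAlg lam} (ha : a ∈ Vn lam (n + 1)) :
    zQ lam 0 * a ∈ In lam n :=
  mem_In.2 ⟨a, ha, 0, Submodule.zero_mem _, by rw [add_zero]⟩

theorem CQ_mul_mem_In {n : ℕ} {a : QuadAlg lam} (ha : a ∈ Vn lam n) : CQ lam * a ∈ In lam n :=
  mem_In.2 ⟨0, Submodule.zero_mem _, _, mem_Jn.2 ⟨a, ha, 0, Submodule.zero_mem _, rfl⟩, by simp⟩

theorem OQ_mul_mem_In {n : ℕ} {a : QuadAlg lam} (ha : a ∈ Vn lam n) : OQ lam * a ∈ In lam n :=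
  mem_In.2 ⟨0, Submodule.zero_mem _, _, mem_Jn.2 ⟨0, Submodule.zero_mem _, a, ha, rfl⟩, by simp⟩

theorem one_mem_Vn : (1 : QuadAlg lam) ∈ Vn lam 0 := mem_Vn_zero.2 ⟨1, one_smul _ _⟩

theorem pathEval_In (hL : Distinct (lv lam)) {v : Path lam} (hv : Cone (lv lam) (v.1 0))
    (h0 : v.1 0 0 = 0) {n : ℕ} {x : QuadAlg lam} (hx : x ∈ In lam n) : pathEval v x = 0 := by
  obtain ⟨a, -, y, hy, rfl⟩ := mem_In.1 hx
  obtain ⟨b, -, c, -, rfl⟩ := mem_Jn.1 hy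
  rw [map_add, map_add, pathEval_zQ_mul, h0, zero_mul, pathEval_CQ_mul hL hv,
    pathEval_OQ_mul hL hv, add_zero, add_zero]

/-- A linear map which kills `z₀`, `C` and `Ω` satisfies the relations of degree two. -/
theorem reduced_of_killed {M : Type*} [AddCommGroup M] [Module ℂ M] (ψ : QuadAlg lam →ₗ[ℂ] M)
    (hz : ∀ μ, ψ (zQ lam 0 * zQ lam μ) = 0) (hC : ψ (CQ lam) = 0) (hO : ψ (OQ lam) = 0) :
    Reduced (lv lam) fun i j => ψ (zQ lam i * zQ lam j) := by
  refine ⟨?_, hz, ?_, ?_⟩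
  · obtain ⟨a1, a2, a3, b1, b2, b3⟩ := rels_zQ (lam := lam)
    refine ⟨?_, ?_, ?_, ?_, ?_, ?_⟩ <;> simp only [← map_smul, ← map_neg, ← map_sub, ← map_add]
    · rw [a1, map_zero]
    · rw [a2, map_zero]
    · rw [a3, map_zero]
    · rw [b1, map_zero]
    · rw [b2, map_zero]
    · rw [b3, map_zero]
  · rw [CQ, sphereForm_eq, quad_diagonal, map_add, map_add, map_add, map_smul, map_smul, map_smul,
      map_smul, hz, smul_zero, zero_add] at hC
    exact hC
  · rw [OQ, quad_diagonal, map_add, map_add, map_add, map_smul, map_smul, map_smul,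
      map_smul, hz, smul_zero, zero_add] at hO
    exact hO

theorem Rels.map {L : Fin 4 → ℂ} {M N : Type*} [AddCommGroup M] [Module ℂ M] [AddCommGroup N]
    [Module ℂ N] {T : Fin 4 → Fin 4 → M} (h : Rels L T) (f : M →ₗ[ℂ] N) :
    Rels L fun i j => f (T i j) := by
  obtain ⟨a1, a2, a3, b1, b2, b3⟩ := h
  refine ⟨?_, ?_, ?_, ?_, ?_, ?_⟩ <;> simp only [← map_smul, ← map_neg, ← map_sub, ← map_add]
  · rw [a1, map_zero]
  · rw [a2, map_zero]
  · rw [a3, map_zero]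
  · rw [b1, map_zero]
  · rw [b2, map_zero]
  · rw [b3, map_zero]

theorem map_wT {L : Fin 4 → ℂ} {M N : Type*} [AddCommGroup M] [Module ℂ M] [AddCommGroup N]
    [Module ℂ N] (T : Fin 4 → Fin 4 → M) (f : M →ₗ[ℂ] N) (μ : Fin 4) :
    f (wT L T μ) = wT L (fun i j => f (T i j)) μ := by
  fin_cases μ <;> simp [wT]

theorem map_eT {L : Fin 4 → ℂ} {M N : Type*} [AddCommGroup M] [Module ℂ M] [AddCommGroup N]
    [Module ℂ N] (T : Fin 4 → Fin 4 → M) (f : M →ₗ[ℂ] N) (s : Fin 4) :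
    f (eT L T s) = eT L (fun i j => f (T i j)) s := by
  simp only [eT, map_smul, map_add, map_wT]

end

/-! ### The kernel of the evaluation along paths -/

section

variable {lam : Fin 4 → Circle}

theorem baseThird_chain {L : Fin 4 → ℂ} (hL : Distinct L) (s : Fin 4) :
    Chain L (baseNext L s) (baseThird L s) := by
  have e1 := base_sq (L := L) s (k := 1) (by decide)
  have e2 := base_sq (L := L) s (k := 2) (by decide)
  have e3 := base_sq (L := L) s (k := 3) (by decide)
  have hp := base_prod (L := L) s
  obtain ⟨s1, s2, s3⟩ := sq_sub_sq_cc L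
  apply Chain.of_solved hL <;>
    simp only [baseNext, baseThird, nn, Matrix.cons_val, Matrix.cons_val_zero, Matrix.cons_val_one,
      ← hp]
  · linear_combination (2 * cc L 1 ^ 2 * cc L 2 * cc L 3 * base L s 2 * base L s 3)
      * (dd L 1 * e1 - s1)
  · linear_combination (2 * cc L 2 ^ 2 * cc L 3 * cc L 1 * base L s 3 * base L s 1)
      * (dd L 2 * e2 - s2)
  · linear_combination (2 * cc L 3 ^ 2 * cc L 1 * cc L 2 * base L s 1 * base L s 2)
      * (dd L 3 * e3 - s3)
  · linear_combination (base L s 2 * base L s 3 * (cc L 1 ^ 2 * cc L 2 ^ 2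
      + cc L 1 ^ 2 * cc L 3 ^ 2 - cc L 2 ^ 2 * cc L 3 ^ 2)) * (dd L 1 * e1 - s1)
  · linear_combination (base L s 3 * base L s 1 * (cc L 2 ^ 2 * cc L 3 ^ 2
      + cc L 2 ^ 2 * cc L 1 ^ 2 - cc L 3 ^ 2 * cc L 1 ^ 2)) * (dd L 2 * e2 - s2)
  · linear_combination (base L s 1 * base L s 2 * (cc L 3 ^ 2 * cc L 1 ^ 2
      + cc L 3 ^ 2 * cc L 2 ^ 2 - cc L 1 ^ 2 * cc L 2 ^ 2)) * (dd L 3 * e3 - s3)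

/-- The paths which begin at the four points with first coordinate zero. -/
theorem exists_basePath (hL : Distinct (lv lam)) (hc : ∀ k, k ≠ 0 → cc (lv lam) k ≠ 0)
    (s : Fin 4) : ∃ v : Path lam, IsCurve v ∧ v.1 0 = base (lv lam) s ∧
      v.1 1 = baseNext (lv lam) s ∧ v.1 2 = baseThird (lv lam) s := by
  have h0 := base_cone (L := lv lam) s
  have h1 := (base_chain hL s).cone h0 hL (base_ne_zero hL s)
  have h2 := (baseThird_chain hL s).cone h1 hL (baseNext_ne_zero hL s)
  have n2 : baseThird (lv lam) s ≠ 0 := fun h =>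
    mul_ne_zero (mul_ne_zero two_ne_zero (mul_ne_zero (mul_ne_zero (hc 1 (by decide))
      (hc 2 (by decide))) (hc 3 (by decide))))
      (mul_ne_zero (mul_ne_zero (rt_ne hL (k := 1) (by decide)) (rt_ne hL (k := 2) (by decide)))
        (rt_ne hL (k := 3) (by decide))) (congrFun h 0)
  obtain ⟨v, hv, hv0⟩ := exists_isCurve hL h2 n2
  have c1 : Chain (lv lam) (baseNext (lv lam) s) (v.1 0) := by
    rw [hv0]; exact baseThird_chain hL s
  exact ⟨(v.cons _ c1).cons _ (base_chain hL s),
    (hv.cons c1 h1 (baseNext_ne_zero hL s)).cons _ h0 (base_ne_zero hL s), rfl, rfl, hv0⟩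

/-- Modulo `In n`, the part of degree `n + 2` is spanned by four elements, which are dual to the
paths from the points with first coordinate zero and which are multiplied by generators according
to the coordinates of these paths. -/
structure Stage (v : Fin 4 → Path lam) (n : ℕ) (e e' : Fin 4 → QuadAlg lam) : Prop where
  mem : ∀ s, e s ∈ Vn lam (n + 2)
  mem' : ∀ s, e' s ∈ Vn lam (n + 3)
  span : Vn lam (n + 2) ≤ Submodule.span ℂ (Set.range e) ⊔ In lam n
  next : ∀ s μ, e s * zQ lam μ - (v s).1 (n + 2) μ • e' s ∈ In lam (n + 1)
  dual : ∀ s t, pathEval (v s) (e t) = if s = t then 1 else 0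

variable (lam) in
/-- The elements of degree two which are dual to the points with first coordinate zero. -/
def eQ (s : Fin 4) : QuadAlg lam := eT (lv lam) (fun i j => zQ lam i * zQ lam j) s

theorem wT_mem (μ : Fin 4) : wT (lv lam) (fun i j => zQ lam i * zQ lam j) μ ∈ Vn lam 2 := by
  fin_cases μ <;> exact Submodule.smul_mem _ _ (mul_mem_Vn (zQ_mem _) (zQ_mem _))

theorem eQ_mem (s : Fin 4) : eQ lam s ∈ Vn lam 2 :=
  Submodule.smul_mem _ _ (Submodule.add_mem _ (Submodule.add_mem _ (Submodule.add_mem _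
    (Submodule.smul_mem _ _ (wT_mem 0)) (Submodule.smul_mem _ _ (wT_mem 1)))
    (Submodule.smul_mem _ _ (wT_mem 2))) (Submodule.smul_mem _ _ (wT_mem 3)))

theorem pathEval_zz (v : Path lam) (i j : Fin 4) :
    pathEval v (zQ lam i * zQ lam j) = v.1 0 i * v.1 1 j := by
  have h := pathEval_mul_zQ v (zQ_mem i) j
  have h' := pathEval_zQ_mul v i 1
  rw [mul_one, pathEval_one, mul_one] at h'
  rw [h, h']

theorem eQ_dual (hL : Distinct (lv lam)) (hc : cc (lv lam) 1 ≠ 0) {v : Path lam} {s : Fin 4}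
    (h0 : v.1 0 = base (lv lam) s) (h1 : v.1 1 = baseNext (lv lam) s) (t : Fin 4) :
    pathEval v (eQ lam t) = if s = t then 1 else 0 := by
  have r1 := rt_ne hL (k := 1) (by decide)
  have r2 := rt_ne hL (k := 2) (by decide)
  have r3 := rt_ne hL (k := 3) (by decide)
  have h : (fun i j => pathEval v (zQ lam i * zQ lam j))
      = fun i j => base (lv lam) s i * baseNext (lv lam) s j := by
    funext i j; rw [pathEval_zz, h0, h1]
  rw [eQ, map_eT, h]
  simp only [eT, wT, smul_eq_mul, Matrix.cons_val, Matrix.cons_val_zero, Matrix.cons_val_one,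
    baseNext, ← rt_sq]
  fin_cases s <;> fin_cases t <;> simp [base, sgn] <;> field_simp <;> norm_num

theorem wT_mem_span (hL : Distinct (lv lam)) (μ : Fin 4) :
    wT (lv lam) (fun i j => zQ lam i * zQ lam j) μ ∈ Submodule.span ℂ (Set.range (eQ lam)) := by
  have r1 := rt_ne hL (k := 1) (by decide)
  have r2 := rt_ne hL (k := 2) (by decide)
  have r3 := rt_ne hL (k := 3) (by decide)
  have hm : ∀ s, eQ lam s ∈ Submodule.span ℂ (Set.range (eQ lam)) := fun s =>
    Submodule.subset_span ⟨s, rfl⟩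
  -- summation over the four points against the characters of the Klein four-group
  have key : ∀ (a : ℂ) (χ : Fin 4 → ℂ), wT (lv lam) (fun i j => zQ lam i * zQ lam j) μ
      = a • ∑ s, χ s • eQ lam s → wT (lv lam) (fun i j => zQ lam i * zQ lam j) μ ∈
        Submodule.span ℂ (Set.range (eQ lam)) := by
    intro a χ h
    rw [h]
    exact Submodule.smul_mem _ _ (Submodule.sum_mem _ fun s _ => Submodule.smul_mem _ _ (hm s))
  fin_cases μ
  · apply key 1 fun _ => 1
    simp only [Fin.sum_univ_four, eQ, eT, base, sgn, Matrix.cons_val, Matrix.cons_val_zero,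
      Matrix.cons_val_one, Fin.isValue, Fin.zero_eta]
    match_scalars <;> field_simp <;> norm_num
  · apply key (rt (lv lam) 2 * rt (lv lam) 3) fun s => sgn s 1
    simp only [Fin.sum_univ_four, eQ, eT, base, sgn, Matrix.cons_val, Matrix.cons_val_zero,
      Matrix.cons_val_one, Fin.isValue, Fin.mk_one]
    match_scalars <;> field_simp <;> norm_num
  · apply key (rt (lv lam) 1 * rt (lv lam) 3) fun s => sgn s 2
    simp only [Fin.sum_univ_four, eQ, eT, base, sgn, Matrix.cons_val, Matrix.cons_val_zero,
      Matrix.cons_val_one, Fin.isValue, Fin.reduceFinMk]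
    match_scalars <;> field_simp <;> norm_num
  · apply key (rt (lv lam) 1 * rt (lv lam) 2) fun s => sgn s 3
    simp only [Fin.sum_univ_four, eQ, eT, base, sgn, Matrix.cons_val, Matrix.cons_val_zero,
      Matrix.cons_val_one, Fin.isValue, Fin.reduceFinMk]
    match_scalars <;> field_simp <;> norm_num

theorem In_zero_mem : CQ lam ∈ In lam 0 ∧ OQ lam ∈ In lam 0 ∧
    ∀ μ, zQ lam 0 * zQ lam μ ∈ In lam 0 := by
  refine ⟨?_, ?_, fun μ => zero_mul_mem_In (zQ_mem μ)⟩
  · have := CQ_mul_mem_In (lam := lam) one_mem_Vn; rwa [mul_one] at this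
  · have := OQ_mul_mem_In (lam := lam) one_mem_Vn; rwa [mul_one] at this

theorem stage_zero (hL : Distinct (lv lam)) (hc : ∀ k, k ≠ 0 → cc (lv lam) k ≠ 0)
    {v : Fin 4 → Path lam} (h0 : ∀ s, (v s).1 0 = base (lv lam) s)
    (h1 : ∀ s, (v s).1 1 = baseNext (lv lam) s) (h2 : ∀ s, (v s).1 2 = baseThird (lv lam) s) :
    ∃ e', Stage v 0 (eQ lam) e' := by
  have hl0 : lv lam 0 ≠ 0 := Circle.coe_ne_zero _
  have hc1 := hc 1 (by decide)
  obtain ⟨iC, iO, iz⟩ := In_zero_mem (lam := lam)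
  have n2 : ∀ s, baseThird (lv lam) s 0 ≠ 0 := fun s =>
    mul_ne_zero (mul_ne_zero two_ne_zero (mul_ne_zero (mul_ne_zero (hc 1 (by decide))
      (hc 2 (by decide))) (hc 3 (by decide))))
      (mul_ne_zero (mul_ne_zero (rt_ne hL (k := 1) (by decide)) (rt_ne hL (k := 2) (by decide)))
        (rt_ne hL (k := 3) (by decide)))
  refine ⟨fun s => (baseThird (lv lam) s 0)⁻¹ • (eQ lam s * zQ lam 0), ?_, ?_, ?_, ?_, ?_⟩
  · exact eQ_mem
  · exact fun s => Submodule.smul_mem _ _ (mul_zQ_mem 0 (eQ_mem s))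
  · -- the products of two generators
    set N := Submodule.span ℂ (Set.range (eQ lam)) ⊔ In lam 0 with hN
    have hw : ∀ (a : ℂ) (μ : Fin 4),
        N.mkQ (a • wT (lv lam) (fun i j => zQ lam i * zQ lam j) μ) = 0 := by
      intro a μ
      rw [Submodule.mkQ_apply, Submodule.Quotient.mk_eq_zero]
      exact Submodule.smul_mem _ _ (Submodule.mem_sup_left (wT_mem_span hL μ))
    have hI : ∀ x ∈ In lam 0, N.mkQ x = 0 := by
      intro x hx
      rw [Submodule.mkQ_apply, Submodule.Quotient.mk_eq_zero]
      exact Submodule.mem_sup_right hx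
    have hr := reduced_of_killed N.mkQ (fun μ => hI _ (iz μ)) (hI _ iC) (hI _ iO)
    have hw' : ∀ μ, wT (lv lam) (fun i j => N.mkQ (zQ lam i * zQ lam j)) μ = 0 := by
      intro μ
      rw [← map_wT, ← one_smul ℂ (wT _ _ μ)]
      exact hw 1 μ
    obtain ⟨g1, g2, g3⟩ := hr.diag hL hl0 hc1
    obtain ⟨c1, c2, c3⟩ := Reduced.col (T := fun i j => N.mkQ (zQ lam i * zQ lam j)) hL
    obtain ⟨⟨o1, o2⟩, ⟨o3, o4⟩, ⟨o5, o6⟩⟩ := hr.off hL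
    have hz := hr.zero
    simp only [hw', smul_zero] at g1 g2 g3 c1 c2 c3 o1 o2 o3 o4 o5 o6
    have hall : ∀ i j, zQ lam i * zQ lam j ∈ N := by
      intro i j
      rw [← Submodule.Quotient.mk_eq_zero, ← Submodule.mkQ_apply]
      fin_cases i <;> fin_cases j <;> first | exact hz _ | assumption
    intro x hx
    obtain ⟨b, hb, rfl⟩ := exists_left hx
    refine Submodule.sum_mem _ fun i _ => ?_
    obtain ⟨b', hb', hbb⟩ := exists_left (hb i)
    rw [hbb, Finset.mul_sum]
    refine Submodule.sum_mem _ fun j _ => ?_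
    obtain ⟨r, hr⟩ := mem_Vn_zero.1 (hb' j)
    rw [← hr, mul_smul_comm, mul_smul_comm, mul_one]
    exact Submodule.smul_mem _ _ (hall i j)
  · intro s κ
    have hS : ∀ κ, Reduced (lv lam)
        fun i j => (In lam 1).mkQ (zQ lam i * zQ lam j * zQ lam κ) := by
      intro κ
      have hI : ∀ x ∈ In lam 0, ((In lam 1).mkQ ∘ₗ LinearMap.mulRight ℂ (zQ lam κ)) x = 0 := by
        intro x hx
        rw [LinearMap.comp_apply, Submodule.mkQ_apply, Submodule.Quotient.mk_eq_zero]
        exact In_mul hx κ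
      exact reduced_of_killed ((In lam 1).mkQ ∘ₗ LinearMap.mulRight ℂ (zQ lam κ))
        (fun μ => hI _ (iz μ)) (hI _ iC) (hI _ iO)
    have hS' : ∀ i, Rels (lv lam)
        fun j κ => (In lam 1).mkQ (zQ lam i * zQ lam j * zQ lam κ) := by
      intro i
      have := rels_zQ.map ((In lam 1).mkQ ∘ₗ LinearMap.mulLeft ℂ (zQ lam i))
      simpa only [LinearMap.comp_apply, LinearMap.mulLeft_apply, ← mul_assoc] using this
    have key := baseThird_smul_eT hL hl0 hc1 hS hS' s κ
    have he : ∀ κ, eT (lv lam) (fun i j => (In lam 1).mkQ (zQ lam i * zQ lam j * zQ lam κ)) s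
        = (In lam 1).mkQ (eQ lam s * zQ lam κ) := fun κ =>
      (map_eT _ ((In lam 1).mkQ ∘ₗ LinearMap.mulRight ℂ (zQ lam κ)) s).symm
    rw [he, he] at key
    rw [← Submodule.Quotient.mk_eq_zero, ← Submodule.mkQ_apply, map_sub, map_smul, map_smul, h2,
      smul_smul, mul_comm, mul_smul, ← key, smul_smul, inv_mul_cancel₀ (n2 s), one_smul, sub_self]
  · exact fun s t => eQ_dual hL hc1 (h0 s) (h1 s) t

/-- In the quotient by `In (n + 2)`, the products of `e' s` with the generators satisfy the
relations which determine the next vector of the path up to a factor. -/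
theorem Stage.succ (hL : Distinct (lv lam)) {v : Fin 4 → Path lam} (hv : ∀ s, IsCurve (v s))
    (h0 : ∀ s, (v s).1 0 0 = 0) {n : ℕ} {e e' : Fin 4 → QuadAlg lam} (h : Stage v n e e') :
    ∃ e'', Stage v (n + 1) e' e'' := by
  have hne : ∀ s, ∃ μ, (v s).1 (n + 3) μ ≠ 0 := fun s => Function.ne_iff.1 (hv s (n + 3)).2
  choose ν hν using hne
  refine ⟨fun s => ((v s).1 (n + 3) (ν s))⁻¹ • (e' s * zQ lam (ν s)), h.mem', ?_, ?_, ?_, ?_⟩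
  · exact fun s => Submodule.smul_mem _ _ (mul_zQ_mem _ (h.mem' s))
  · intro x hx
    obtain ⟨b, hb, rfl⟩ := exists_right hx
    refine Submodule.sum_mem _ fun μ _ => ?_
    obtain ⟨y, hy, i, hi, hyi⟩ := Submodule.mem_sup.1 (h.span (hb μ))
    obtain ⟨c, rfl⟩ := (Submodule.mem_span_range_iff_exists_fun ℂ).1 hy
    rw [← hyi, add_mul, Finset.sum_mul]
    refine Submodule.add_mem _ (Submodule.sum_mem _ fun s _ => ?_)
      (Submodule.mem_sup_right (In_mul hi μ))
    rw [smul_mul_assoc]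
    refine Submodule.smul_mem _ _ ?_
    rw [← sub_add_cancel (e s * zQ lam μ) ((v s).1 (n + 2) μ • e' s)]
    exact Submodule.add_mem _ (Submodule.mem_sup_right (h.next s μ))
      (Submodule.mem_sup_left (Submodule.smul_mem _ _ (Submodule.subset_span ⟨s, rfl⟩)))
  · intro s κ
    set φ := (In lam (n + 2)).mkQ with hφ
    have hT : Rels (lv lam) fun i j => (v s).1 (n + 2) i • φ (e' s * zQ lam j) := by
      have := rels_zQ.map (φ ∘ₗ LinearMap.mulLeft ℂ (e s))
      convert this using 3 with i j
      have h1 := In_mul (h.next s i) j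
      rw [sub_mul, smul_mul_assoc, ← Submodule.Quotient.mk_eq_zero, ← Submodule.mkQ_apply, map_sub,
        map_smul, sub_eq_zero] at h1
      rw [LinearMap.comp_apply, LinearMap.mulLeft_apply, ← mul_assoc, h1]
    have key : (v s).1 (n + 3) (ν s) • φ (e' s * zQ lam κ)
        = (v s).1 (n + 3) κ • φ (e' s * zQ lam (ν s)) := by
      rw [← sub_eq_zero, ← Module.forall_dual_apply_eq_zero_iff ℂ]
      intro f
      have hc : Chain (lv lam) ((v s).1 (n + 2)) fun j => f (φ (e' s * zQ lam j)) := by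
        obtain ⟨a1, a2, a3, b1, b2, b3⟩ := hT.map f
        simp only [map_smul, smul_eq_mul, ← mul_assoc] at a1 a2 a3 b1 b2 b3
        exact ⟨a1, a2, a3, b1, b2, b3⟩
      obtain ⟨r, hr⟩ := hc.unique ((v s).2 (n + 2)) (hv s _).1 hL (hv s _).2 (hv s _).2
      have hr' : ∀ j, f (φ (e' s * zQ lam j)) = r * (v s).1 (n + 3) j := fun j => congrFun hr j
      rw [map_sub, map_smul, map_smul, hr', hr', smul_eq_mul, smul_eq_mul]
      ring
    change e' s * zQ lam κ - (v s).1 (n + 3) κ • _ ∈ In lam (n + 2)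
    rw [← Submodule.Quotient.mk_eq_zero, ← Submodule.mkQ_apply, map_sub, map_smul, map_smul,
      smul_smul, mul_comm, mul_smul, ← hφ, ← key, smul_smul, inv_mul_cancel₀ (hν s), one_smul,
      sub_self]
  · intro s t
    obtain ⟨μ, hμ⟩ := Function.ne_iff.1 (hv t (n + 2)).2
    have h1 := pathEval_In hL (hv s 0).1 (h0 s) (h.next t μ)
    rw [map_sub, map_smul, pathEval_mul_zQ (v s) (h.mem t), h.dual, sub_eq_zero, smul_eq_mul] at h1
    apply mul_left_cancel₀ hμ
    rw [← h1]
    split_ifs with hst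
    · rw [hst, mul_comm]
    · rw [zero_mul, mul_zero]

/-- A homogeneous element which vanishes along the paths from the four points with first coordinate
zero belongs to the right ideal generated by `z₀`, `C` and `Ω`. -/
theorem exists_basePaths (hL : Distinct (lv lam)) (hc : ∀ k, k ≠ 0 → cc (lv lam) k ≠ 0) :
    ∃ v : Fin 4 → Path lam, (∀ s, IsCurve (v s)) ∧
      ∀ n, ∀ x ∈ Vn lam (n + 2), (∀ s, pathEval (v s) x = 0) → x ∈ In lam n := by
  choose v hv v0 v1 v2 using exists_basePath hL hc
  have h0 : ∀ s, (v s).1 0 0 = 0 := fun s => by rw [v0, base_zero]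
  have hst : ∀ n, ∃ e e', Stage v n e e' := by
    intro n
    induction n with
    | zero =>
      obtain ⟨e', h⟩ := stage_zero hL hc v0 v1 v2
      exact ⟨_, e', h⟩
    | succ n ih =>
      obtain ⟨e, e', h⟩ := ih
      obtain ⟨e'', h'⟩ := h.succ hL hv h0
      exact ⟨e', e'', h'⟩
  refine ⟨v, hv, fun n x hx hz => ?_⟩
  obtain ⟨e, e', h⟩ := hst n
  obtain ⟨y, hy, i, hi, rfl⟩ := Submodule.mem_sup.1 (h.span hx)
  obtain ⟨c, rfl⟩ := (Submodule.mem_span_range_iff_exists_fun ℂ).1 hy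
  have hc0 : ∀ s, c s = 0 := by
    intro s
    have := hz s
    rw [map_add, pathEval_In hL (hv s 0).1 (h0 s) hi, add_zero, map_sum] at this
    simpa [h.dual] using this
  simpa [hc0] using hi

end

/-! ### Homogeneous elements which vanish on the curve -/

section

variable {lam : Fin 4 → Circle}

/-- The values along the orbits of a chart are continuous at the centre, hence vanish there if they
vanish at the other points. -/
theorem pathEval_eq_zero_of_chart (hL : Distinct (lv lam)) {h : ℂ → Fin 4 → ℂ} {r : ℝ} (hr : 0 < r)
    (hcone : ∀ t, Cone (lv lam) (h t))
    (hd : ∀ μ, DifferentiableOn ℂ (fun t => h t μ) (Metric.ball 0 r)) {k : ℕ → Fin 3}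
    (hk : ∀ n, orb (lv lam) k (h 0) n ≠ 0) {n m : ℕ} {a : QuadAlg lam} (ha : a ∈ Vn lam n)
    (hz : ∀ t ∈ Metric.ball (0 : ℂ) r, t ≠ 0 →
      pathEval ((orbPath hL k (hcone t)).drop m) a = 0)
    {w : Path lam} (hw : IsCurve w) {c : ℂ} (hw0 : w.1 0 = c • orb (lv lam) k (h 0) m) :
    pathEval w a = 0 := by
  have hv : IsCurve ((orbPath hL k (hcone 0)).drop m) :=
    fun n => ⟨(hcone 0).orb hL k _, hk _⟩
  refine pathEval_eq_of_isCurve hL hv hw (c := c) (by rw [hw0]; simp [Path.drop, orbPath]) ha ?_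
  have hnhds : Metric.ball (0 : ℂ) r ∈ nhds (0 : ℂ) := Metric.ball_mem_nhds 0 hr
  have hh : Filter.Tendsto h (nhdsWithin 0 {0}ᶜ) (nhds (h 0)) :=
    tendsto_nhdsWithin_of_tendsto_nhds <| tendsto_pi_nhds.2 fun μ =>
      ((hd μ).differentiableAt hnhds).continuousAt
  have hlim := tendsto_pathEval (w := fun t => (orbPath hL k (hcone t)).drop m)
    (v := (orbPath hL k (hcone 0)).drop m) (l := nhdsWithin 0 {0}ᶜ) (n := n)
    (fun i _ => ((continuous_orb (lv lam) k (i + m)).tendsto (h 0)).comp hh) ha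
  refine tendsto_nhds_unique hlim (tendsto_const_nhds.congr' ?_)
  filter_upwards [self_mem_nhdsWithin, mem_nhdsWithin_of_mem_nhds hnhds] with t ht htr
  exact (hz t htr ht).symm

/-- The first generator is not a zero divisor for the values along the paths on the curve. -/
theorem pathEval_eq_zero_of_zQ_mul (hL : Distinct (lv lam)) {n : ℕ} {a : QuadAlg lam}
    (ha : a ∈ Vn lam n) (hz : ∀ v : Path lam, IsCurve v → pathEval v (zQ lam 0 * a) = 0)
    {w : Path lam} (hw : IsCurve w) : pathEval w a = 0 := by
  obtain ⟨y, hy, hy0, hyw⟩ := exists_pred hL (hw 0).1 (hw 0).2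
  obtain ⟨h, r, hr, h0, hcone, hne, hd, hcoord, -⟩ := exists_chart hL hy hy0
  obtain ⟨k, hk⟩ := (hcone 0).exists_orb_ne hL (hne 0)
  obtain ⟨c, hc⟩ := hyw.unique (h0 ▸ (hcone 0).chain_stepMap hL (k 0)) hy hL hy0 (hk 1)
  refine pathEval_eq_zero_of_chart hL hr hcone hd hk (m := 1) ha (fun t ht ht0 => ?_) hw hc
  obtain ⟨v, hv, hv0⟩ := exists_isCurve hL (hcone t) (hne t)
  obtain ⟨b, hb⟩ := pathEval_orb_eq hL k (hcone t) hv hv0 (n := n + 1)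
  have h1 := hb _ (zQ_mul_mem 0 ha)
  rw [hz v hv, mul_zero, pathEval_zQ_mul] at h1
  exact (mul_eq_zero.1 h1).resolve_left (hcoord t ht ht0 0)

theorem exists_isCurve_pt (hL : Distinct (lv lam)) (Z : curve lam) :
    ∃ v : Path lam, IsCurve v ∧ v.1 0 = Z.1.rep :=
  exists_isCurve hL (cone_of_mem Z (rep_mem _)) Z.1.rep_nonzero

theorem eq_zero_of_vanish_zero (hL : Distinct (lv lam)) {x : QuadAlg lam} (hx : x ∈ Vn lam 0)
    (hz : ∀ v : Path lam, IsCurve v → pathEval v x = 0) : x = 0 := by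
  have := uncountable_curve hL
  obtain ⟨Z⟩ : Nonempty (curve lam) := inferInstance
  obtain ⟨v, hv, -⟩ := exists_isCurve_pt hL Z
  obtain ⟨r, rfl⟩ := mem_Vn_zero.1 hx
  have := hz v hv
  rw [map_smul, pathEval_one, smul_eq_mul, mul_one] at this
  rw [this, zero_smul]

/-- A linear form which vanishes on the curve is zero. -/
theorem eq_zero_of_vanish_one (hL : Distinct (lv lam)) {x : QuadAlg lam} (hx : x ∈ Vn lam 1)
    (hz : ∀ v : Path lam, IsCurve v → pathEval v x = 0) : x = 0 := by
  obtain ⟨b, hb, rfl⟩ := exists_left hx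
  choose r hr using fun μ => mem_Vn_zero.1 (hb μ)
  simp only [← hr] at hz ⊢
  by_cases h0 : r = 0
  · simp [h0]
  · have := uncountable_curve hL
    refine absurd (finite_plane_section hL h0) (Set.infinite_of_injective_forall_mem
      Function.injective_id fun Z => ?_)
    obtain ⟨v, hv, hv0⟩ := exists_isCurve_pt hL Z
    have := hz v hv
    simp only [map_sum, pathEval_zQ_mul, map_smul, pathEval_one, hv0, smul_eq_mul, mul_one] at this
    simpa only [mul_comm, Set.mem_ofPred_eq, id] using this

/-- The homogeneous elements which vanish along the paths on the curve are in the ideal generated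
by `C` and `Ω`. Modulo this ideal such an element is a multiple of `z₀`, and the factor again
vanishes along the paths on the curve. -/
theorem mem_Jn_of_vanish (hL : Distinct (lv lam)) (hc : ∀ k, k ≠ 0 → cc (lv lam) k ≠ 0) {n : ℕ}
    {x : QuadAlg lam} (hx : x ∈ Vn lam (n + 2))
    (hz : ∀ v : Path lam, IsCurve v → pathEval v x = 0) : x ∈ Jn lam n := by
  obtain ⟨v, hv, hvI⟩ := exists_basePaths hL hc
  induction n generalizing x with
  | zero =>
    obtain ⟨a, ha, y, hy, rfl⟩ := mem_In.1 (hvI 0 x hx fun s => hz _ (hv s))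
    suffices a = 0 by rwa [this, mul_zero, zero_add]
    refine eq_zero_of_vanish_one hL ha fun w hw => pathEval_eq_zero_of_zQ_mul hL ha ?_ hw
    intro u hu
    have := hz u hu
    obtain ⟨b, -, c, -, rfl⟩ := mem_Jn.1 hy
    rwa [map_add, map_add, pathEval_CQ_mul hL (hu 0).1, pathEval_OQ_mul hL (hu 0).1, add_zero,
      add_zero] at this
  | succ n ih =>
    obtain ⟨a, ha, y, hy, rfl⟩ := mem_In.1 (hvI (n + 1) x hx fun s => hz _ (hv s))
    refine Submodule.add_mem _ ?_ hy
    obtain ⟨b, hb, c, hc, rfl⟩ := mem_Jn.1 <| ih ha fun w hw =>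
      pathEval_eq_zero_of_zQ_mul hL ha (fun u hu => by
        have := hz u hu
        obtain ⟨b, -, c, -, rfl⟩ := mem_Jn.1 hy
        rwa [map_add, map_add, pathEval_CQ_mul hL (hu 0).1, pathEval_OQ_mul hL (hu 0).1, add_zero,
          add_zero] at this) hw
    refine mem_Jn.2 ⟨_, zQ_mul_mem 0 hb, _, zQ_mul_mem 0 hc, ?_⟩
    rw [mul_add, ← mul_assoc, ← mul_assoc, ← CQ_commute hL, ← OQ_commute_zero, mul_assoc, mul_assoc]

end

/-! ### Polarization -/

theorem eqOn_zero_of_real {f : ℂ → ℂ} {r : ℝ} (hr : 0 < r)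
    (hf : DifferentiableOn ℂ f (Metric.ball 0 r))
    (h : ∀ x : ℝ, (x : ℂ) ∈ Metric.ball (0 : ℂ) r → f x = 0) :
    ∀ z ∈ Metric.ball (0 : ℂ) r, f z = 0 := by
  have hz := (hf.analyticOnNhd Metric.isOpen_ball).eqOn_zero_of_preconnected_of_frequently_eq_zero
    (convex_ball (0 : ℂ) r).isPreconnected (Metric.mem_ball_self hr) ?_
  · exact fun z hz' => hz hz'
  · have ht : Filter.Tendsto (fun x : ℝ => (x : ℂ)) (nhdsWithin 0 {0}ᶜ) (nhdsWithin 0 {0}ᶜ) := by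
      refine tendsto_nhdsWithin_iff.2 ⟨tendsto_nhdsWithin_of_tendsto_nhds ?_, ?_⟩
      · exact Complex.continuous_ofReal.tendsto' 0 0 Complex.ofReal_zero
      · filter_upwards [self_mem_nhdsWithin] with x hx
        simpa using hx
    refine ht.frequently (Filter.Eventually.frequently ?_)
    filter_upwards [(Complex.continuous_ofReal.tendsto' 0 0 Complex.ofReal_zero).mono_left
      nhdsWithin_le_nhds (Metric.ball_mem_nhds (0 : ℂ) hr)] with x hx
    exact h x hx

/-- A holomorphic function of two variables which vanishes on the pairs of conjugate numbers
vanishes. -/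
theorem eq_zero_of_conj {F : ℂ × ℂ → ℂ} {r : ℝ} (hr : 0 < r)
    (hF : ∀ x, x.1 ∈ Metric.ball (0 : ℂ) r → x.2 ∈ Metric.ball (0 : ℂ) r →
      DifferentiableAt ℂ F x)
    (h : ∀ t ∈ Metric.ball (0 : ℂ) r, F (t, (starRingEnd ℂ) t) = 0) {t s : ℂ}
    (ht : t ∈ Metric.ball (0 : ℂ) (r / 2)) (hs : s ∈ Metric.ball (0 : ℂ) (r / 2)) :
    F (t, s) = 0 := by
  have hr2 : 0 < r / 2 := by positivity
  simp only [mem_ball_zero_iff] at ht hs h hF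
  -- the variables `u` and `v` for which the pairs of conjugate numbers are the real points
  have hin : ∀ u v : ℂ, ‖u‖ < r / 2 → ‖v‖ < r / 2 →
      ‖u + v * Complex.I‖ < r ∧ ‖u - v * Complex.I‖ < r := by
    intro u v hu hv
    have : ‖v * Complex.I‖ = ‖v‖ := by simp
    constructor
    · linarith [norm_add_le u (v * Complex.I)]
    · linarith [norm_sub_le u (v * Complex.I)]
  have h1 : ∀ u : ℝ, ‖(u : ℂ)‖ < r / 2 → ∀ v : ℂ, ‖v‖ < r / 2 →
      F (u + v * Complex.I, u - v * Complex.I) = 0 := by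
    intro u hu v hv
    refine eqOn_zero_of_real (f := fun v => F (u + v * Complex.I, u - v * Complex.I)) hr2 ?_ ?_ v
      (mem_ball_zero_iff.2 hv)
    · intro v hv
      obtain ⟨ha, hb⟩ := hin u v hu (mem_ball_zero_iff.1 hv)
      exact ((hF _ ha hb).comp v (by fun_prop)).differentiableWithinAt
    · intro v hv
      have := h (u + v * Complex.I) (hin u v hu (mem_ball_zero_iff.1 hv)).1
      simpa [sub_eq_add_neg] using this
  have h2 : ∀ v : ℂ, ‖v‖ < r / 2 → ∀ u : ℂ, ‖u‖ < r / 2 →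
      F (u + v * Complex.I, u - v * Complex.I) = 0 := by
    intro v hv u hu
    refine eqOn_zero_of_real (f := fun u => F (u + v * Complex.I, u - v * Complex.I)) hr2 ?_ ?_ u
      (mem_ball_zero_iff.2 hu)
    · intro u hu
      obtain ⟨ha, hb⟩ := hin u v (mem_ball_zero_iff.1 hu) hv
      exact ((hF _ ha hb).comp u (by fun_prop)).differentiableWithinAt
    · exact fun u hu => h1 u (mem_ball_zero_iff.1 hu) v hv
  have e : (t, s) = ((t + s) / 2 + ((t - s) / (2 * Complex.I)) * Complex.I,
      (t + s) / 2 - ((t - s) / (2 * Complex.I)) * Complex.I) := by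
    refine Prod.ext ?_ ?_ <;> field_simp <;> ring
  rw [e]
  refine h2 _ ?_ _ ?_
  · rw [norm_div, norm_mul, Complex.norm_I, mul_one, Complex.norm_ofNat]
    linarith [norm_sub_le t s]
  · rw [norm_div, Complex.norm_ofNat]
    linarith [norm_add_le t s]

/-! ### The independence of the powers of `Ω` -/

section

variable {lam : Fin 4 → Circle}

theorem differentiable_stepMap (L : Fin 4 → ℂ) (k : Fin 3) : Differentiable ℂ (stepMap L k) := by
  refine differentiable_pi.2 fun μ => ?_
  fin_cases k <;> fin_cases μ <;> simp [stepMap] <;> fun_prop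

theorem differentiable_orb (L : Fin 4 → ℂ) (k : ℕ → Fin 3) (n : ℕ) :
    Differentiable ℂ fun y => orb L k y n := by
  induction n with
  | zero => exact differentiable_id
  | succ n ih => exact (differentiable_stepMap L (k n)).comp ih

theorem differentiableAt_pathEval {n : ℕ} {w : ℂ → Path lam} {t : ℂ}
    (h : ∀ i μ, DifferentiableAt ℂ (fun t => (w t).1 i μ) t) {a : QuadAlg lam}
    (ha : a ∈ Vn lam n) : DifferentiableAt ℂ (fun t => pathEval (w t) a) t := by
  induction n generalizing a w with
  | zero =>
    obtain ⟨r, rfl⟩ := mem_Vn_zero.1 ha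
    simp only [map_smul, pathEval_one]
    exact differentiableAt_const _
  | succ n ih =>
    obtain ⟨b, hb, rfl⟩ := exists_left ha
    simp only [map_sum, pathEval_zQ_mul]
    exact DifferentiableAt.fun_sum fun μ _ =>
      (h 0 μ).mul (ih (w := fun t => (w t).drop 1) (fun i => h (i + 1)) (hb μ))

/-- A chart of the conjugate curve meets a plane in finitely many points. -/
theorem finite_conj_chart (hL : Distinct (lv lam)) {h : ℂ → Fin 4 → ℂ}
    (hcone : ∀ t, Cone (lv lam) (h t)) (hne : ∀ t, h t ≠ 0)
    (hfin : ∀ z, Cone (lv lam) z → z ≠ 0 → {t | ∃ s : ℂ, h t = s • z}.Finite) {a : Fin 4 → ℂ}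
    (ha : a ≠ 0) : {s | ∑ μ, a μ * jV lam (h ((starRingEnd ℂ) s)) μ = 0}.Finite := by
  refine ((finite_plane_section hL ha).biUnion fun Z _ =>
    (hfin (jV lam Z.1.rep) (cone_of_mem _ (mem_jE (rep_mem Z.1)))
      (jV_ne_zero Z.1.rep_nonzero)).preimage (f := starRingEnd ℂ)
        (starRingEnd ℂ).injective.injOn).subset ?_
  intro s hs
  obtain ⟨Z, hZ⟩ : ∃ Z : curve lam, jV lam (h ((starRingEnd ℂ) s)) ∈ Z.1.submodule :=
    ⟨_, mem_jE (self_mem_pt _ (hne _) (hcone _))⟩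
  obtain ⟨b, hb⟩ := mem_submodule_iff.1 hZ
  refine Set.mem_biUnion (x := Z) ?_ ⟨(starRingEnd ℂ) b, ?_⟩
  · have h0 : b ≠ 0 := by
      rintro rfl
      rw [zero_smul] at hb
      exact jV_ne_zero (hne _) hb.symm
    simp only [Set.mem_ofPred_eq, ← hb, Pi.smul_apply, smul_eq_mul] at hs
    have : b * ∑ μ, a μ * Z.1.rep μ = 0 := by
      rw [← hs, Finset.mul_sum]
      exact Finset.sum_congr rfl fun μ _ => by ring
    exact (mul_eq_zero.1 this).resolve_left h0
  · rw [← jV_jV (lam := lam) (h ((starRingEnd ℂ) s)), ← hb, LinearMap.map_smulₛₗ]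

/-- The powers of the function `Ω / C` of the points `(Z, j(Z))` are linearly independent over the
sections on the curve. Indeed `j(Z)` can be replaced by an independent point, and for a fixed `Z`
the quotient of the two linear forms takes infinitely many values. -/
theorem pathEval_eq_zero_of_sum (hL : Distinct (lv lam)) (hc : cc (lv lam) 1 ≠ 0) {N M : ℕ}
    {x : ℕ → QuadAlg lam} (hx : ∀ i, x i ∈ Vn lam N)
    (hz : ∀ v : Path lam, IsCurve v → ∑ i ∈ Finset.range (M + 1),
      ev (Matrix.diagonal (om (lv lam))) (v.1 0) (jV lam (v.1 0)) ^ i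
        * ev (sphereForm lam) (v.1 0) (jV lam (v.1 0)) ^ (M - i) * pathEval v (x i) = 0)
    {w : Path lam} (hw : IsCurve w) : ∀ i ≤ M, pathEval w (x i) = 0 := by
  obtain ⟨h, r, hr, h0, hcone, hne, hd, hcoord, hfin⟩ := exists_chart hL (hw 0).1 (hw 0).2
  obtain ⟨k, hk⟩ := (hcone 0).exists_orb_ne hL (hne 0)
  have hr2 : 0 < r / 2 := by positivity
  have hsub : Metric.ball (0 : ℂ) (r / 2) ⊆ Metric.ball 0 r := Metric.ball_subset_ball (by linarith)
  have hdA : ∀ t ∈ Metric.ball (0 : ℂ) r, ∀ μ, DifferentiableAt ℂ (fun t => h t μ) t :=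
    fun t ht μ => (hd μ).differentiableAt (Metric.isOpen_ball.mem_nhds ht)
  set E : ℕ → ℂ → ℂ := fun i t => pathEval (orbPath hL k (hcone t)) (x i) with hE
  suffices hE0 : ∀ t ∈ Metric.ball (0 : ℂ) (r / 2), t ≠ 0 → ∀ i ≤ M, E i t = 0 by
    intro i hi
    refine pathEval_eq_zero_of_chart hL hr2 hcone (fun μ => (hd μ).mono hsub) hk (m := 0) (hx i)
      (fun t ht ht0 => hE0 t ht ht0 i hi) hw (c := 1) ?_
    rw [one_smul, ← h0]; rfl
  -- the chart of the conjugate curve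
  set g : ℂ → Fin 4 → ℂ := fun s => jV lam (h ((starRingEnd ℂ) s)) with hg
  have hgA : ∀ s ∈ Metric.ball (0 : ℂ) r, ∀ μ, DifferentiableAt ℂ (fun s => g s μ) s := by
    intro s hs μ
    have hs' : (starRingEnd ℂ) s ∈ Metric.ball (0 : ℂ) r := by
      rw [mem_ball_zero_iff] at hs ⊢; rwa [RCLike.norm_conj]
    have h1 := (((hdA _ hs' μ).const_mul (lam μ : ℂ))).conj_conj
    rw [Complex.conj_conj] at h1
    exact h1
  have hEA : ∀ i, ∀ t ∈ Metric.ball (0 : ℂ) r, DifferentiableAt ℂ (E i) t := by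
    intro i t ht
    refine differentiableAt_pathEval (fun n μ => ?_) (hx i)
    have h1 : DifferentiableAt ℂ h t := differentiableAt_pi.2 fun μ => hdA t ht μ
    exact differentiableAt_pi.1 (((differentiable_orb (lv lam) k n) (h t)).comp t h1) μ
  have hP := fun t s => eq_zero_of_conj (t := t) (s := s) (r := r)
    (F := fun x => ∑ i ∈ Finset.range (M + 1), dq (om (lv lam)) (h x.1) (g x.2) ^ i
        * dq (lv lam) (h x.1) (g x.2) ^ (M - i) * E i x.1) hr
    (by
      intro x h1 h2
      have d1 : ∀ μ, DifferentiableAt ℂ (fun x : ℂ × ℂ => h x.1 μ) x := fun μ =>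
        (hdA _ h1 μ).comp x differentiableAt_fst
      have d2 : ∀ μ, DifferentiableAt ℂ (fun x : ℂ × ℂ => g x.2 μ) x := fun μ =>
        (hgA _ h2 μ).comp x differentiableAt_snd
      have d3 : ∀ i, DifferentiableAt ℂ (fun x : ℂ × ℂ => E i x.1) x := fun i =>
        (hEA i _ h1).comp x differentiableAt_fst
      have d4 : ∀ d : Fin 4 → ℂ, DifferentiableAt ℂ (fun x : ℂ × ℂ => dq d (h x.1) (g x.2)) x := by
        intro d
        have := d1 0; have := d1 1; have := d1 2; have := d1 3
        have := d2 0; have := d2 1; have := d2 2; have := d2 3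
        unfold dq
        fun_prop
      exact DifferentiableAt.fun_sum fun i _ => (((d4 _).pow i).mul ((d4 _).pow (M - i))).mul (d3 i))
    (by
      intro t _
      obtain ⟨v, hv, hv0⟩ := exists_isCurve hL (hcone t) (hne t)
      obtain ⟨b, hb⟩ := pathEval_orb_eq hL k (hcone t) hv hv0 (n := N)
      have h1 := hz v hv
      simp only [sphereForm_eq, ev_diagonal, hv0] at h1
      simp only [hE, hg, Complex.conj_conj, fun i => hb (x i) (hx i)]
      rw [← mul_zero b, ← h1, Finset.mul_sum]
      exact Finset.sum_congr rfl fun i _ => by ring)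
  intro t ht ht0 i hi
  have hcoord' := hcoord t (hsub ht) ht0
  -- the polynomial which has the values of the quotient of the two forms as roots
  set P : Polynomial ℂ := ∑ i ∈ Finset.range (M + 1), Polynomial.C (E i t) * Polynomial.X ^ i
    with hPdef
  have hcoeff : P.coeff i = E i t := by
    rw [hPdef, Polynomial.finsetSum_coeff]
    simp [Polynomial.coeff_C_mul, Polynomial.coeff_X_pow, hi]
  by_contra hEi
  have hP0 : P ≠ 0 := fun h' => hEi (by rw [← hcoeff, h', Polynomial.coeff_zero])
  have hlin : ∀ a : Fin 4 → ℂ, a ≠ 0 → {s | dq a (h t) (g s) = 0}.Finite := by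
    intro a ha
    refine (finite_conj_chart hL hcone hne hfin (a := fun μ => a μ * h t μ) ?_).subset ?_
    · intro h'
      exact ha (funext fun μ => (mul_eq_zero.1 (congrFun h' μ)).resolve_right (hcoord' μ))
    · intro s hs
      simp only [Set.mem_ofPred_eq, Fin.sum_univ_four]
      exact hs
  have hl0 : lv lam 0 ≠ 0 := Circle.coe_ne_zero _
  have hroot : ∀ ρ : ℂ, (fun μ => om (lv lam) μ - ρ * lv lam μ) ≠ 0 := by
    intro ρ h'
    have e0 := congrFun h' 0
    have e1 := congrFun h' 1
    simp only [om, dd, sub_self, zero_mul, zero_sub, Pi.zero_apply, neg_eq_zero] at e0 e1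
    rw [(mul_eq_zero.1 e0).resolve_right hl0, zero_mul, sub_zero] at e1
    exact mul_ne_zero (hL.dd_ne (k := 1) (by decide)) hc e1
  have hinf : (Metric.ball (0 : ℂ) (r / 2)).Infinite :=
    infinite_of_mem_nhds 0 (Metric.ball_mem_nhds _ hr2)
  refine hinf (((hlin (lv lam) fun h' => hl0 (congrFun h' 0)).union
    (P.roots.toFinset.finite_toSet.biUnion fun ρ _ => hlin _ (hroot ρ))).subset ?_)
  intro s hs
  by_cases hB : dq (lv lam) (h t) (g s) = 0
  · exact Or.inl hB
  right
  set A := dq (om (lv lam)) (h t) (g s) with hA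
  set B := dq (lv lam) (h t) (g s) with hBdef
  refine Set.mem_biUnion (x := A / B) ?_ ?_
  · rw [Finset.mem_coe, Multiset.mem_toFinset, Polynomial.mem_roots hP0, Polynomial.IsRoot,
      hPdef, Polynomial.eval_finsetSum]
    have h1 := hP t s ht hs
    apply mul_left_cancel₀ (pow_ne_zero M hB)
    rw [mul_zero, ← h1, Finset.mul_sum]
    refine Finset.sum_congr rfl fun i hi => ?_
    rw [Polynomial.eval_mul, Polynomial.eval_C, Polynomial.eval_pow, Polynomial.eval_X, div_pow,
      ← hA, ← hBdef, ← pow_sub_mul_pow B (Nat.lt_succ_iff.1 (Finset.mem_range.1 hi))]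
    field_simp
  · have e : dq (fun μ => om (lv lam) μ - A / B * lv lam μ) (h t) (g s)
        = A - A / B * B := by
      rw [hA, hBdef]; simp only [dq]; ring
    rw [div_mul_cancel₀ _ hB, sub_self] at e
    exact e

end

/-! ### The leading coefficients in the cross product -/

section

variable {lam : Fin 4 → Circle} {σ : Equiv.Perm (curve lam)} {q : Matrix (Fin 4) (Fin 4) ℂ}
  {X : Set (curve lam × curve lam)}

/-- The value at a frame of the coefficient of `Wᵐ`. -/
def coefAt (m : ℤ) (p : frames lam σ q X) : BigCross lam σ q X →ₗ[ℂ] ℂ where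
  toFun F := F.coeff (Multiplicative.ofAdd m) p
  map_add' F G := by rw [SkewMonoidAlgebra.coeff_add]; rfl
  map_smul' c F := by rw [SkewMonoidAlgebra.coeff_smul]; rfl

theorem coefAt_sgl_mul (m n : ℤ) (p : frames lam σ q X) (f : Fn lam σ q X)
    (G : BigCross lam σ q X) : coefAt m p (sgl lam σ q X n f * G)
      = f p * coefAt (m - n) (shift lam σ q X n p) G := by
  change (SkewMonoidAlgebra.coeff (SkewMonoidAlgebra.single (Multiplicative.ofAdd n) f * G)) _ p = _
  rw [SkewMonoidAlgebra.coeff_single_mul]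
  have : (Multiplicative.ofAdd n)⁻¹ * Multiplicative.ofAdd m = Multiplicative.ofAdd (m - n) := by
    rw [← ofAdd_neg, ← ofAdd_add]; congr 1; ring
  rw [this]
  rfl

theorem coefAt_xB_mul (m : ℤ) (p : frames lam σ q X) (μ : Fin 4) (G : BigCross lam σ q X) :
    coefAt m p (xB lam σ q X μ * G) = p.1.1 0 μ * coefAt (m - 1) (shift lam σ q X 1 p) G
      + p.1.2 (-1) μ * coefAt (m + 1) (shift lam σ q X (-1) p) G := by
  rw [xB, add_mul, map_add, coefAt_sgl_mul, coefAt_sgl_mul, sub_neg_eq_add]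
  rfl

theorem coefAt_one (m : ℤ) (p : frames lam σ q X) :
    coefAt m p 1 = if m = 0 then 1 else 0 := by
  change (SkewMonoidAlgebra.single (1 : Multiplicative ℤ) (1 : Fn lam σ q X)).coeff _ p = _
  classical
  rw [SkewMonoidAlgebra.coeff_single_apply]
  by_cases h : m = 0
  · subst h; simp; rfl
  · have h' : (1 : Multiplicative ℤ) ≠ Multiplicative.ofAdd m := fun e =>
      h (congrArg Multiplicative.toAdd e).symm
    rw [if_neg h, if_neg h']; rfl

/-- The path which consists of the vectors of a frame with nonnegative index. -/
def framePath (hσ : IsCorrespondence lam σ) (p : frames lam σ q X) : Path lam :=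
  ⟨fun k => p.1.1 k, fun k => by have := frame_chain hσ p k; exact_mod_cast this⟩

theorem framePath_shift (hσ : IsCorrespondence lam σ) (p : frames lam σ q X) :
    framePath hσ (shift lam σ q X 1 p) = (framePath hσ p).drop 1 := by
  apply Subtype.ext
  funext k
  change p.1.1 (k + 1) = p.1.1 ((k + 1 : ℕ) : ℤ)
  push_cast; rfl

variable (hσ : IsCorrespondence lam σ) (hC : CentralEq lam σ q) (hq : q.IsSymm)

theorem val_repQ_zQ_mul (μ : Fin 4) (a : QuadAlg lam) :
    ((repQ (X := X) hσ hC hq (zQ lam μ * a)) : BigCross lam σ q X)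
      = xB lam σ q X μ * (repQ (X := X) hσ hC hq a : BigCross lam σ q X) := by
  rw [map_mul, repQ, liftQ_zQ]
  rfl

theorem val_repQ_sum {ι : Type*} (s : Finset ι) (a : ι → QuadAlg lam) :
    ((repQ (X := X) hσ hC hq (∑ i ∈ s, a i)) : BigCross lam σ q X)
      = ∑ i ∈ s, (repQ (X := X) hσ hC hq (a i) : BigCross lam σ q X) :=
  map_sum ((CrossProd lam σ q X).val.comp (repQ (X := X) hσ hC hq)) a s

theorem val_repQ_smul_one (r : ℂ) :
    ((repQ (X := X) hσ hC hq (r • 1)) : BigCross lam σ q X) = r • 1 := by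
  rw [map_smul, map_one]; rfl

/-- An element of degree `n` is represented by a sum of monomials of degree at most `n`. -/
theorem coefAt_repQ_of_lt {n : ℕ} {a : QuadAlg lam} (ha : a ∈ Vn lam n) {m : ℤ} (hm : n < m)
    (p : frames lam σ q X) : coefAt m p (repQ (X := X) hσ hC hq a : BigCross lam σ q X) = 0 := by
  induction n generalizing a m p with
  | zero =>
    obtain ⟨r, rfl⟩ := mem_Vn_zero.1 ha
    rw [val_repQ_smul_one, map_smul, coefAt_one, if_neg (by simp at hm; omega), smul_zero]
  | succ n ih =>
    obtain ⟨b, hb, rfl⟩ := exists_left ha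
    rw [val_repQ_sum, map_sum]
    refine Finset.sum_eq_zero fun μ _ => ?_
    push_cast at hm
    rw [val_repQ_zQ_mul, coefAt_xB_mul, ih (hb μ) (by omega), ih (hb μ) (by omega), mul_zero,
      mul_zero, add_zero]

/-- The coefficient of `Wⁿ` in the image of an element of degree `n` is its value along the path of
the frame. -/
theorem coefAt_repQ {n : ℕ} {a : QuadAlg lam} (ha : a ∈ Vn lam n) (p : frames lam σ q X) :
    coefAt n p (repQ (X := X) hσ hC hq a : BigCross lam σ q X) = pathEval (framePath hσ p) a := by
  induction n generalizing a p with
  | zero =>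
    obtain ⟨r, rfl⟩ := mem_Vn_zero.1 ha
    rw [val_repQ_smul_one, map_smul, map_smul, pathEval_one, coefAt_one, if_pos (by simp)]
  | succ n ih =>
    obtain ⟨b, hb, rfl⟩ := exists_left ha
    rw [val_repQ_sum, map_sum, map_sum]
    refine Finset.sum_congr rfl fun μ _ => ?_
    have h1 := coefAt_repQ_of_lt hσ hC hq (hb μ) (m := (n + 1 : ℕ) + 1) (by omega)
      (shift lam σ q X (-1) p)
    have h2 := ih (hb μ) (shift lam σ q X 1 p)
    rw [val_repQ_zQ_mul, coefAt_xB_mul, h1, mul_zero, add_zero, pathEval_zQ_mul, ← framePath_shift,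
      ← h2]
    push_cast
    rw [add_sub_cancel_right]
    rfl

/-- The two terms of the function which represents `Ω` are equal. -/
theorem valMid_om (hL : Distinct (lv lam)) (hσ : IsCorrespondence lam σ) (hQ : IsCentralQuad lam q)
    (p : frames lam σ q X) :
    valMid lam σ q X (Matrix.diagonal (om (lv lam))) p
      = 2 * ev (Matrix.diagonal (om (lv lam))) (p.1.1 0) (p.1.2 0) := by
  set O := Matrix.diagonal (om (lv lam)) with hO
  have hCO : CentralEq lam σ O := (cForm_om hL).centralEq hσ
  have hom : ∀ ω ∈ relSpace lam, ev ω (p.1.1 0) (p.1.2 0)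
      * (ev O (p.1.2 (-1)) (p.1.1 (-1)) - ev O (p.1.1 0) (p.1.2 0)) = 0 := by
    intro ω hω
    have h1 := frame_central (hQ.centralEq hL hσ) hQ.1 p hω
    obtain ⟨x, hx⟩ := p.2
    have h0 := hx 0
    have h2 := hx (-1)
    simp only [tw, neg_zero, zpow_zero, neg_neg, zpow_one, zpow_neg_one, Equiv.Perm.one_apply]
      at h0 h2
    have := hCO ω hω _ _ _ h0.2.1 _ h0.2.2.1 _ h2.2.2.1 _ h2.2.1
    linear_combination this - ev O (p.1.1 0) (p.1.2 0) * h1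
  have hz : ev O (p.1.2 (-1)) (p.1.1 (-1)) - ev O (p.1.1 0) (p.1.2 0) = 0 := by
    by_contra hne
    have hch : Chain (lv lam) (p.1.1 0) (p.1.2 0) :=
      chain_iff.2 fun ω hω => (mul_eq_zero.1 (hom ω hω)).resolve_right hne
    have := hQ.ev_eq_zero hL (frame_cone p 0).1 hch
    rw [frame_norm] at this
    exact one_ne_zero this
  rw [valMid]
  linear_combination hz

theorem repQ_OQ (hL : Distinct (lv lam)) :
    ((repQ (X := X) hσ hC hq (OQ lam)) : BigCross lam σ q X)
      = sgl lam σ q X 0 (valMid lam σ q X (Matrix.diagonal (om (lv lam)))) := by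
  rw [OQ, map_quad]
  simp only [repQ, liftQ_zQ]
  rw [val_quad_xC, quad_xB_of_vanish hσ fun y y' hy h => ev_om hL hy h]

theorem coefAt_OQ_pow_mul (hL : Distinct (lv lam)) (m : ℤ) (p : frames lam σ q X) (i : ℕ)
    (a : QuadAlg lam) :
    coefAt m p (repQ (X := X) hσ hC hq (OQ lam ^ i * a) : BigCross lam σ q X)
      = valMid lam σ q X (Matrix.diagonal (om (lv lam))) p ^ i
        * coefAt m p (repQ (X := X) hσ hC hq a : BigCross lam σ q X) := by
  induction i with
  | zero => rw [pow_zero, pow_zero, one_mul, one_mul]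
  | succ i ih =>
    have hs : shift lam σ q X 0 p = p := by
      apply Subtype.ext
      simp [shift]
    have h1 : ((repQ (X := X) hσ hC hq (OQ lam * (OQ lam ^ i * a))) : BigCross lam σ q X)
        = (repQ (X := X) hσ hC hq (OQ lam) : BigCross lam σ q X)
          * (repQ (X := X) hσ hC hq (OQ lam ^ i * a) : BigCross lam σ q X) := by
      rw [map_mul]; rfl
    rw [pow_succ', mul_assoc, h1, repQ_OQ hσ hC hq hL, coefAt_sgl_mul, sub_zero, hs, ih, pow_succ',
      mul_assoc]

/-! ### Frames over the real locus -/

theorem IsCurve.mem_zpow (hσ : IsCorrespondence lam σ) {v : Path lam} (hv : IsCurve v) (k : ℕ) :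
    v.1 k ∈ ((σ ^ (k : ℤ)) (pt (v.1 0) (hv 0).2 (hv 0).1)).1.submodule := by
  induction k with
  | zero => exact self_mem_pt _ (hv 0).2 (hv 0).1
  | succ k ih =>
    have h := (hσ.mem_iff ih (hv k).2).2 (v.2 k)
    rwa [← Equiv.Perm.mul_apply, ← zpow_one_add, add_comm, ← Nat.cast_succ] at h

/-- Every path on the curve is the path of a frame over the real locus. -/
theorem exists_frame (hq : IsPositive lam q) (hj : ∀ Z, jE lam (σ Z) = σ⁻¹ (jE lam Z))
    {v : Path lam} (hv : IsCurve v) : ∃ p : frames lam σ q (realLocus lam),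
      framePath hσ p = v ∧ p.1.2 0 = (ev q (v.1 0) (jV lam (v.1 0)))⁻¹ • jV lam (v.1 0) := by
  set Z := pt (v.1 0) (hv 0).2 (hv 0).1 with hZ
  let u : ℤ → Fin 4 → ℂ := fun k => if 0 ≤ k then v.1 k.toNat else ((σ ^ k) Z).1.rep
  have hu : ∀ k, u k ∈ ((σ ^ k) Z).1.submodule ∧ u k ≠ 0 := by
    intro k
    by_cases hk : 0 ≤ k
    · obtain ⟨n, rfl⟩ := Int.eq_ofNat_of_zero_le hk
      simp only [u, if_pos hk, Int.toNat_natCast]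
      exact ⟨hv.mem_zpow hσ n, (hv n).2⟩
    · simp only [u, if_neg hk]
      exact ⟨rep_mem _, Projectivization.rep_nonzero _⟩
  have hu' : ∀ n : ℕ, u n = v.1 n := fun n => by simp [u]
  refine ⟨⟨(u, fun k => (ev q (u k) (jV lam (u k)))⁻¹ • jV lam (u k)), (Z, jE lam Z), fun k => ?_⟩,
    Subtype.ext (funext hu'), ?_⟩
  · have e : (tw σ k (Z, jE lam Z)).2 = jE lam ((σ ^ k) Z) := (jE_zpow hj k Z).symm
    refine ⟨e, (hu k).1, ?_, ?_⟩
    · rw [e]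
      exact Submodule.smul_mem _ _ (mem_jE (hu k).1)
    · obtain ⟨r, hr, he⟩ := hq _ _ (hu k).1 (hu k).2
      have h0 : ev q (u k) (jV lam (u k)) ≠ 0 := by
        rw [he]; exact_mod_cast hr.ne'
      have := ev_smul_smul q 1 (ev q (u k) (jV lam (u k)))⁻¹ (u k) (jV lam (u k))
      rw [one_smul, one_mul, inv_mul_cancel₀ h0] at this
      exact this
  · rfl

end

/-! ### The representation of the three-sphere is faithful -/

section

variable {lam : Fin 4 → Circle} {σ : Equiv.Perm (curve lam)}

variable (lam) in
/-- The elements of the algebra of the three-sphere which are polynomials in `Ω` whose coefficients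
are of degree less than `N` in the generators. -/
def Filt (N : ℕ) : Submodule ℂ (SphereAlg lam (sphereForm lam)) :=
  Submodule.span ℂ {a | ∃ n < N, ∃ i, ∃ x ∈ Vn lam n, a = piS lam (sphereForm lam) (OQ lam ^ i * x)}

theorem Filt_zero : Filt lam 0 = ⊥ := by
  rw [Filt, Submodule.span_eq_bot]
  rintro a ⟨n, hn, -⟩
  exact absurd hn (Nat.not_lt_zero n)

theorem Filt_mono : Monotone (Filt lam) := fun _ _ h =>
  Submodule.span_mono fun _ ⟨n, hn, ha⟩ => ⟨n, hn.trans_le h, ha⟩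

theorem mem_Filt_of_mem {n N : ℕ} (hn : n < N) (i : ℕ) {x : QuadAlg lam} (hx : x ∈ Vn lam n) :
    piS lam (sphereForm lam) (OQ lam ^ i * x) ∈ Filt lam N :=
  Submodule.subset_span ⟨n, hn, i, x, hx, rfl⟩

/-- Since `C = 1` in the algebra of the three-sphere, the ideal generated by `C` and `Ω` lowers the
degree of the coefficients. -/
theorem mem_Filt_of_Jn (hL : Distinct (lv lam)) {n : ℕ} (i : ℕ) {x : QuadAlg lam}
    (hx : x ∈ Jn lam n) : piS lam (sphereForm lam) (OQ lam ^ i * x) ∈ Filt lam (n + 1) := by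
  obtain ⟨b, hb, c, hc, rfl⟩ := mem_Jn.1 hx
  have h1 : piS lam (sphereForm lam) (CQ lam) = 1 := by rw [CQ, piS_quad]; exact quad_zS
  have h2 : OQ lam ^ i * (CQ lam * b + OQ lam * c)
      = CQ lam * (OQ lam ^ i * b) + OQ lam ^ (i + 1) * c := by
    rw [mul_add, ← mul_assoc, ← CQ_commute hL, mul_assoc, pow_succ, mul_assoc (OQ lam ^ i)]
  rw [h2, map_add, map_mul, h1, one_mul]
  exact Submodule.add_mem _ (mem_Filt_of_mem n.lt_succ_self i hb)
    (mem_Filt_of_mem n.lt_succ_self (i + 1) hc)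

/-- The elements of the filtration have a leading part. -/
theorem exists_leading {N : ℕ} {a : SphereAlg lam (sphereForm lam)} (ha : a ∈ Filt lam (N + 1)) :
    ∃ b ∈ Filt lam N, ∃ M, ∃ x : ℕ → QuadAlg lam, (∀ i, x i ∈ Vn lam N) ∧
      a = b + ∑ i ∈ Finset.range (M + 1), piS lam (sphereForm lam) (OQ lam ^ i * x i) := by
  let T : (ℕ →₀ Vn lam N) →ₗ[ℂ] SphereAlg lam (sphereForm lam) := Finsupp.lsum ℂ fun i =>
    (piS lam (sphereForm lam)).toLinearMap ∘ₗ LinearMap.mulLeft ℂ (OQ lam ^ i) ∘ₗ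
      (Vn lam N).subtype
  have hle : Filt lam (N + 1) ≤ Filt lam N ⊔ LinearMap.range T := by
    refine Submodule.span_le.2 ?_
    rintro _ ⟨n, hn, i, x, hx, rfl⟩
    rcases (Nat.lt_succ_iff.1 hn).lt_or_eq with h | rfl
    · exact Submodule.mem_sup_left (mem_Filt_of_mem h i hx)
    · refine Submodule.mem_sup_right ⟨Finsupp.single i ⟨x, hx⟩, ?_⟩
      simp [T]
  obtain ⟨b, hb, _, ⟨f, rfl⟩, rfl⟩ := Submodule.mem_sup.1 (hle ha)
  refine ⟨b, hb, f.support.sup id, fun i => f i, fun i => (f i).2, ?_⟩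
  congr 1
  rw [Finsupp.lsum_apply, Finsupp.sum_of_support_subset f (fun i hi => ?_) _ (by simp)]
  · rfl
  · exact Finset.mem_range.2 (Nat.lt_succ_iff.2 (Finset.le_sup (f := id) hi))

theorem exists_mem_Filt (a : SphereAlg lam (sphereForm lam)) : ∃ N, a ∈ Filt lam N := by
  obtain ⟨x, rfl⟩ := piS_surjective a
  have hx : x ∈ Algebra.adjoin ℂ (Set.range (zQ lam)) := by rw [adjoin_zQ]; trivial
  rw [← Subalgebra.mem_toSubmodule, Algebra.adjoin_eq_span] at hx
  induction hx using Submodule.span_induction with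
  | mem x hx =>
    have : ∃ n, x ∈ Vn lam n := by
      induction hx using Submonoid.closure_induction with
      | mem x hx =>
        obtain ⟨μ, rfl⟩ := hx
        exact ⟨1, zQ_mem μ⟩
      | one => exact ⟨0, one_mem_Vn⟩
      | mul x y _ _ h1 h2 =>
        obtain ⟨m, hm⟩ := h1
        obtain ⟨n, hn⟩ := h2
        exact ⟨m + n, mul_mem_Vn hm hn⟩
    obtain ⟨n, hn⟩ := this
    have := mem_Filt_of_mem n.lt_succ_self 0 hn
    rw [pow_zero, one_mul] at this
    exact ⟨_, this⟩
  | zero => exact ⟨0, by rw [map_zero]; exact Submodule.zero_mem _⟩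
  | add x y _ _ h1 h2 =>
    obtain ⟨m, hm⟩ := h1
    obtain ⟨n, hn⟩ := h2
    refine ⟨max m n, ?_⟩
    rw [map_add]
    exact Submodule.add_mem _ (Filt_mono (le_max_left m n) hm) (Filt_mono (le_max_right m n) hn)
  | smul c x _ h =>
    obtain ⟨n, hn⟩ := h
    refine ⟨n, ?_⟩
    rw [map_smul]
    exact Submodule.smul_mem _ _ hn

theorem rep_piS {q : Matrix (Fin 4) (Fin 4) ℂ} {X : Set (curve lam × curve lam)}
    (hL : Distinct (lv lam)) (hσ : IsCorrespondence lam σ) (hq : IsCentralQuad lam q)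
    {c : Matrix (Fin 4) (Fin 4) ℂ} (hc : (2 : ℂ) • c = q) (a : QuadAlg lam) :
    rep (X := X) hL hσ hq hc (piS lam c a) = repQ hσ (hq.centralEq hL hσ) hq.1 a := by
  rw [rep, piS, RingQuot.liftAlgHom_mkAlgHom_apply]

/-- The value at a frame of the coefficient of `Wᵐ`, on the algebra of the three-sphere. -/
def repAt (hL : Distinct (lv lam)) (hσ : IsCorrespondence lam σ) (m : ℤ)
    (p : frames lam σ ((2 : ℂ) • sphereForm lam) (realLocus lam)) :
    SphereAlg lam (sphereForm lam) →ₗ[ℂ] ℂ :=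
  coefAt m p ∘ₗ (CrossProd lam σ ((2 : ℂ) • sphereForm lam) (realLocus lam)).val.toLinearMap ∘ₗ
    (rep (X := realLocus lam) hL hσ (isCentralQuad_sphere hL)
      (c := sphereForm lam) rfl).toLinearMap

theorem repAt_piS (hL : Distinct (lv lam)) (hσ : IsCorrespondence lam σ) (m : ℤ)
    (p : frames lam σ ((2 : ℂ) • sphereForm lam) (realLocus lam)) (i : ℕ) (x : QuadAlg lam) :
    repAt hL hσ m p (piS lam (sphereForm lam) (OQ lam ^ i * x))
      = (2 * ev (Matrix.diagonal (om (lv lam))) (p.1.1 0) (p.1.2 0)) ^ i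
        * coefAt m p (repQ (X := realLocus lam) hσ ((isCentralQuad_sphere hL).centralEq hL hσ)
          (isCentralQuad_sphere hL).1 x : BigCross lam σ _ (realLocus lam)) := by
  have h1 : repAt hL hσ m p (piS lam (sphereForm lam) (OQ lam ^ i * x))
      = coefAt m p (rep (X := realLocus lam) hL hσ (isCentralQuad_sphere hL) (c := sphereForm lam)
        rfl (piS lam (sphereForm lam) (OQ lam ^ i * x)) : BigCross lam σ _ (realLocus lam)) := rfl
  rw [h1, rep_piS, coefAt_OQ_pow_mul _ _ _ hL, valMid_om hL hσ (isCentralQuad_sphere hL)]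

theorem repAt_of_mem_Filt (hL : Distinct (lv lam)) (hσ : IsCorrespondence lam σ) {N : ℕ} {m : ℤ}
    (hm : N ≤ m) (p : frames lam σ ((2 : ℂ) • sphereForm lam) (realLocus lam))
    {a : SphereAlg lam (sphereForm lam)} (ha : a ∈ Filt lam N) : repAt hL hσ m p a = 0 := by
  have hle : Filt lam N ≤ LinearMap.ker (repAt hL hσ m p) := by
    refine Submodule.span_le.2 ?_
    rintro _ ⟨n, hn, i, x, hx, rfl⟩
    rw [SetLike.mem_coe, LinearMap.mem_ker, repAt_piS,
      coefAt_repQ_of_lt _ _ _ hx (by omega), mul_zero]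
  exact hle ha

/-- The leading part of an element of the kernel belongs to the ideal generated by `C` and `Ω`, and
hence can be lowered. -/
theorem mem_Filt_of_rep_eq_zero (hL : Distinct (lv lam)) (hσ : IsCorrespondence lam σ)
    (hj : ∀ Z, jE lam (σ Z) = σ⁻¹ (jE lam Z)) (hc : ∀ k, k ≠ 0 → cc (lv lam) k ≠ 0) {N : ℕ}
    {a : SphereAlg lam (sphereForm lam)} (ha : a ∈ Filt lam (N + 1))
    (h : ∀ m p, repAt hL hσ m p a = 0) : a ∈ Filt lam N := by
  obtain ⟨b, hb, M, x, hx, rfl⟩ := exists_leading ha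
  refine Submodule.add_mem _ hb (Submodule.sum_mem _ fun i hi => ?_)
  have hvan : ∀ v : Path lam, IsCurve v → ∀ i ≤ M, pathEval v (x i) = 0 := by
    refine fun v hv => pathEval_eq_zero_of_sum hL (hc 1 (by decide)) hx (fun w hw => ?_) hv
    obtain ⟨p, hp, hp'⟩ := exists_frame hσ isPositive_sphere hj hw
    have hp0 : p.1.1 0 = w.1 0 := congrFun (congrArg Subtype.val hp) 0
    have h1 := h N p
    rw [map_add, repAt_of_mem_Filt hL hσ le_rfl p hb, zero_add, map_sum] at h1
    simp only [repAt_piS, coefAt_repQ _ _ _ (hx _), hp] at h1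
    set y := w.1 0 with hy
    set O := ev (Matrix.diagonal (om (lv lam))) y (jV lam y) with hO
    set C := ev (sphereForm lam) y (jV lam y) with hC
    have hC0 : C ≠ 0 := by
      obtain ⟨r, hr, he⟩ := isPositive_sphere (lam := lam) _ _
        (self_mem_pt y (hw 0).2 (hw 0).1) (hw 0).2
      rw [ev_smul] at he
      intro h0
      rw [← hC, h0, mul_zero] at he
      exact hr.ne (by exact_mod_cast he)
    have hval : 2 * ev (Matrix.diagonal (om (lv lam))) (p.1.1 0) (p.1.2 0) = O / C := by
      have := ev_smul_smul (Matrix.diagonal (om (lv lam))) 1 (2 * C)⁻¹ y (jV lam y)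
      rw [one_smul, one_mul] at this
      rw [hp0, hp', ev_smul, ← hC, this, ← hO]
      field_simp
    rw [hval] at h1
    rw [← mul_zero (C ^ M), ← h1, Finset.mul_sum]
    refine Finset.sum_congr rfl fun i hi => ?_
    rw [div_pow, ← pow_sub_mul_pow C (Nat.lt_succ_iff.1 (Finset.mem_range.1 hi))]
    field_simp
  have hvi := fun v hv => hvan v hv i (Nat.lt_succ_iff.1 (Finset.mem_range.1 hi))
  match N, hx with
  | 0, hx => rw [eq_zero_of_vanish_zero hL (hx i) hvi, mul_zero, map_zero]; exact Submodule.zero_mem _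
  | 1, hx => rw [eq_zero_of_vanish_one hL (hx i) hvi, mul_zero, map_zero]; exact Submodule.zero_mem _
  | n + 2, hx =>
    exact Filt_mono (Nat.le_succ _) (mem_Filt_of_Jn hL i (mem_Jn_of_vanish hL hc (hx i) hvi))

/-- The degree of an element of the kernel can be lowered until nothing is left. -/
theorem rep_injective (hL : Distinct (lv lam)) (hσ : IsCorrespondence lam σ)
    (hj : ∀ Z, jE lam (σ Z) = σ⁻¹ (jE lam Z)) (h4 : σ ^ 4 ≠ 1) :
    Function.Injective (rep (X := realLocus lam) hL hσ (isCentralQuad_sphere hL)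
      (c := sphereForm lam) rfl) := by
  refine (injective_iff_map_eq_zero _).2 fun a ha => ?_
  have h : ∀ m p, repAt hL hσ m p a = 0 := by
    intro m p
    have h1 : repAt hL hσ m p a = coefAt m p (rep (X := realLocus lam) hL hσ
      (isCentralQuad_sphere hL) (c := sphereForm lam) rfl a : BigCross lam σ _ (realLocus lam)) := rfl
    rw [h1, ha]
    exact map_zero (coefAt m p)
  have hmem : ∀ N, a ∈ Filt lam N → a = 0 := by
    intro N
    induction N with
    | zero => rw [Filt_zero, Submodule.mem_bot]; exact id
    | succ N ih =>
      exact fun hN => ih (mem_Filt_of_rep_eq_zero hL hσ hj (fun k hk =>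
        cc_ne_of_pow_four hL hσ h4 hk) hN h)
  obtain ⟨N, hN⟩ := exists_mem_Filt a
  exact hmem N hN

end

end NCSphere

end

theorem mainTheorem5 (lam : Fin 4 → Circle)
    (hlam : ∀ μ ν, μ ≠ ν → (lam μ : ℂ) ^ 2 ≠ (lam ν : ℂ) ^ 2) :
    -- the geometric data
    Uncountable (NCSphere.curve lam) ∧
    ∃ σ : Equiv.Perm (NCSphere.curve lam), NCSphere.IsCorrespondence lam σ ∧
      (∀ Z, NCSphere.jE lam (σ Z) = σ⁻¹ (NCSphere.jE lam Z)) ∧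
      -- a quadratic element of the algebra is given by a unique symmetric matrix
      (∀ c : Matrix (Fin 4) (Fin 4) ℂ, ∃! q : Matrix (Fin 4) (Fin 4) ℂ,
        q.IsSymm ∧ NCSphere.quad (NCSphere.zQ lam) q = NCSphere.quad (NCSphere.zQ lam) c) ∧
      -- central quadratic elements give central quadratic forms
      (∀ q, NCSphere.IsCentralQuad lam q → NCSphere.CentralEq lam σ q) ∧
      (σ ^ 4 ≠ 1 →
        -- the representation over `E × E`
        (∀ q, NCSphere.IsCentralQuad lam q → q ≠ 0 →
          {Z : NCSphere.curve lam | ¬ {Z' : NCSphere.curve lam | ∃ k : ℤ,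
            NCSphere.ev q ((σ ^ k) Z).1.rep ((σ ^ (-k)) Z').1.rep = 0}.Countable}.Countable ∧
          ∃ ρ : NCSphere.SphereAlg lam ((1 / 2 : ℂ) • q) →ₐ[ℂ]
              NCSphere.CrossProd lam σ q Set.univ,
            NCSphere.HasFormula ρ ∧
            ρ ((1 / 2 : ℂ) • NCSphere.quad (NCSphere.zS lam ((1 / 2 : ℂ) • q)) q) = 1 ∧
            (NCSphere.IsReal lam q → NCSphere.IsStarRep ρ)) ∧
        -- the representation over the points `(Z, j(Z))`
        (∀ q, NCSphere.IsCentralQuad lam q → NCSphere.IsReal lam q → NCSphere.IsPositive lam q →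
          ∃ ρ : NCSphere.SphereAlg lam ((1 / 2 : ℂ) • q) →ₐ[ℂ]
              NCSphere.CrossProd lam σ q (NCSphere.realLocus lam),
            NCSphere.HasFormula ρ ∧ NCSphere.IsStarRep ρ) ∧
        -- the faithful representation of the algebra of the sphere
        (NCSphere.IsCentralQuad lam ((2 : ℂ) • NCSphere.sphereForm lam) ∧
          NCSphere.IsReal lam ((2 : ℂ) • NCSphere.sphereForm lam) ∧
          NCSphere.IsPositive lam ((2 : ℂ) • NCSphere.sphereForm lam) ∧
          ∃ ρ : NCSphere.SphereAlg lam (NCSphere.sphereForm lam) →ₐ[ℂ]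
              NCSphere.CrossProd lam σ ((2 : ℂ) • NCSphere.sphereForm lam)
                (NCSphere.realLocus lam),
            NCSphere.HasFormula ρ ∧ NCSphere.IsStarRep ρ ∧ Function.Injective ρ)) := by
  have hL : NCSphere.Distinct (NCSphere.lv lam) := hlam
  obtain ⟨σ, hσ, hj⟩ := NCSphere.exists_correspondence hL
  have hS := NCSphere.isCentralQuad_sphere hL
  refine ⟨NCSphere.uncountable_curve hL, σ, hσ, hj, NCSphere.existsUnique_symm hL,
    fun q hq => hq.centralEq hL hσ, fun h4 => ⟨fun q hq hq0 => ?_, fun q hq hr hp => ?_, ?_⟩⟩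
  · have hc : (2 : ℂ) • ((1 / 2 : ℂ) • q) = q := by rw [smul_smul]; norm_num
    refine ⟨NCSphere.countable_exceptional hL hq0, NCSphere.rep hL hσ hq hc,
      NCSphere.rep_hasFormula hL hσ hq hc, ?_,
      fun hr => NCSphere.rep_isStarRep hL hσ hq hc hr hj fun _ _ => trivial⟩
    rw [← NCSphere.quad_smul, NCSphere.quad_zS, map_one]
  · have hc : (2 : ℂ) • ((1 / 2 : ℂ) • q) = q := by rw [smul_smul]; norm_num
    exact ⟨NCSphere.rep hL hσ hq hc, NCSphere.rep_hasFormula hL hσ hq hc,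
      NCSphere.rep_isStarRep hL hσ hq hc hr hj NCSphere.realLocus_invariant⟩
  · exact ⟨hS, NCSphere.isReal_sphere, NCSphere.isPositive_sphere, NCSphere.rep hL hσ hS rfl,
      NCSphere.rep_hasFormula hL hσ hS rfl,
      NCSphere.rep_isStarRep hL hσ hS rfl NCSphere.isReal_sphere hj NCSphere.realLocus_invariant,
      NCSphere.rep_injective hL hσ hj h4⟩
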